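/- **Setting.** Let $\mu$ be a probability measure on a measurable space $\mathcal X$, let $(e_j)_{j\ge1}$ be an orthonormal basis of $L^2(\mathcal X,\mu)$, and let $f^*=\sum_{j\ge1}\theta^*_je_j\in L^2(\mathcal X,\mu)$ with $\theta_j^*=\langle f^*,e_j\rangle_{L^2(\mu)}$. Let $(x_i,\varepsilon_i)_{i=1}^n$ be i.i.d., where $x_i\sim\mu$ and, given $x_i$, the noise $\varepsilon_i$ has mean zero and is $\sigma^2$-sub-Gaussian, and let $y_i=f^*(x_i)+\varepsilon_i$. Assume: 1. $|e_j|\le C_{\mathrm{eigf}}$ $\mu$-a.e. for all $j$, and $c_{\mathrm{eig}}\,j^{-\gamma}\le\lambda_j\le C_{\mathrm{eig}}\,j^{-\gamma}$ for all $j\ge1$, where $\gamma>1$ and $C_{\mathrm{eigf}},c_{\mathrm{eig}},C_{\mathrm{eig}}>0$. 2. With $J(\delta)=\{j:|\theta_j^*|\ge\delta\}$: $|\theta^*_j|\le B_\infty$ for all $j$, and for all $\delta>0$ every $j\in J(\delta)$ satisfies $j\le B_{\mathrm{spn}}\,\delta^{-\kappa}$, and $|J(\delta)|\le B_{\mathrm{sig}}\,\delta^{-(1-s_0)}$,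 where $\kappa\ge1$ and $B_{\mathrm{spn}},B_{\mathrm{sig}},s_0>0$. Let $D\ge0$ be an integer and $b_0>0$. For sequences $a,b,\beta$ put $f_{a,b,\beta}(x)=\sum_{j\ge1}a_jb_j^De_j(x)\beta_j$ and $\mathcal L_n(a,b,\beta)=\frac1{2n}\sum_{i=1}^n(y_i-f_{a,b,\beta}(x_i))^2$. Consider the gradient flow $$\dot a=-\nabla_a\mathcal L_n,\qquad \dot b=-\nabla_b\mathcal L_n,\qquad \dot\beta=-\nabla_\beta\mathcal L_n,\qquad a_j(0)=\lambda_j^{1/2},\quad b_j(0)=b_0,\quad \beta_j(0)=0,$$ where $a$, $b-b_0$ and $\beta$ are continuous curves in $\ell^2$. (For $D=0$ we have $b_j^D=1$, and only $a$ and $\beta$ are trained.) **Proposition.** Let $s>0$ and let $0<c_t\le C_t$, $0<c_b\le C_b$. There are constants $c_1,C_1,C_2,C_3,C>0$ and $N$, depending only on $D$, $s$, $\sigma$, $c_t,C_t,c_b,C_b$ and the constants in assumptions 1 and 2 (in particular not on $n$ or $k$), such that for all $n\ge N$, all $t\in[c_t,C_t]\cdot n^{\frac{D+1}{D+2}}$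 and all $b_0\in[c_b,C_b]\cdot n^{-\frac1{2(D+2)}}$, with probability at least $1-C/n^2$ the following holds: the gradient flow exists on $[0,t]$, and every such flow satisfies, simultaneously for all $k\ge1$: * (signal component) if $|\theta^*_k|\ge C_1n^{-1/2}\ln n$, then $$a_k(t)\,b_k^D(t)\ge c_1|\theta_k^*|^{\frac{D+1}{D+2}};$$ * (noise component) if $|\theta_k^*|\le n^{-1/2}$ and $\lambda_k\le n^{-\frac{1+s}{D+2}}$, then $$a_k(t)\,b_k^D(t)\le C_2\,a_k(0)\,b_k^D(0)\exp\!\big(C_3(\sqrt{\ln n}+\sqrt{\ln k})\big).$$ -/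

import Mathlib

open MeasureTheory ProbabilityTheory Filter Topology Set

open scoped NNReal ENNReal

namespace DiagKernel

noncomputable section

/-- The functions `e 1, e 2, …` form (up to null sets) an orthonormal basis of `L²(X, μ)`. -/
def IsL2Basis {X : Type*} [MeasurableSpace X] (μ : Measure X) (e : ℕ+ → X → ℝ) : Prop :=
  ∃ B : HilbertBasis ℕ+ ℝ (Lp ℝ 2 μ), ∀ j, (B j : X → ℝ) =ᵐ[μ] e j

/-- The coefficient `θ*_j = ⟨f, e_j⟩` of `f` in `L²(X, μ)`. -/
def coeff {X : Type*} [MeasurableSpace X] (μ : Measure X) (e : ℕ+ → X → ℝ) (f : X → ℝ)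
    (j : ℕ+) : ℝ :=
  ∫ x, f x * e j x ∂μ

/-- Uniformly bounded eigenfunctions and polynomially decaying eigenvalues. -/
structure EigenSystem {X : Type*} [MeasurableSpace X] (μ : Measure X) (e : ℕ+ → X → ℝ)
    (lam : ℕ+ → ℝ) (Ceigf ceig Ceig γ : ℝ) : Prop where
  bounded : ∀ j, ∀ᵐ x ∂μ, |e j x| ≤ Ceigf
  lower : ∀ j : ℕ+, ceig * (j : ℝ) ^ (-γ) ≤ lam j
  upper : ∀ j : ℕ+, lam j ≤ Ceig * (j : ℝ) ^ (-γ)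

/-- The index set `J_sig(δ)` of the coefficients of size at least `δ`. -/
def sigSet (θ : ℕ+ → ℝ) (δ : ℝ) : Set ℕ+ := {j | δ ≤ |θ j|}

/-- The assumption on the true coefficients. By `span` the sets `sigSet θ δ`, `δ > 0`, are finite,
so that `Set.ncard` in `decay` is their true cardinality. -/
structure SignalSpan (θ : ℕ+ → ℝ) (Binf κ Bspn s₀ Bsig : ℝ) : Prop where
  bounded : ∀ j, |θ j| ≤ Binf
  span : ∀ δ : ℝ, 0 < δ → ∀ j ∈ sigSet θ δ, ((j : ℕ) : ℝ) ≤ Bspn * δ ^ (-κ)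
  decay : ∀ δ : ℝ, 0 < δ → ((sigSet θ δ).ncard : ℝ) ≤ Bsig * δ ^ (-(1 - s₀))

/-- The law of `n` i.i.d. pairs `(x_i, ε_i)`, where `x_i ∼ μ` and `ε_i ∼ ν x_i` given `x_i`. -/
def sampleLaw {X : Type*} [MeasurableSpace X] (μ : Measure X) (ν : Kernel X ℝ) (n : ℕ) :
    Measure (Fin n → X × ℝ) :=
  Measure.pi fun _ => μ ⊗ₘ ν

/-- The predictor `⟨Φ_{a,b}(x), β⟩` with the feature map `Φ_{a,b}(x) = (a_j b_j^D e_j(x))_j`. -/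
def predictor {X : Type*} (e : ℕ+ → X → ℝ) (D : ℕ) (a b β : ℕ+ → ℝ) (x : X) : ℝ :=
  ∑' j, (a j * b j ^ D * e j x) * β j

/-- The empirical loss `(1 / 2n) ∑ i, (y_i - f(x_i))²` of the predictor, where
`y_i = f*(x_i) + ε_i` and `z i = (x_i, ε_i)`. -/
def loss {X : Type*} (e : ℕ+ → X → ℝ) (D : ℕ) (fstar : X → ℝ) {n : ℕ} (z : Fin n → X × ℝ)
    (a b β : ℕ+ → ℝ) : ℝ :=
  1 / (2 * (n : ℝ)) *
    ∑ i, ((fstar (z i).1 + (z i).2) - predictor e D a b β (z i).1) ^ 2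

/-- The gradient (the sequence of the partial derivatives) of a function of a sequence. -/
def grad (F : (ℕ+ → ℝ) → ℝ) (v : ℕ+ → ℝ) : ℕ+ → ℝ :=
  fun j => deriv (fun u => F (Function.update v j u)) (v j)

/-- `v`, restricted to `[0, T]`, is a continuous curve in `ℓ²`. -/
def IsL2Curve (T : ℝ) (v : ℝ → ℕ+ → ℝ) : Prop :=
  ∃ V : ℝ → lp (fun _ : ℕ+ => ℝ) 2,
    ContinuousOn V (Icc 0 T) ∧ ∀ t ∈ Icc 0 T, ∀ j, V t j = v t j

/-- `(a, b, β)` is the gradient flow of the empirical loss on `[0, T]`, started at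
`a_j(0) = λ_j^{1/2}`, `b_j(0) = b₀`, `β_j(0) = 0`. The curves `a`, `b - b₀`, `β` live in `ℓ²`
(so that all series defining the loss converge when the `e_j` are uniformly bounded). For `D = 0`
one has `b_j ^ D = 1`, the predictor does not depend on `b`, and `(a, β)` is the gradient flow of
the model with the feature map `(a_j e_j(x))_j`. -/
structure IsGradientFlow {X : Type*} (e : ℕ+ → X → ℝ) (lam : ℕ+ → ℝ) (D : ℕ) (b₀ : ℝ)
    (fstar : X → ℝ) {n : ℕ} (z : Fin n → X × ℝ) (T : ℝ) (a b β : ℝ → ℕ+ → ℝ) : Prop where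
  init_a : ∀ j, a 0 j = √(lam j)
  init_b : ∀ j, b 0 j = b₀
  init_β : ∀ j, β 0 j = 0
  curve_a : IsL2Curve T a
  curve_b : IsL2Curve T (fun t j => b t j - b₀)
  curve_β : IsL2Curve T β
  deriv_a : ∀ t ∈ Icc 0 T, ∀ j, HasDerivWithinAt (fun τ => a τ j)
    (-grad (fun a' => loss e D fstar z a' (b t) (β t)) (a t) j) (Icc 0 T) t
  deriv_b : ∀ t ∈ Icc 0 T, ∀ j, HasDerivWithinAt (fun τ => b τ j)
    (-grad (fun b' => loss e D fstar z (a t) b' (β t)) (b t) j) (Icc 0 T) t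
  deriv_β : ∀ t ∈ Icc 0 T, ∀ j, HasDerivWithinAt (fun τ => β τ j)
    (-grad (fun β' => loss e D fstar z (a t) (b t) β') (β t) j) (Icc 0 T) t

end

end DiagKernel

/-! For one coordinate put `θ = a b^D β`. The flow reads `a' = b^D β g`, `b' = D a b^(D-1) β g`, `β'
= a b^D g`, where `g` is the empirical correlation of the residuals with `e_k`. Hence `a² - β²` and
`b² - D β²` are conserved, and `log (a + β)` has derivative `b^D g`.

On a good sample `g_k = θ*_k - θ_k + h_k`, where `h_k` is the noise average plus `∑_j (θ*_j - θ_j)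
Δ_jk`, and `Δ` is the empirical Gram matrix minus the identity. Up to a constant, the entries of
noise and `Δ` are at most `(√ln n + √ln j + √ln k) n^(-1/2)` (without the `j` term for the noise).
The deviation `h_k` is thus of order `(√ln n + √ln k) n^(-1/2)` as soon as `∑_j |θ*_j - θ_j| (1 +
√ln j)` is bounded. This is proved by a bootstrap in time: if `|h_k| ≤ H (√ln n + √ln k) n^(-1/2)`
for all `k` up to time `t`, then the weighted sum is at most a constant `M` that does not depend on
`H` once `n` is large (`weighted_error_bound`). Taking `H` twice what `M` yields makes the
hypothesis improve itself (`bootstrap`, `residual_bound`).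

Given the bound on `h`, the scaling `b₀^D t n^(-1/2) ≍ 1` decides everything. In a noise coordinate
the driving force is of order `(√ln n + √ln k) n^(-1/2)`, so up to time `t` the logarithm of `a ± β`
gains only `O(√ln n + √ln k)` (`noise_component`). In a signal coordinate `|h_k| ≤ |θ*_k| / 4`; as
long as `θ_k` is less than half of `θ*_k`, `a + β` (up to reflection) grows exponentially at a rate
which produces any prescribed power of `n` before time `t`. So `θ_k` reaches half its target and
stays beyond it, and the conservation laws turn this into a bound on `a b^D` (`signal_component`).

Existence: the conservation laws express `a` and `b` through `β`, leaving one equation in `ℓ²` whose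
vector field is Lipschitz on balls and has bounded radial part (`exists_flow_of_inner_le`). Good
samples have the required probability by a sub-Gaussian tail bound and a union bound over all pairs
`(j, k)`. -/

namespace DiagKernel

noncomputable section

/-! ### Scalar differential inequalities and continuous induction -/

/-- A function that does not increase while it lies above the level `c` never rises above `c`. -/
theorem le_of_deriv_nonpos_above {f f' : ℝ → ℝ} {s T c : ℝ}
    (hf : ∀ t ∈ Icc s T, HasDerivWithinAt f (f' t) (Icc s T) t) (h0 : f s ≤ c)
    (hc : ∀ t ∈ Icc s T, c < f t → f' t ≤ 0) : ∀ t ∈ Icc s T, f t ≤ c := by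
  intro t ht
  by_contra! hlt
  have hcont : ContinuousOn f (Icc s T) := fun t ht => (hf t ht).continuousWithinAt
  set S : Set ℝ := Icc s t ∩ f ⁻¹' Iic c with hS
  have hcl : IsClosed S :=
    (hcont.mono (Icc_subset_Icc_right ht.2)).preimage_isClosed_of_isClosed isClosed_Icc isClosed_Iic
  have hcomp : IsCompact S := isCompact_Icc.of_isClosed_subset hcl inter_subset_left
  have hne : S.Nonempty := ⟨s, ⟨le_rfl, ht.1⟩, h0⟩
  obtain ⟨u, hu, hmax⟩ := hcomp.exists_isGreatest hne
  have hut : u ≤ t := hu.1.2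
  have habove : ∀ x ∈ Ioc u t, c < f x := fun x hx => by
    by_contra! hle
    exact absurd (hmax ⟨⟨hu.1.1.trans hx.1.le, hx.2⟩, hle⟩) (not_le.2 hx.1)
  have hsub : Icc u t ⊆ Icc s T := Icc_subset_Icc hu.1.1 ht.2
  have hanti : AntitoneOn f (Icc u t) := by
    refine antitoneOn_of_hasDerivWithinAt_nonpos (f' := f') (convex_Icc u t) (hcont.mono hsub) ?_ ?_
    · intro x hx
      exact (hf x (hsub (interior_subset hx))).mono (interior_subset.trans hsub)
    · intro x hx
      rw [interior_Icc] at hx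
      exact hc x (hsub (Ioo_subset_Icc_self hx)) (habove x (Ioo_subset_Ioc_self hx))
  have := hanti ⟨le_rfl, hut⟩ ⟨hut, le_rfl⟩ hut
  exact absurd (this.trans hu.2) (not_le.2 hlt)

/-- Continuous induction: a property that improves itself and depends continuously on time holds on
the whole interval. -/
theorem continuous_induction {T : ℝ} {P Q : ℝ → Prop}
    (himp : ∀ t ∈ Icc 0 T, (∀ s ∈ Icc 0 t, s ≠ t → Q s) → P t)
    (hopen : ∀ t ∈ Icc 0 T, P t → ∃ δ > 0, ∀ s ∈ Icc t (t + δ), s ≤ T → Q s) :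
    ∀ t ∈ Icc 0 T, Q t := by
  by_contra! hcon
  obtain ⟨t₁, ht₁, hQ₁⟩ := hcon
  set S : Set ℝ := {t | t ∈ Icc 0 T ∧ ¬ Q t} with hS
  have hbdd : BddBelow S := ⟨0, fun t ht => ht.1.1⟩
  have hne : S.Nonempty := ⟨t₁, ht₁, hQ₁⟩
  have hmem : sInf S ∈ Icc 0 T :=
    ⟨le_csInf hne fun t ht => ht.1.1, (csInf_le hbdd ⟨ht₁, hQ₁⟩).trans ht₁.2⟩
  have hbelow : ∀ s ∈ Icc 0 (sInf S), s ≠ sInf S → Q s := fun s hs hne' => by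
    by_contra hq
    exact hne' (le_antisymm hs.2 (csInf_le hbdd ⟨⟨hs.1, hs.2.trans hmem.2⟩, hq⟩))
  obtain ⟨δ, hδ, h⟩ := hopen _ hmem (himp _ hmem hbelow)
  obtain ⟨t, ht, htlt⟩ := exists_lt_of_csInf_lt hne (lt_add_of_pos_right (sInf S) hδ)
  exact ht.2 (h t ⟨csInf_le hbdd ht, htlt.le⟩ ht.1.2)

theorem eq_of_deriv_zero_on_Icc {f : ℝ → ℝ} {T : ℝ}
    (hf : ∀ t ∈ Icc 0 T, HasDerivWithinAt f 0 (Icc 0 T) t) : ∀ t ∈ Icc 0 T, f t = f 0 := by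
  intro t ht
  have h0 : (0 : ℝ) ≤ T := ht.1.trans ht.2
  refine le_antisymm (le_of_deriv_nonpos_above (f' := fun _ => 0) hf le_rfl (by simp) t ht) ?_
  have := le_of_deriv_nonpos_above (f := fun t => - f t) (f' := fun _ => 0) (c := - f 0)
    (fun t ht => (hf t ht).neg.congr_deriv neg_zero) le_rfl (by simp) t ht
  linarith

/-! ### Dynamics of a single coordinate -/

/-- One coordinate of the gradient flow, driven by the scalar function `g`. -/
structure CoordFlow (D : ℕ) (l b₀ T : ℝ) (a b β g : ℝ → ℝ) : Prop where
  init_a : a 0 = √l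
  init_b : b 0 = b₀
  init_β : β 0 = 0
  deriv_a : ∀ t ∈ Icc 0 T, HasDerivWithinAt a (b t ^ D * β t * g t) (Icc 0 T) t
  deriv_b : ∀ t ∈ Icc 0 T, HasDerivWithinAt b (D * a t * b t ^ (D - 1) * β t * g t) (Icc 0 T) t
  deriv_β : ∀ t ∈ Icc 0 T, HasDerivWithinAt β (a t * b t ^ D * g t) (Icc 0 T) t

namespace CoordFlow

variable {D : ℕ} {l b₀ T : ℝ} {a b β g : ℝ → ℝ}

theorem mono (h : CoordFlow D l b₀ T a b β g) {S : ℝ} (hS : S ≤ T) :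
    CoordFlow D l b₀ S a b β g where
  init_a := h.init_a
  init_b := h.init_b
  init_β := h.init_β
  deriv_a t ht := (h.deriv_a t ⟨ht.1, ht.2.trans hS⟩).mono (Icc_subset_Icc_right hS)
  deriv_b t ht := (h.deriv_b t ⟨ht.1, ht.2.trans hS⟩).mono (Icc_subset_Icc_right hS)
  deriv_β t ht := (h.deriv_β t ⟨ht.1, ht.2.trans hS⟩).mono (Icc_subset_Icc_right hS)

/-- The reflection `β ↦ -β`, `g ↦ -g` reduces negative targets to positive ones and turns estimates
of `a + β` into estimates of `a - β`. -/
theorem neg (h : CoordFlow D l b₀ T a b β g) :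
    CoordFlow D l b₀ T a b (fun t => - β t) (fun t => - g t) where
  init_a := h.init_a
  init_b := h.init_b
  init_β := by simp [h.init_β]
  deriv_a t ht := by exact (h.deriv_a t ht).congr_deriv (by ring)
  deriv_b t ht := by exact (h.deriv_b t ht).congr_deriv (by ring)
  deriv_β t ht := by exact (h.deriv_β t ht).neg.congr_deriv (by ring)

theorem a_sq (h : CoordFlow D l b₀ T a b β g) (hl : 0 < l) :
    ∀ t ∈ Icc 0 T, a t ^ 2 = l + β t ^ 2 := by
  intro t ht
  have := eq_of_deriv_zero_on_Icc (f := fun t => a t ^ 2 - β t ^ 2) (T := T) (fun t ht => by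
    refine (((h.deriv_a t ht).pow 2).sub ((h.deriv_β t ht).pow 2)).congr_deriv ?_
    push_cast; ring) t ht
  simp only [h.init_a, h.init_β, Real.sq_sqrt hl.le] at this
  linarith

theorem b_sq (h : CoordFlow D l b₀ T a b β g) :
    ∀ t ∈ Icc 0 T, b t ^ 2 = b₀ ^ 2 + D * β t ^ 2 := by
  intro t ht
  have := eq_of_deriv_zero_on_Icc (f := fun t => b t ^ 2 - D * β t ^ 2) (T := T) (fun t ht => by
    refine (((h.deriv_b t ht).pow 2).sub
      (((h.deriv_β t ht).pow 2).const_mul (D : ℝ))).congr_deriv ?_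
    rcases D with _ | D
    · simp
    · push_cast; ring_nf) t ht
  simp only [h.init_b, h.init_β] at this
  linarith

theorem a_cont (h : CoordFlow D l b₀ T a b β g) : ContinuousOn a (Icc 0 T) :=
  fun t ht => (h.deriv_a t ht).continuousWithinAt

theorem b_cont (h : CoordFlow D l b₀ T a b β g) : ContinuousOn b (Icc 0 T) :=
  fun t ht => (h.deriv_b t ht).continuousWithinAt

theorem β_cont (h : CoordFlow D l b₀ T a b β g) : ContinuousOn β (Icc 0 T) :=
  fun t ht => (h.deriv_β t ht).continuousWithinAt

theorem pos_of_sq_pos {f : ℝ → ℝ} (hf : ContinuousOn f (Icc 0 T)) (h0 : 0 < f 0)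
    (hne : ∀ t ∈ Icc 0 T, f t ≠ 0) : ∀ t ∈ Icc 0 T, 0 < f t := by
  intro t ht
  by_contra! hle
  obtain ⟨u, hu, hfu⟩ := intermediate_value_Icc' ht.1 (hf.mono (Icc_subset_Icc_right ht.2))
    (⟨hle, h0.le⟩ : (0 : ℝ) ∈ Icc (f t) (f 0))
  exact hne u ⟨hu.1, hu.2.trans ht.2⟩ hfu

theorem a_pos (h : CoordFlow D l b₀ T a b β g) (hl : 0 < l) : ∀ t ∈ Icc 0 T, 0 < a t := by
  refine pos_of_sq_pos h.a_cont (by rw [h.init_a]; positivity) fun t ht h0 => ?_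
  have := h.a_sq hl t ht
  rw [h0] at this
  nlinarith [sq_nonneg (β t)]

theorem b_pos (h : CoordFlow D l b₀ T a b β g) (hb : 0 < b₀) : ∀ t ∈ Icc 0 T, 0 < b t := by
  refine pos_of_sq_pos h.b_cont (by rwa [h.init_b]) fun t ht h0 => ?_
  have := h.b_sq t ht
  rw [h0] at this
  have : 0 < b₀ ^ 2 := by positivity
  have : 0 ≤ D * β t ^ 2 := by positivity
  linarith

theorem le_b (h : CoordFlow D l b₀ T a b β g) (hb : 0 < b₀) : ∀ t ∈ Icc 0 T, b₀ ≤ b t := by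
  intro t ht
  refine (sq_le_sq₀ hb.le (h.b_pos hb t ht).le).1 ?_
  rw [h.b_sq t ht]
  have : 0 ≤ D * β t ^ 2 := by positivity
  linarith

theorem abs_β_lt_a (h : CoordFlow D l b₀ T a b β g) (hl : 0 < l) :
    ∀ t ∈ Icc 0 T, |β t| < a t := by
  intro t ht
  refine abs_lt_of_sq_lt_sq ?_ (h.a_pos hl t ht).le
  rw [h.a_sq hl t ht]; linarith

/-- The factor in front of `g` is a sum of squares, so the coefficient moves in the direction of the
sign of `g`. This is all the barrier arguments use. -/
theorem deriv_theta (h : CoordFlow D l b₀ T a b β g) : ∀ t ∈ Icc 0 T,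
    HasDerivWithinAt (fun t => a t * b t ^ D * β t)
      (((b t ^ D * β t) ^ 2 + (D * a t * b t ^ (D - 1) * β t) ^ 2 + (a t * b t ^ D) ^ 2) * g t)
      (Icc 0 T) t := by
  intro t ht
  refine (((h.deriv_a t ht).mul ((h.deriv_b t ht).pow D)).mul (h.deriv_β t ht)).congr_deriv ?_
  simp only [Pi.mul_apply, Pi.pow_apply]
  ring

/-- The barrier for the coefficient `θ = a b ^ D β`. -/
theorem abs_theta_le (h : CoordFlow D l b₀ T a b β g) {c r : ℝ} (hr : 0 ≤ r)
    (hg : ∀ t ∈ Icc 0 T, |g t - (c - a t * b t ^ D * β t)| ≤ r) :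
    ∀ t ∈ Icc 0 T, |a t * b t ^ D * β t| ≤ |c| + r := by
  intro t ht
  have hT : (0 : ℝ) ≤ T := ht.1.trans ht.2
  have hup : a t * b t ^ D * β t ≤ |c| + r := by
    refine le_of_deriv_nonpos_above h.deriv_theta ?_ ?_ t ht
    · simp [h.init_β]; positivity
    · intro s hs hlt
      have h1 := (abs_le.1 (hg s hs)).2
      have h2 := le_abs_self c
      exact mul_nonpos_of_nonneg_of_nonpos (by positivity) (by linarith)
  have hlow : - (a t * b t ^ D * β t) ≤ |c| + r := by
    refine le_of_deriv_nonpos_above (fun s hs => (h.deriv_theta s hs).neg) ?_ ?_ t ht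
    · simp [h.init_β]; positivity
    · intro s hs hlt
      have h1 := (abs_le.1 (hg s hs)).1
      have h2 := neg_abs_le c
      rw [neg_nonpos]
      simp only [Pi.neg_apply] at hlt
      exact mul_nonneg (by positivity) (by linarith)
  exact abs_le.2 ⟨by linarith, hup⟩

/-- Since `a' = b^D β g` and `β' = b^D a g`, the sum `a + β` solves a linear equation with rate `b^D
g`; the other factors of the product cancel. -/
theorem deriv_log (h : CoordFlow D l b₀ T a b β g) (hl : 0 < l) : ∀ t ∈ Icc 0 T,
    HasDerivWithinAt (fun t => Real.log (a t + β t)) (b t ^ D * g t) (Icc 0 T) t := by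
  intro t ht
  have hpos : 0 < a t + β t := by
    have := h.abs_β_lt_a hl t ht
    linarith [neg_abs_le (β t)]
  refine (((h.deriv_a t ht).add (h.deriv_β t ht)).log hpos.ne').congr_deriv ?_
  simp only [Pi.add_apply]
  field_simp
  ring

/-- An upper bound of the growth rate controls the growth of `a + β`. -/
theorem add_le_of_rate_le (h : CoordFlow D l b₀ T a b β g) (hl : 0 < l) {R : ℝ}
    (hR : ∀ t ∈ Icc 0 T, b t ^ D * g t ≤ R) :
    ∀ t ∈ Icc 0 T, a t + β t ≤ √l * Real.exp (R * t) := by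
  intro t ht
  have hT : (0 : ℝ) ≤ T := ht.1.trans ht.2
  have hpos : 0 < a t + β t := by
    have := h.abs_β_lt_a hl t ht
    linarith [neg_abs_le (β t)]
  have key : Real.log (a t + β t) - R * t ≤ Real.log √l := by
    refine le_of_deriv_nonpos_above (f := fun t => Real.log (a t + β t) - R * t)
      (fun s hs => (h.deriv_log hl s hs).sub
        ((hasDerivAt_id s).const_mul R |>.hasDerivWithinAt)) ?_ ?_ t ht
    · simp [h.init_a, h.init_β]
    · intro s hs _
      have := hR s hs
      simp; linarith
  have hsq : 0 < √l := Real.sqrt_pos.2 hl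
  rw [← Real.exp_log hpos, ← Real.exp_log hsq, ← Real.exp_add]
  exact Real.exp_le_exp.2 (by linarith)

/-- A lower bound of the growth rate forces `a + β` to grow. -/
theorem le_add_of_le_rate (h : CoordFlow D l b₀ T a b β g) (hl : 0 < l) {R : ℝ}
    (hR : ∀ t ∈ Icc 0 T, R ≤ b t ^ D * g t) :
    ∀ t ∈ Icc 0 T, √l * Real.exp (R * t) ≤ a t + β t := by
  intro t ht
  have hT : (0 : ℝ) ≤ T := ht.1.trans ht.2
  have hpos : 0 < a t + β t := by
    have := h.abs_β_lt_a hl t ht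
    linarith [neg_abs_le (β t)]
  have key : R * t - Real.log (a t + β t) ≤ - Real.log √l := by
    refine le_of_deriv_nonpos_above (f := fun t => R * t - Real.log (a t + β t))
      (fun s hs => ((hasDerivAt_id s).const_mul R |>.hasDerivWithinAt).sub
        (h.deriv_log hl s hs)) ?_ ?_ t ht
    · simp [h.init_a, h.init_β]
    · intro s hs _
      have := hR s hs
      simp; linarith
  have hsq : 0 < √l := Real.sqrt_pos.2 hl
  rw [← Real.exp_log hpos, ← Real.exp_log hsq, ← Real.exp_add]
  exact Real.exp_le_exp.2 (by linarith)

/-- `a` is the mean of `a + β` and `a - β`, and the latter is the corresponding sum for the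
reflected flow. -/
theorem a_le_of_abs_rate_le (h : CoordFlow D l b₀ T a b β g) (hl : 0 < l) {R : ℝ}
    (hR : ∀ t ∈ Icc 0 T, |b t ^ D * g t| ≤ R) :
    ∀ t ∈ Icc 0 T, a t ≤ √l * Real.exp (R * t) := by
  intro t ht
  have h1 := h.add_le_of_rate_le hl (fun t ht => (le_abs_self _).trans (hR t ht)) t ht
  have h2 := h.neg.add_le_of_rate_le hl (R := R)
    (fun t ht => by have := (abs_le.1 (hR t ht)).1; linarith) t ht
  linarith

/-- As long as the driving force is small, `β` stays below `b₀` and `a` stays comparable to its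
initial value. -/
theorem noise_bound (h : CoordFlow D l b₀ T a b β g) (hl : 0 < l) (hb : 0 < b₀) {G : ℝ}
    (hG : ∀ t ∈ Icc 0 T, |g t| ≤ G)
    (hsmall : √l * Real.exp ((√(1 + D) * b₀) ^ D * G * T) < b₀) : ∀ t ∈ Icc 0 T,
    |β t| ≤ b₀ ∧ b t ≤ √(1 + D) * b₀ ∧ a t ≤ √l * Real.exp ((√(1 + D) * b₀) ^ D * G * T) := by
  have hb_of : ∀ t ∈ Icc 0 T, |β t| ≤ b₀ → b t ≤ √(1 + D) * b₀ := by
    intro t ht hβ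
    refine (sq_le_sq₀ (h.b_pos hb t ht).le (by positivity)).1 ?_
    rw [h.b_sq t ht, mul_pow, Real.sq_sqrt (by positivity)]
    have h1 : β t ^ 2 ≤ b₀ ^ 2 := by rw [← sq_abs]; gcongr
    have : (D : ℝ) * β t ^ 2 ≤ D * b₀ ^ 2 := by gcongr
    linarith
  have ha_of : ∀ t ∈ Icc 0 T, (∀ s ∈ Icc 0 t, |β s| ≤ b₀) →
      a t ≤ √l * Real.exp ((√(1 + D) * b₀) ^ D * G * T) := by
    intro t ht hs
    have hG0 : 0 ≤ G := (abs_nonneg _).trans (hG t ht)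
    refine ((h.mono ht.2).a_le_of_abs_rate_le hl (R := (√(1 + D) * b₀) ^ D * G)
      (fun s hs' => ?_) t ⟨ht.1, le_rfl⟩).trans ?_
    · have hsT : s ∈ Icc 0 T := ⟨hs'.1, hs'.2.trans ht.2⟩
      have := h.b_pos hb s hsT
      rw [abs_mul, abs_of_pos (by positivity)]
      gcongr
      · exact hb_of s hsT (hs s hs')
      · exact hG s hsT
    · gcongr
      exact ht.2
  -- The argument closes on itself: `|β| ≤ b₀` up to time `t` bounds `b`, hence the growth rate,
  -- hence `a`; then `|β| < a` and `hsmall` give the strict inequality at `t`, which persists a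
  -- little longer by continuity.
  have hβ : ∀ t ∈ Icc 0 T, |β t| ≤ b₀ := by
    refine continuous_induction (P := fun t => |β t| < b₀) ?_ ?_
    · intro t ht hs
      have hle : ∀ s ∈ Icc 0 t, |β s| ≤ b₀ := by
        intro s hst
        rcases eq_or_ne s t with rfl | hne
        · rcases hst.1.eq_or_lt with h0 | h0
          · rw [← h0, h.init_β, abs_zero]; exact hb.le
          · have hc : ContinuousWithinAt (fun t => |β t|) (Ico 0 s) s :=
              ((h.β_cont s ht).mono (Ico_subset_Icc_self.trans (Icc_subset_Icc_right ht.2))).abs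
            refine hc.closure_le (g := fun _ => b₀) ?_ continuousWithinAt_const fun u hu => ?_
            · rw [closure_Ico h0.ne]; exact ⟨h0.le, le_rfl⟩
            · exact hs u ⟨hu.1, hu.2.le⟩ hu.2.ne
        · exact hs s hst hne
      exact (h.abs_β_lt_a hl t ht).trans ((ha_of t ht hle).trans_lt hsmall)
    · intro t ht hlt
      have hc := (h.β_cont t ht).abs
      have := hc.eventually (gt_mem_nhds hlt)
      obtain ⟨δ, hδ, hball⟩ := Metric.mem_nhdsWithin_iff.1 this
      refine ⟨δ / 2, by positivity, fun s hs hsT => ?_⟩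
      refine le_of_lt (hball ⟨?_, ht.1.trans hs.1, hsT⟩)
      rw [Metric.mem_ball, Real.dist_eq, abs_of_nonneg (by linarith [hs.1])]
      linarith [hs.2]
  exact fun t ht => ⟨hβ t ht, hb_of t ht (hβ t ht),
    ha_of t ht fun s hs => hβ s ⟨hs.1, hs.2.trans ht.2⟩⟩

/-- Below the level `c / 2` the force `g` is at least `c / 4`. So once the coefficient has reached
`c / 2` it cannot end below it; if it never did, `a + β` would grow at rate at least `b₀^D c / 4` on
the whole interval, and `hbig` would put the coefficient above `c`. The hypothesis `hbig` is about
arbitrary numbers `A`, `B`, so that it also applies to the reflected flow. -/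
theorem half_le_theta_of_pos (h : CoordFlow D l b₀ T a b β g) (hT : 0 ≤ T) (hl : 0 < l)
    (hb : 0 < b₀) {c : ℝ} (hc : 0 < c)
    (hg : ∀ t ∈ Icc 0 T, |g t - (c - a t * b t ^ D * β t)| ≤ c / 4)
    (hbig : ∀ A B : ℝ, 0 < A → A ^ 2 = l + B ^ 2 →
      √l * Real.exp (b₀ ^ D * (c / 4) * T) ≤ A + B → c ≤ A * b₀ ^ D * B) :
    c / 2 ≤ a T * b T ^ D * β T := by
  by_contra! hlt
  have hTm : T ∈ Icc 0 T := ⟨hT, le_rfl⟩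
  have hall : ∀ t ∈ Icc 0 T, a t * b t ^ D * β t < c / 2 := by
    intro t ht
    by_contra! hge
    have hsub : Icc t T ⊆ Icc 0 T := Icc_subset_Icc_left ht.1
    have := le_of_deriv_nonpos_above (f := fun t => - (a t * b t ^ D * β t)) (c := - (c / 2))
      (fun s hs => ((h.deriv_theta s (hsub hs)).mono hsub).neg) (by linarith)
      (fun s hs hlt' => by
        have h1 := (abs_le.1 (hg s (hsub hs))).1
        rw [neg_nonpos]
        exact mul_nonneg (by positivity) (by linarith)) T ⟨ht.2, le_rfl⟩
    linarith
  have hrate := h.le_add_of_le_rate hl (R := b₀ ^ D * (c / 4)) (fun t ht => by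
    have h1 := (abs_le.1 (hg t ht)).1
    have h2 := hall t ht
    have h3 := h.le_b hb t ht
    have h4 := h.b_pos hb t ht
    gcongr
    linarith) T hTm
  have hA := h.a_pos hl T hTm
  have hcon := hbig (a T) (β T) hA (h.a_sq hl T hTm) hrate
  have hβ : 0 < β T := by
    by_contra! hle
    have : a T * b₀ ^ D * β T ≤ 0 := mul_nonpos_of_nonneg_of_nonpos (by positivity) hle
    linarith
  have : a T * b₀ ^ D * β T ≤ a T * b T ^ D * β T := by
    have := h.le_b hb T hTm
    gcongr
  linarith

/-- The conservation laws give `β ≤ a` and, for `D ≥ 1`, `β ≤ b`, hence `β^(D+1) ≤ a b^D`. So `c /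
2` is at most `a b^D` to the power `1 + 1/(D+1)`. -/
theorem signal_bound_of_pos (h : CoordFlow D l b₀ T a b β g) (hT : 0 ≤ T) (hl : 0 < l)
    (hb : 0 < b₀) {c : ℝ} (hc : 0 < c) (hθ : c / 2 ≤ a T * b T ^ D * β T) :
    (c / 2) ^ (((D : ℝ) + 1) / ((D : ℝ) + 2)) ≤ a T * b T ^ D := by
  have hTm : T ∈ Icc 0 T := ⟨hT, le_rfl⟩
  have ha := h.a_pos hl T hTm
  have hbp := h.b_pos hb T hTm
  set A := a T * b T ^ D with hA
  have hA0 : 0 < A := by positivity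
  have hβ : 0 < β T := by
    by_contra! hle
    have := mul_nonpos_of_nonneg_of_nonpos hA0.le hle
    linarith
  have hβa : β T ≤ a T := (le_abs_self _).trans (h.abs_β_lt_a hl T hTm).le
  have hpow : β T ^ (D + 1) ≤ A := by
    rw [pow_succ', hA]
    -- For `D = 0` the factor `b` is constant and `β ≤ b` may fail, but it is not needed.
    rcases Nat.eq_zero_or_pos D with rfl | hD
    · simpa using hβa
    · have hβb : β T ≤ b T := by
        refine (sq_le_sq₀ hβ.le hbp.le).1 ?_
        rw [h.b_sq T hTm]
        have : (1 : ℝ) ≤ D := by exact_mod_cast hD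
        nlinarith [sq_nonneg (β T), sq_nonneg b₀]
      gcongr
  have hβA : β T ≤ A ^ (1 / ((D : ℝ) + 1)) := by
    have h1 : (β T ^ (D + 1)) ^ (1 / ((D : ℝ) + 1)) ≤ A ^ (1 / ((D : ℝ) + 1)) := by gcongr
    have h2 : (β T ^ (D + 1)) ^ (1 / ((D : ℝ) + 1)) = β T := by
      rw [← Real.rpow_natCast, ← Real.rpow_mul hβ.le]
      push_cast
      rw [mul_one_div_cancel (by positivity), Real.rpow_one]
    rwa [h2] at h1
  have hc2 : c / 2 ≤ A ^ (((D : ℝ) + 2) / ((D : ℝ) + 1)) := by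
    have h1 : ((D : ℝ) + 2) / ((D : ℝ) + 1) = 1 + 1 / ((D : ℝ) + 1) := by field_simp; ring
    rw [h1, Real.rpow_add hA0, Real.rpow_one]
    exact hθ.trans (by gcongr)
  calc (c / 2) ^ (((D : ℝ) + 1) / ((D : ℝ) + 2))
      ≤ (A ^ (((D : ℝ) + 2) / ((D : ℝ) + 1))) ^ (((D : ℝ) + 1) / ((D : ℝ) + 2)) := by gcongr
    _ = A := by
      rw [← Real.rpow_mul hA0.le]
      have : ((D : ℝ) + 2) / ((D : ℝ) + 1) * (((D : ℝ) + 1) / ((D : ℝ) + 2)) = 1 := by field_simp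
      rw [this, Real.rpow_one]

/-- A coordinate driven towards `c` with a small relative error becomes large. -/
theorem signal_bound (h : CoordFlow D l b₀ T a b β g) (hT : 0 ≤ T) (hl : 0 < l) (hb : 0 < b₀)
    {c : ℝ} (hc : c ≠ 0) (hg : ∀ t ∈ Icc 0 T, |g t - (c - a t * b t ^ D * β t)| ≤ |c| / 4)
    (hbig : ∀ A B : ℝ, 0 < A → A ^ 2 = l + B ^ 2 →
      √l * Real.exp (b₀ ^ D * (|c| / 4) * T) ≤ A + B → |c| ≤ A * b₀ ^ D * B) :
    (|c| / 2) ^ (((D : ℝ) + 1) / ((D : ℝ) + 2)) ≤ a T * b T ^ D := by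
  rcases lt_or_gt_of_ne hc with hneg | hpos
  · rw [abs_of_neg hneg] at hg hbig ⊢
    have hc' : 0 < -c := by linarith
    refine h.neg.signal_bound_of_pos hT hl hb hc'
      (h.neg.half_le_theta_of_pos hT hl hb hc' (fun t ht => ?_) hbig)
    have := hg t ht
    rwa [← abs_neg, show -(-g t - (-c - a t * b t ^ D * -β t)) = g t - (c - a t * b t ^ D * β t) by
      ring]
  · rw [abs_of_pos hpos] at hg hbig ⊢
    exact h.signal_bound_of_pos hT hl hb hpos (h.half_le_theta_of_pos hT hl hb hpos hg hbig)

end CoordFlow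

/-! ### Sub-polynomial factors and sums over the coefficients -/

/-- Completing the square: `c y ≤ c² / (4p) + p y²` with `y = √(log x)`. Factors of this kind
therefore cost only an arbitrarily small power. -/
theorem exp_sqrt_log_le (c : ℝ) {p x : ℝ} (hp : 0 < p) (hx : 1 ≤ x) :
    Real.exp (c * √(Real.log x)) ≤ Real.exp (c ^ 2 / (4 * p)) * x ^ p := by
  have hx0 : 0 < x := by linarith
  rw [Real.rpow_def_of_pos hx0, ← Real.exp_add]
  refine Real.exp_le_exp.2 ?_
  have h := Real.sq_sqrt (Real.log_nonneg hx)
  set y := √(Real.log x)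
  rw [← h]
  have : c ^ 2 / (4 * p) + y ^ 2 * p - c * y = (c - 2 * p * y) ^ 2 / (4 * p) := by
    field_simp; ring
  have h2 : 0 ≤ (c - 2 * p * y) ^ 2 / (4 * p) := by positivity
  linarith

theorem eventually_exp_sqrt_log_mul_rpow_le (K c : ℝ) {p ε : ℝ} (hp : 0 < p) (hε : 0 < ε) :
    ∀ᶠ n : ℕ in atTop, K * Real.exp (c * √(Real.log n)) * (n : ℝ) ^ (-p) ≤ ε := by
  have hp2 : 0 < p / 2 := by positivity
  have h1 : Tendsto (fun n : ℕ => |K| * Real.exp (c ^ 2 / (4 * (p / 2))) * (n : ℝ) ^ (-(p / 2)))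
      atTop (𝓝 0) := by
    simpa using ((tendsto_rpow_neg_atTop hp2).comp tendsto_natCast_atTop_atTop).const_mul
      (|K| * Real.exp (c ^ 2 / (4 * (p / 2))))
  filter_upwards [h1.eventually (gt_mem_nhds hε), eventually_ge_atTop 1] with n hn hn1
  have hn1' : (1 : ℝ) ≤ n := by exact_mod_cast hn1
  refine le_trans ?_ hn.le
  have hexp := exp_sqrt_log_le c hp2 hn1'
  calc K * Real.exp (c * √(Real.log n)) * (n : ℝ) ^ (-p)
      ≤ |K| * (Real.exp (c ^ 2 / (4 * (p / 2))) * (n : ℝ) ^ (p / 2)) * (n : ℝ) ^ (-p) := by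
        gcongr
        exact le_abs_self K
    _ = |K| * Real.exp (c ^ 2 / (4 * (p / 2))) * ((n : ℝ) ^ (p / 2) * (n : ℝ) ^ (-p)) := by ring
    _ = _ := by rw [← Real.rpow_add (by linarith)]; ring_nf

theorem one_le_pnat_cast (j : ℕ+) : (1 : ℝ) ≤ (j : ℝ) := by exact_mod_cast j.pos

theorem summable_rpow_mul_exp_sqrt_log {r : ℝ} (hr : 1 < r) (c : ℝ) :
    Summable fun j : ℕ+ => (j : ℝ) ^ (-r) * Real.exp (c * √(Real.log j)) := by
  have hp : 0 < (r - 1) / 2 := by linarith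
  have h1 : Summable fun j : ℕ+ => Real.exp (c ^ 2 / (4 * ((r - 1) / 2))) *
      (j : ℝ) ^ (-((r + 1) / 2)) := by
    refine Summable.mul_left _ ?_
    have : Summable fun n : ℕ => (n : ℝ) ^ (-((r + 1) / 2)) :=
      Real.summable_nat_rpow.2 (by linarith)
    exact this.comp_injective PNat.coe_injective
  refine Summable.of_nonneg_of_le (fun j => by positivity) (fun j => ?_) h1
  have hj := one_le_pnat_cast j
  calc (j : ℝ) ^ (-r) * Real.exp (c * √(Real.log j))
      ≤ (j : ℝ) ^ (-r) * (Real.exp (c ^ 2 / (4 * ((r - 1) / 2))) * (j : ℝ) ^ ((r - 1) / 2)) := by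
        gcongr; exact exp_sqrt_log_le c hp hj
    _ = Real.exp (c ^ 2 / (4 * ((r - 1) / 2))) * ((j : ℝ) ^ (-r) * (j : ℝ) ^ ((r - 1) / 2)) := by
        ring
    _ = _ := by rw [← Real.rpow_add (by linarith)]; ring_nf

/-- Dyadic layers: at most about `δ^(-(1-s₀))` coefficients reach size `δ`, each contributing about
`δ^r`, and `r > 1 - s₀` makes the sum over `δ = B 2^(-m)` geometric. -/
theorem exists_sum_rpow_le {r Binf κ Bspn s₀ Bsig : ℝ} (hr0 : 0 < r) (hr : 1 - s₀ < r)
    (hBsig : 0 < Bsig) :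
    ∃ K : ℝ, ∀ θ : ℕ+ → ℝ, SignalSpan θ Binf κ Bspn s₀ Bsig →
      ∀ F : Finset ℕ+, ∑ j ∈ F, |θ j| ^ r ≤ K := by
  classical
  set B : ℝ := max Binf 1 with hB
  have hB0 : 0 < B := lt_of_lt_of_le one_pos (le_max_right _ _)
  set y : ℝ := 1 / 2 with hy
  have hy0 : 0 < y := by norm_num [hy]
  have hy1 : y < 1 := by norm_num [hy]
  set ρ : ℝ := y ^ (r - (1 - s₀)) with hρ
  have hρ1 : ρ < 1 := Real.rpow_lt_one hy0.le hy1 (by linarith)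
  have hρ0 : 0 ≤ ρ := by positivity
  set C' : ℝ := Bsig * B ^ r * (B * y) ^ (-(1 - s₀)) with hC'
  refine ⟨∑' m : ℕ, C' * ρ ^ m, fun θ hθ F => ?_⟩
  -- The index `j` is counted in every layer whose lower threshold lies below `|θ j|`, not just in
  -- its own; this keeps the count of each layer equal to that of `sigSet`, and the overcount is
  -- harmless.
  set v : ℕ+ → ℕ → ℝ := fun j m => if B * y ^ (m + 1) ≤ |θ j| then (B * y ^ m) ^ r else 0 with hv
  have hv0 : ∀ j m, 0 ≤ v j m := fun j m => by simp only [hv]; split_ifs <;> positivity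
  have hpow : ∀ m : ℕ, (y ^ m) ^ r = (y ^ r) ^ m := fun m => by
    rw [← Real.rpow_natCast, ← Real.rpow_mul hy0.le, mul_comm, Real.rpow_mul hy0.le,
      Real.rpow_natCast]
  have hvs : ∀ j, Summable (v j) := fun j => by
    refine Summable.of_nonneg_of_le (hv0 j) (g := v j) (f := fun m => B ^ r * (y ^ r) ^ m)
      (fun m => ?_) ((summable_geometric_of_lt_one (by positivity)
        (Real.rpow_lt_one hy0.le hy1 hr0)).mul_left _)
    simp only [hv]
    split_ifs
    · rw [Real.mul_rpow hB0.le (by positivity), hpow]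
    · positivity
  have hle : ∀ j, |θ j| ^ r ≤ ∑' m, v j m := fun j => by
    rcases eq_or_ne (θ j) 0 with h0 | h0
    · rw [h0, abs_zero, Real.zero_rpow hr0.ne']; exact tsum_nonneg (hv0 j)
    · obtain ⟨m, hm1, hm2⟩ := exists_nat_pow_near_of_lt_one (x := |θ j| / B) (y := y)
        (by positivity) (by
          rw [div_le_one hB0]; exact (hθ.bounded j).trans (le_max_left _ _)) hy0 hy1
      rw [lt_div_iff₀ hB0] at hm1
      rw [div_le_iff₀ hB0] at hm2
      refine le_trans ?_ ((hvs j).le_tsum m fun i _ => hv0 j i)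
      simp only [hv]
      rw [if_pos (by linarith)]
      gcongr
      linarith
  calc ∑ j ∈ F, |θ j| ^ r ≤ ∑ j ∈ F, ∑' m, v j m := Finset.sum_le_sum fun j _ => hle j
    _ = ∑' m, ∑ j ∈ F, v j m := (Summable.tsum_finsetSum fun j _ => hvs j).symm
    _ ≤ ∑' m : ℕ, C' * ρ ^ m := by
      refine Summable.tsum_le_tsum (fun m => ?_) (summable_sum fun j _ => hvs j)
        ((summable_geometric_of_lt_one hρ0 hρ1).mul_left _)
      have hδ : 0 < B * y ^ (m + 1) := by positivity
      have hfin : (sigSet θ (B * y ^ (m + 1))).Finite := by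
        refine Set.Finite.subset (Set.finite_Iic
          (⟨⌊Bspn * (B * y ^ (m + 1)) ^ (-κ)⌋₊ + 1, Nat.succ_pos _⟩ : ℕ+)) fun j hj => ?_
        have h1 := Nat.le_floor (hθ.span _ hδ j hj)
        exact PNat.coe_le_coe _ _ |>.1 (h1.trans (Nat.le_succ _))
      have hcard : ((F.filter fun j => B * y ^ (m + 1) ≤ |θ j|).card : ℝ) ≤
          Bsig * (B * y ^ (m + 1)) ^ (-(1 - s₀)) := by
        refine le_trans ?_ (hθ.decay _ hδ)
        rw [← Set.ncard_coe_finset]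
        have hsub : ((F.filter fun j => B * y ^ (m + 1) ≤ |θ j| : Finset ℕ+) : Set ℕ+) ⊆
            sigSet θ (B * y ^ (m + 1)) := fun j hj => (Finset.mem_filter.1 (Finset.mem_coe.1 hj)).2
        exact_mod_cast Set.ncard_le_ncard hsub hfin
      simp only [hv]
      rw [← Finset.sum_filter, Finset.sum_const, nsmul_eq_mul]
      calc _ ≤ Bsig * (B * y ^ (m + 1)) ^ (-(1 - s₀)) * (B * y ^ m) ^ r := by gcongr
        _ = C' * ρ ^ m := by
          rw [hC', hρ, Real.mul_rpow hB0.le (by positivity : (0 : ℝ) ≤ y ^ m), hpow,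
            Real.rpow_sub hy0, div_pow (y ^ r), pow_succ' y m, ← mul_assoc B,
            Real.mul_rpow (by positivity : (0 : ℝ) ≤ B * y) (by positivity : (0 : ℝ) ≤ y ^ m),
            Real.rpow_neg (by positivity : (0 : ℝ) ≤ y ^ m)]
          have : (y ^ m) ^ (1 - s₀) = (y ^ (1 - s₀)) ^ m := by
            rw [← Real.rpow_natCast, ← Real.rpow_mul hy0.le, mul_comm, Real.rpow_mul hy0.le,
              Real.rpow_natCast]
          rw [this]
          field_simp

/-- The span condition `j ≤ Bspn |θ_j|^(-κ)` converts a small power of `j` into a small negative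
power of `|θ_j|`, so the exponential factor only lowers the exponent from `q` to some `r` still
above `1 - s₀`. -/
theorem exists_tsum_rpow_mul_exp_le {q Binf κ Bspn s₀ Bsig : ℝ} (c : ℝ) (hq0 : 0 < q)
    (hq : 1 - s₀ < q) (hκ : 1 ≤ κ) (hBspn : 0 < Bspn) (hBsig : 0 < Bsig) :
    ∃ K : ℝ, 0 ≤ K ∧ ∀ θ : ℕ+ → ℝ, SignalSpan θ Binf κ Bspn s₀ Bsig →
      Summable (fun j => |θ j| ^ q * Real.exp (c * √(Real.log j))) ∧
        ∑' j, |θ j| ^ q * Real.exp (c * √(Real.log j)) ≤ K := by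
  obtain ⟨r, hr, hrq⟩ : ∃ r, max 0 (1 - s₀) < r ∧ r < q := exists_between (max_lt hq0 hq)
  obtain ⟨K, hK⟩ := exists_sum_rpow_le (Binf := Binf) (κ := κ) (Bspn := Bspn)
    (lt_of_le_of_lt (le_max_left _ _) hr)
    (lt_of_le_of_lt (le_max_right _ _) hr) hBsig
  set p : ℝ := (q - r) / κ with hp
  have hκ0 : 0 < κ := by linarith
  have hp0 : 0 < p := div_pos (by linarith) hκ0
  set C' : ℝ := Real.exp (c ^ 2 / (4 * p)) * Bspn ^ p with hC'
  have hC0 : 0 ≤ C' := by positivity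
  have hterm : ∀ θ : ℕ+ → ℝ, SignalSpan θ Binf κ Bspn s₀ Bsig → ∀ j,
      |θ j| ^ q * Real.exp (c * √(Real.log j)) ≤ C' * |θ j| ^ r := by
    intro θ hθ j
    rcases eq_or_ne (θ j) 0 with h0 | h0
    · rw [h0, abs_zero, Real.zero_rpow hq0.ne', zero_mul]; positivity
    · have hpos : 0 < |θ j| := abs_pos.2 h0
      have hj := hθ.span |θ j| hpos j (le_refl |θ j|)
      have hj1 := one_le_pnat_cast j
      calc |θ j| ^ q * Real.exp (c * √(Real.log j))
          ≤ |θ j| ^ q * (Real.exp (c ^ 2 / (4 * p)) * (Bspn * |θ j| ^ (-κ)) ^ p) := by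
            gcongr
            exact (exp_sqrt_log_le c hp0 hj1).trans (by gcongr)
        _ = C' * (|θ j| ^ q * (|θ j| ^ (-κ)) ^ p) := by
            rw [Real.mul_rpow hBspn.le (by positivity), hC']; ring
        _ = C' * |θ j| ^ r := by
            rw [← Real.rpow_mul hpos.le, ← Real.rpow_add hpos]
            congr 2
            rw [hp]; field_simp; ring
  have hsum : ∀ θ : ℕ+ → ℝ, SignalSpan θ Binf κ Bspn s₀ Bsig → ∀ F : Finset ℕ+,
      ∑ j ∈ F, |θ j| ^ q * Real.exp (c * √(Real.log j)) ≤ C' * max K 0 := by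
    intro θ hθ F
    refine (Finset.sum_le_sum fun j _ => hterm θ hθ j).trans ?_
    rw [← Finset.mul_sum]
    gcongr
    exact (hK θ hθ F).trans (le_max_left _ _)
  refine ⟨C' * max K 0, by positivity, fun θ hθ => ⟨?_, ?_⟩⟩
  · exact summable_of_sum_le (fun j => by positivity) (hsum θ hθ)
  · exact Real.tsum_le_of_sum_le (fun j => by positivity) (hsum θ hθ)

/-! ### Noise components, signal components and the bootstrap over all coordinates -/

/-- Continuous induction for a family of error terms which is equicontinuous relative to the
bounds to be proved. -/
theorem bootstrap {ι : Type*} {h : ι → ℝ → ℝ} {W : ι → ℝ} {T : ℝ} (hW : ∀ k, 0 ≤ W k)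
    (h0 : ∀ k, |h k 0| ≤ W k)
    (himp : ∀ t ∈ Icc 0 T, (∀ s ∈ Icc 0 t, ∀ k, |h k s| ≤ W k) → ∀ k, |h k t| ≤ W k / 2)
    (hcont : ∀ t ∈ Icc 0 T, ∀ ε > 0, ∃ δ > 0, ∀ s ∈ Icc 0 T, |s - t| ≤ δ →
      ∀ k, |h k s - h k t| ≤ ε * W k) :
    ∀ t ∈ Icc 0 T, ∀ k, |h k t| ≤ W k := by
  refine continuous_induction (P := fun t => ∀ k, |h k t| ≤ W k / 2) ?_ ?_
  · intro t ht hs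
    refine himp t ht fun s hst k => ?_
    rcases eq_or_ne s t with rfl | hne
    · rcases hst.1.eq_or_lt with h0' | h0'
      · rw [← h0']; exact h0 k
      · refine le_of_forall_pos_le_add fun ε hε => ?_
        -- The bound has to be carried over to the endpoint `s` itself by continuity; the `+ 1`
        -- keeps the quotient meaningful when `W k = 0`.
        obtain ⟨δ, hδ, hc⟩ := hcont s ht (ε / (W k + 1)) (by have := hW k; positivity)
        set u := max 0 (s - δ) with hu
        have hu0 : 0 ≤ u := le_max_left _ _
        have hus : u < s := max_lt h0' (by linarith)
        have h1 := hc u ⟨hu0, hus.le.trans ht.2⟩ (by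
          rw [abs_sub_comm, abs_of_pos (by linarith)]
          linarith [le_max_right 0 (s - δ)]) k
        have h2 := hs u ⟨hu0, hus.le⟩ hus.ne k
        have h3 : ε / (W k + 1) * W k ≤ ε := by
          have := hW k
          rw [div_mul_eq_mul_div, div_le_iff₀ (by positivity)]
          nlinarith
        have h4 : |h k s| ≤ |h k u| + |h k u - h k s| := by
          have := abs_sub_abs_le_abs_sub (h k s) (h k u)
          rw [abs_sub_comm (h k s)] at this
          linarith
        linarith
    · exact hs s hst hne k
  · intro t ht hP
    obtain ⟨δ, hδ, hc⟩ := hcont t ht (1 / 2) (by norm_num)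
    refine ⟨δ, hδ, fun s hs hsT k => ?_⟩
    have h1 := hc s ⟨ht.1.trans hs.1, hsT⟩ (by
      rw [abs_of_nonneg (by linarith [hs.1])]; linarith [hs.2]) k
    have h2 := hP k
    have h3 := abs_sub_abs_le_abs_sub (h k s) (h k t)
    linarith

/-- This is the balance behind the choice of `t` and `b₀`: a force of size `n^(-1/2)` acting with
weight `b₀^D` for time `t` changes `log (a + β)` by a quantity of order one. -/
theorem rate_exponent (D : ℕ) {n : ℝ} (hn : 0 < n) :
    (n ^ (-(1 / (2 * ((D : ℝ) + 2))))) ^ D * n ^ (((D : ℝ) + 1) / ((D : ℝ) + 2)) *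
      n ^ (-(1 / 2 : ℝ)) = 1 := by
  rw [← Real.rpow_natCast, ← Real.rpow_mul hn.le, ← Real.rpow_add hn, ← Real.rpow_add hn]
  have : -(1 / (2 * ((D : ℝ) + 2))) * D + ((D : ℝ) + 1) / ((D : ℝ) + 2) + -(1 / 2 : ℝ) = 0 := by
    field_simp; ring
  rw [this, Real.rpow_zero]

theorem one_le_sqrt_log {n : ℕ} (hn : 3 ≤ n) : 1 ≤ √(Real.log n) := by
  rw [Real.one_le_sqrt, Real.le_log_iff_exp_le (by positivity)]
  have : (3 : ℝ) ≤ n := by exact_mod_cast hn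
  linarith [Real.exp_one_lt_three]

/-- The noise components stay of the order of their initial size. -/
theorem noise_component (D : ℕ) {s H Ceig γ Ct cb Cb : ℝ} (hs : 0 < s) (hH : 0 < H)
    (hCeig : 0 < Ceig) (hγ : 1 < γ) (hCt : 0 < Ct) (hcb : 0 < cb) (hCb : 0 < Cb) :
    ∃ C₃ : ℝ, 0 < C₃ ∧ ∃ N : ℕ, ∀ n : ℕ, N ≤ n → ∀ (T b₀ l c : ℝ) (k : ℕ+) (a b β g : ℝ → ℝ),
      0 ≤ T → T ≤ Ct * (n : ℝ) ^ (((D : ℝ) + 1) / ((D : ℝ) + 2)) →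
      cb * (n : ℝ) ^ (-(1 / (2 * ((D : ℝ) + 2)))) ≤ b₀ →
      b₀ ≤ Cb * (n : ℝ) ^ (-(1 / (2 * ((D : ℝ) + 2)))) →
      0 < l → l ≤ Ceig * (k : ℝ) ^ (-γ) → l ≤ (n : ℝ) ^ (-((1 + s) / ((D : ℝ) + 2))) →
      |c| ≤ (n : ℝ) ^ (-(1 / 2 : ℝ)) → CoordFlow D l b₀ T a b β g →
      (∀ t ∈ Icc 0 T, |g t - (c - a t * b t ^ D * β t)| ≤
        H * (√(Real.log n) + √(Real.log k)) * (n : ℝ) ^ (-(1 / 2 : ℝ))) →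
      ∀ t ∈ Icc 0 T, b t ≤ √(1 + D) * b₀ ∧
        a t ≤ √l * Real.exp (C₃ * (√(Real.log n) + √(Real.log k))) := by
  set C₃ : ℝ := (√(1 + D) * Cb) ^ D * (2 + 2 * H) * Ct with hC₃
  have hC₃0 : 0 < C₃ := by positivity
  -- `√l` is split as `l^((1-ρ)/2) l^(ρ/2)`. With this `ρ` the first factor is at most
  -- `n^(-1/(2(D+2)))`, the size of `b₀`, times a spare power `n^(-s/(4(D+2)))` that absorbs `exp
  -- (C₃ √ln n)`; the second decays in `k` and absorbs `exp (C₃ √ln k)`.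
  set ρ : ℝ := s / (2 * (1 + s)) with hρ
  have hρ0 : 0 < ρ := by positivity
  have hρ1 : ρ < 1 := by rw [hρ, div_lt_one (by positivity)]; linarith
  set K : ℝ := Ceig ^ (ρ / 2) * Real.exp (C₃ ^ 2 / (4 * (γ * ρ / 2))) with hK
  obtain ⟨N, hN⟩ := eventually_atTop.1 ((eventually_exp_sqrt_log_mul_rpow_le K C₃
    (p := s / 2 / (2 * ((D : ℝ) + 2))) (ε := cb / 2) (by positivity) (by positivity)).and
    (eventually_ge_atTop 3))
  refine ⟨C₃, hC₃0, N, fun n hn T b₀ l c k a b β g hT0 hT hb1 hb2 hl hlk hln hc hflow hg t ht => ?_⟩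
  obtain ⟨hN1, hn3⟩ := hN n hn
  have hn0 : (0 : ℝ) < n := by positivity
  have hL := one_le_sqrt_log hn3
  set L := √(Real.log n) with hLdef
  set lk := √(Real.log k) with hlk_def
  have hlk0 : 0 ≤ lk := Real.sqrt_nonneg _
  set ν : ℝ := (n : ℝ) ^ (-(1 / 2 : ℝ)) with hν
  have hν0 : 0 < ν := by positivity
  have hb0 : 0 < b₀ := lt_of_lt_of_le (by positivity) hb1
  have hθ := hflow.abs_theta_le (c := c) (r := H * (L + lk) * ν) (by positivity) hg
  have hG : ∀ t ∈ Icc 0 T, |g t| ≤ (2 + 2 * H) * (L + lk) * ν := by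
    intro t ht
    have h1 := hθ t ht
    have h2 := hg t ht
    have h3 : |g t| ≤ |g t - (c - a t * b t ^ D * β t)| + (|c| + |a t * b t ^ D * β t|) := by
      have e1 := abs_add_le (g t - (c - a t * b t ^ D * β t)) (c - a t * b t ^ D * β t)
      have e2 := abs_sub c (a t * b t ^ D * β t)
      rw [sub_add_cancel] at e1
      linarith
    have h4 : ν ≤ (L + lk) * ν := le_mul_of_one_le_left hν0.le (by linarith)
    linarith
  have hrate : (√(1 + D) * b₀) ^ D * ((2 + 2 * H) * (L + lk) * ν) * T ≤ C₃ * (L + lk) := by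
    have hpre := rate_exponent D hn0
    calc (√(1 + D) * b₀) ^ D * ((2 + 2 * H) * (L + lk) * ν) * T
        ≤ (√(1 + D) * (Cb * (n : ℝ) ^ (-(1 / (2 * ((D : ℝ) + 2)))))) ^ D *
          ((2 + 2 * H) * (L + lk) * ν) * (Ct * (n : ℝ) ^ (((D : ℝ) + 1) / ((D : ℝ) + 2))) := by
          gcongr
      _ = C₃ * (L + lk) * ((n : ℝ) ^ (-(1 / (2 * ((D : ℝ) + 2))))) ^ D *
            (n : ℝ) ^ (((D : ℝ) + 1) / ((D : ℝ) + 2)) * ν := by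
          rw [hC₃, ← mul_assoc √(1 + (D : ℝ)) Cb, mul_pow (√(1 + (D : ℝ)) * Cb)]; ring
      _ = C₃ * (L + lk) * (((n : ℝ) ^ (-(1 / (2 * ((D : ℝ) + 2))))) ^ D *
            (n : ℝ) ^ (((D : ℝ) + 1) / ((D : ℝ) + 2)) * ν) := by ring
      _ = _ := by rw [hpre, mul_one]
  have hk1 := one_le_pnat_cast k
  have hk0 : (0 : ℝ) < k := by linarith
  have hsmall : √l * Real.exp (C₃ * (L + lk)) < b₀ := by
    have h1 : √l ≤ ((n : ℝ) ^ (-((1 + s) / ((D : ℝ) + 2)))) ^ ((1 - ρ) / 2) *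
        (Ceig * (k : ℝ) ^ (-γ)) ^ (ρ / 2) := by
      have : √l = l ^ ((1 - ρ) / 2) * l ^ (ρ / 2) := by
        rw [Real.sqrt_eq_rpow, ← Real.rpow_add hl]; ring_nf
      rw [this]
      have : 0 ≤ (1 - ρ) / 2 := by linarith
      gcongr
    have h2 : ((n : ℝ) ^ (-((1 + s) / ((D : ℝ) + 2)))) ^ ((1 - ρ) / 2) =
        (n : ℝ) ^ (-(s / 2 / (2 * ((D : ℝ) + 2)))) * (n : ℝ) ^ (-(1 / (2 * ((D : ℝ) + 2)))) := by
      rw [← Real.rpow_mul hn0.le, ← Real.rpow_add hn0, hρ]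
      congr 1
      field_simp
      ring
    have h3 : (Ceig * (k : ℝ) ^ (-γ)) ^ (ρ / 2) * Real.exp (C₃ * lk) ≤ K := by
      rw [Real.mul_rpow hCeig.le (by positivity), ← Real.rpow_mul hk0.le, hK, mul_assoc]
      gcongr
      calc (k : ℝ) ^ (-γ * (ρ / 2)) * Real.exp (C₃ * lk)
          ≤ (k : ℝ) ^ (-γ * (ρ / 2)) *
            (Real.exp (C₃ ^ 2 / (4 * (γ * ρ / 2))) * (k : ℝ) ^ (γ * ρ / 2)) := by
            gcongr
            exact exp_sqrt_log_le C₃ (by positivity) hk1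
        _ = Real.exp (C₃ ^ 2 / (4 * (γ * ρ / 2))) *
            ((k : ℝ) ^ (-γ * (ρ / 2)) * (k : ℝ) ^ (γ * ρ / 2)) := by ring
        _ = _ := by
            rw [← Real.rpow_add hk0]
            have : -γ * (ρ / 2) + γ * ρ / 2 = 0 := by ring
            rw [this, Real.rpow_zero, mul_one]
    calc √l * Real.exp (C₃ * (L + lk))
        ≤ (n : ℝ) ^ (-(s / 2 / (2 * ((D : ℝ) + 2)))) * (n : ℝ) ^ (-(1 / (2 * ((D : ℝ) + 2)))) *
          (Ceig * (k : ℝ) ^ (-γ)) ^ (ρ / 2) * Real.exp (C₃ * (L + lk)) := by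
          rw [← h2]; gcongr
      _ = (Ceig * (k : ℝ) ^ (-γ)) ^ (ρ / 2) * Real.exp (C₃ * lk) * (Real.exp (C₃ * L) *
          (n : ℝ) ^ (-(s / 2 / (2 * ((D : ℝ) + 2))))) *
            (n : ℝ) ^ (-(1 / (2 * ((D : ℝ) + 2)))) := by
          rw [mul_add C₃, Real.exp_add]; ring
      _ ≤ K * (Real.exp (C₃ * L) * (n : ℝ) ^ (-(s / 2 / (2 * ((D : ℝ) + 2))))) *
            (n : ℝ) ^ (-(1 / (2 * ((D : ℝ) + 2)))) := by gcongr
      _ ≤ cb / 2 * (n : ℝ) ^ (-(1 / (2 * ((D : ℝ) + 2)))) := by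
          gcongr
          rw [← mul_assoc]; exact hN1
      _ < cb * (n : ℝ) ^ (-(1 / (2 * ((D : ℝ) + 2)))) := by
          gcongr; linarith
      _ ≤ b₀ := hb1
  have hexp : √l * Real.exp ((√(1 + D) * b₀) ^ D * ((2 + 2 * H) * (L + lk) * ν) * T) ≤
      √l * Real.exp (C₃ * (L + lk)) := by gcongr
  have := hflow.noise_bound hl hb0 hG (hexp.trans_lt hsmall) t ht
  exact ⟨this.2.1, this.2.2.trans hexp⟩

/-- From `(A - B)(A + B) = l`, a large sum forces `0 < A - B ≤ 1`, so `A` and `B` are both about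
half the sum. -/
theorem le_of_sq_eq_add_sq {A B l n : ℝ} (hAB : A ^ 2 = l + B ^ 2) (hl : 0 < l) (hln : l ≤ n)
    (hn : 1 ≤ n) (hS : 4 * n ≤ A + B) : n ≤ A ∧ n ≤ B := by
  have hprod : (A - B) * (A + B) = l := by linarith [hAB]
  have h1 : A - B ≤ 1 := by
    by_contra! hgt
    have : 1 * (A + B) < (A - B) * (A + B) := by gcongr; linarith
    linarith
  have h2 : 0 < A - B := pos_of_mul_pos_left (hprod ▸ hl) (by linarith)
  constructor <;> linarith

set_option maxHeartbeats 1000000 in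
/-- The signal components reach the size of the signal. -/
theorem signal_component (D : ℕ) {H ceig Ceig γ Binf κ Bspn ct cb : ℝ} (hH : 0 < H)
    (hceig : 0 < ceig) (hCeig : 0 < Ceig) (hγ : 1 < γ) (hκ : 1 ≤ κ) (hBspn : 0 < Bspn)
    (hct : 0 < ct) (hcb : 0 < cb) :
    ∃ C₁ : ℝ, 0 < C₁ ∧ ∃ N : ℕ, ∀ n : ℕ, N ≤ n → ∀ (T b₀ l c : ℝ) (k : ℕ+) (a b β g : ℝ → ℝ),
      ct * (n : ℝ) ^ (((D : ℝ) + 1) / ((D : ℝ) + 2)) ≤ T →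
      cb * (n : ℝ) ^ (-(1 / (2 * ((D : ℝ) + 2)))) ≤ b₀ →
      ceig * (k : ℝ) ^ (-γ) ≤ l → l ≤ Ceig * (k : ℝ) ^ (-γ) →
      C₁ * (n : ℝ) ^ (-(1 / 2 : ℝ)) * Real.log n ≤ |c| → |c| ≤ Binf →
      (k : ℝ) ≤ Bspn * |c| ^ (-κ) → CoordFlow D l b₀ T a b β g →
      (∀ t ∈ Icc 0 T, |g t - (c - a t * b t ^ D * β t)| ≤
        H * (√(Real.log n) + √(Real.log k)) * (n : ℝ) ^ (-(1 / 2 : ℝ))) →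
      (|c| / 2) ^ (((D : ℝ) + 1) / ((D : ℝ) + 2)) ≤ a T * b T ^ D := by
  -- The second entry makes the error in the force at most `|c| / 4`. The third makes the growth
  -- exponent at least `(2 + κγ/4) ln n`: since `k ≤ Bspn n^(κ/2)`, the initial value `√l` can be as
  -- small as `n^(-κγ/4)`, and `a + β` should still reach order `n²`.
  set C₁ : ℝ := max 1 (max (4 * H * (2 + κ)) (4 * (2 + κ * γ / 4) / (cb ^ D * ct))) with hC₁
  have hC₁1 : 1 ≤ C₁ := le_max_left _ _
  have hC₁0 : 0 < C₁ := by linarith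
  have hC₁H : 4 * H * (2 + κ) ≤ C₁ := (le_max_left _ _).trans (le_max_right _ _)
  have hC₁r : 4 * (2 + κ * γ / 4) / (cb ^ D * ct) ≤ C₁ :=
    (le_max_right _ _).trans (le_max_right _ _)
  set K : ℝ := √ceig * Bspn ^ (-γ / 2) with hK
  have hK0 : 0 < K := by positivity
  obtain ⟨N, hN⟩ := exists_nat_ge (max (max 3 Bspn) (max (4 / K) (max Ceig (Binf / cb ^ D))))
  refine ⟨C₁, hC₁0, N, fun n hn T b₀ l c k a b β g hT hb hl1 hl2 hc1 hc2 hk hflow hg => ?_⟩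
  have hnR : max (max 3 Bspn) (max (4 / K) (max Ceig (Binf / cb ^ D))) ≤ (n : ℝ) :=
    hN.trans (by exact_mod_cast hn)
  simp only [max_le_iff] at hnR
  obtain ⟨⟨hn3, hnB⟩, hnK, hnC, hnBinf⟩ := hnR
  have hn3' : 3 ≤ n := by exact_mod_cast hn3
  have hn0 : (0 : ℝ) < n := by linarith
  have hn1 : (1 : ℝ) ≤ n := by linarith
  have hL := one_le_sqrt_log hn3'
  have hlogn : 0 ≤ Real.log n := Real.log_nonneg hn1
  have hLsq := Real.sq_sqrt hlogn
  set L := √(Real.log n) with hLdef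
  have hlog1 : 1 ≤ Real.log n := by rw [← hLsq]; nlinarith
  have hLlog : L ≤ Real.log n := by rw [← hLsq]; nlinarith
  set ν : ℝ := (n : ℝ) ^ (-(1 / 2 : ℝ)) with hν
  have hν0 : 0 < ν := by positivity
  have hνc : ν ≤ |c| := by
    refine le_trans ?_ hc1
    rw [mul_right_comm]
    exact le_mul_of_one_le_left hν0.le (one_le_mul_of_one_le_of_one_le hC₁1 hlog1)
  have hcpos : 0 < |c| := hν0.trans_le hνc
  have hb0 : 0 < b₀ := lt_of_lt_of_le (by positivity) hb
  have hT0 : 0 ≤ T := le_trans (by positivity) hT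
  have hk1 := one_le_pnat_cast k
  have hk0 : (0 : ℝ) < k := by linarith
  have hl0 : 0 < l := lt_of_lt_of_le (by positivity) hl1
  have hkn : (k : ℝ) ≤ Bspn * (n : ℝ) ^ (κ / 2) := by
    refine hk.trans ?_
    gcongr
    calc |c| ^ (-κ) ≤ ν ^ (-κ) := Real.rpow_le_rpow_of_nonpos hν0 hνc (by linarith)
      _ = (n : ℝ) ^ (κ / 2) := by rw [hν, ← Real.rpow_mul hn0.le]; ring_nf
  refine hflow.signal_bound hT0 hl0 hb0 (abs_pos.1 hcpos) (fun t ht => (hg t ht).trans ?_) ?_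
  · have hlogk : Real.log k ≤ (1 + κ / 2) * Real.log n := by
      rw [← Real.log_rpow hn0]
      refine Real.log_le_log hk0 (hkn.trans ?_)
      rw [Real.rpow_add hn0, Real.rpow_one]
      gcongr
    have hlk : √(Real.log k) ≤ (1 + κ / 2) * L := by
      refine (Real.sqrt_le_sqrt hlogk).trans ?_
      rw [Real.sqrt_mul (by positivity)]
      gcongr
      rw [Real.sqrt_le_left (by positivity)]
      nlinarith
    have h1 : H * (L + √(Real.log k)) ≤ C₁ / 4 * Real.log n := by
      calc H * (L + √(Real.log k)) ≤ H * (L + (1 + κ / 2) * L) := by gcongr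
        _ = H * (2 + κ / 2) * L := by ring
        _ ≤ H * (2 + κ) * Real.log n := by gcongr; linarith
        _ ≤ C₁ / 4 * Real.log n := by gcongr; linarith
    calc H * (L + √(Real.log k)) * ν ≤ C₁ / 4 * Real.log n * ν := by gcongr
      _ = C₁ * ν * Real.log n / 4 := by ring
      _ ≤ |c| / 4 := by gcongr
  · intro A B hA hAB hge
    have hE : (2 + κ * γ / 4) * Real.log n ≤ b₀ ^ D * (|c| / 4) * T := by
      have hpre := rate_exponent D hn0
      calc (2 + κ * γ / 4) * Real.log n
          = 4 * (2 + κ * γ / 4) / (cb ^ D * ct) * (cb ^ D * ct / 4) * Real.log n := by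
            field_simp
        _ ≤ C₁ * (cb ^ D * ct / 4) * Real.log n := by gcongr
        _ = C₁ * (cb ^ D * ct / 4) * Real.log n *
            (((n : ℝ) ^ (-(1 / (2 * ((D : ℝ) + 2))))) ^ D *
              (n : ℝ) ^ (((D : ℝ) + 1) / ((D : ℝ) + 2)) * ν) := by rw [hpre, mul_one]
        _ = (cb * (n : ℝ) ^ (-(1 / (2 * ((D : ℝ) + 2))))) ^ D * (C₁ * ν * Real.log n / 4) *
            (ct * (n : ℝ) ^ (((D : ℝ) + 1) / ((D : ℝ) + 2))) := by rw [mul_pow]; ring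
        _ ≤ b₀ ^ D * (|c| / 4) * T := by gcongr
    have hexp : (n : ℝ) ^ (2 + κ * γ / 4) ≤ Real.exp (b₀ ^ D * (|c| / 4) * T) := by
      rw [Real.rpow_def_of_pos hn0, mul_comm]
      exact Real.exp_le_exp.2 hE
    have hsl : K * (n : ℝ) ^ (-(κ * γ / 4)) ≤ √l := by
      rw [Real.le_sqrt' (by positivity)]
      refine le_trans ?_ hl1
      have h1 : (Bspn * (n : ℝ) ^ (κ / 2)) ^ (-γ) ≤ (k : ℝ) ^ (-γ) :=
        Real.rpow_le_rpow_of_nonpos hk0 hkn (by linarith)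
      have h2 : (K * (n : ℝ) ^ (-(κ * γ / 4))) ^ 2 = ceig * (Bspn * (n : ℝ) ^ (κ / 2)) ^ (-γ) := by
        rw [hK, mul_pow, mul_pow, Real.sq_sqrt hceig.le, Real.mul_rpow hBspn.le (by positivity),
          ← Real.rpow_natCast, ← Real.rpow_natCast, ← Real.rpow_mul hBspn.le,
          ← Real.rpow_mul hn0.le, ← Real.rpow_mul hn0.le]
        push_cast
        rw [mul_assoc]
        congr 2
        · congr 1; ring
        · congr 1; ring
      rw [h2]
      gcongr
    have hS : K * (n : ℝ) ^ 2 ≤ A + B := by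
      refine le_trans ?_ hge
      calc K * (n : ℝ) ^ 2 = K * (n : ℝ) ^ (-(κ * γ / 4)) * (n : ℝ) ^ (2 + κ * γ / 4) := by
            rw [mul_assoc K, ← Real.rpow_add hn0, ← Real.rpow_natCast]; congr 2; push_cast; ring
        _ ≤ _ := by gcongr
    have hS4 : 4 * (n : ℝ) ≤ A + B := by
      refine le_trans ?_ hS
      rw [div_le_iff₀ hK0] at hnK
      calc 4 * (n : ℝ) ≤ n * K * n := by gcongr
        _ = K * (n : ℝ) ^ 2 := by ring
    have hlC : l ≤ Ceig := hl2.trans (mul_le_of_le_one_right hCeig.le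
      (Real.rpow_le_one_of_one_le_of_nonpos hk1 (by linarith)))
    obtain ⟨hAn, hBn⟩ := le_of_sq_eq_add_sq hAB hl0 (hlC.trans hnC) hn1 hS4
    have hb0D : cb ^ D ≤ b₀ ^ D * n := by
      have h1 : (n : ℝ) ^ (-(1 : ℝ)) ≤ ((n : ℝ) ^ (-(1 / (2 * ((D : ℝ) + 2))))) ^ D := by
        rw [← Real.rpow_natCast, ← Real.rpow_mul hn0.le]
        refine Real.rpow_le_rpow_of_exponent_le hn1 ?_
        rw [neg_mul, neg_le_neg_iff, div_mul_eq_mul_div, div_le_one (by positivity)]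
        linarith [(Nat.cast_nonneg D : (0 : ℝ) ≤ D)]
      calc cb ^ D = cb ^ D * (n : ℝ) ^ (-(1 : ℝ)) * n := by
            rw [Real.rpow_neg_one]; field_simp
        _ ≤ cb ^ D * ((n : ℝ) ^ (-(1 / (2 * ((D : ℝ) + 2))))) ^ D * n := by gcongr
        _ = (cb * (n : ℝ) ^ (-(1 / (2 * ((D : ℝ) + 2))))) ^ D * n := by rw [mul_pow]
        _ ≤ b₀ ^ D * n := by gcongr
    rw [div_le_iff₀ (by positivity)] at hnBinf
    calc |c| ≤ n * cb ^ D := hc2.trans hnBinf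
      _ ≤ n * (b₀ ^ D * n) := by gcongr
      _ = n * b₀ ^ D * n := by ring
      _ ≤ A * b₀ ^ D * B := by gcongr

theorem add_mul_le_exp {L x : ℝ} (hx : 0 ≤ x) :
    (L + x) * (1 + x) ≤ Real.exp L * Real.exp (2 * x) := by
  have h1 : L + x ≤ Real.exp (L + x) := by linarith [Real.add_one_le_exp (L + x)]
  have h2 : 1 + x ≤ Real.exp x := by linarith [Real.add_one_le_exp x]
  calc (L + x) * (1 + x) ≤ Real.exp (L + x) * Real.exp x := by gcongr
    _ = Real.exp L * Real.exp (2 * x) := by rw [← Real.exp_add, ← Real.exp_add]; ring_nf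

set_option maxHeartbeats 1000000 in
/-- The weighted `ℓ¹` error of the coefficients is bounded by a constant which does not depend on
the size `H` of the error in the driving force. -/
theorem weighted_error_bound (D : ℕ) {Ceig γ Binf κ Bspn s₀ Bsig Ct cb Cb : ℝ}
    (hCeig : 0 < Ceig) (hγ : 1 < γ) (hκ : 1 ≤ κ) (hBspn : 0 < Bspn) (hs₀ : 0 < s₀)
    (hBsig : 0 < Bsig) (hCt : 0 < Ct) (hcb : 0 < cb) (hCb : 0 < Cb) :
    ∃ M : ℝ, 0 < M ∧ ∀ H : ℝ, 0 < H → ∃ N : ℕ, ∀ n : ℕ, N ≤ n →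
      ∀ (T b₀ : ℝ) (lam θs : ℕ+ → ℝ) (a b β g : ℝ → ℕ+ → ℝ),
      0 ≤ T → T ≤ Ct * (n : ℝ) ^ (((D : ℝ) + 1) / ((D : ℝ) + 2)) →
      cb * (n : ℝ) ^ (-(1 / (2 * ((D : ℝ) + 2)))) ≤ b₀ →
      b₀ ≤ Cb * (n : ℝ) ^ (-(1 / (2 * ((D : ℝ) + 2)))) →
      (∀ k, 0 < lam k) → (∀ k : ℕ+, lam k ≤ Ceig * (k : ℝ) ^ (-γ)) →
      SignalSpan θs Binf κ Bspn s₀ Bsig →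
      (∀ k, CoordFlow D (lam k) b₀ T (fun t => a t k) (fun t => b t k) (fun t => β t k)
        (fun t => g t k)) →
      (∀ t ∈ Icc 0 T, ∀ k, |g t k - (θs k - a t k * b t k ^ D * β t k)| ≤
        H * (√(Real.log n) + √(Real.log k)) * (n : ℝ) ^ (-(1 / 2 : ℝ))) →
      Summable (fun j : ℕ+ => |θs j - a T j * b T j ^ D * β T j| * (1 + √(Real.log j))) ∧
        ∑' j : ℕ+, |θs j - a T j * b T j ^ D * β T j| * (1 + √(Real.log j)) ≤ M := by
  -- Since `q > 1 - s₀`, the sum of `|θ*_j|^q` with its sub-polynomial weight is finite; since `q <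
  -- 1`, there are `o(√n)` indices with `|θ*_j| > n^(-1/2)`.
  obtain ⟨q, hq0, hq1⟩ : ∃ q, max 0 (1 - s₀) < q ∧ q < 1 :=
    exists_between (max_lt one_pos (by linarith))
  have hqpos : 0 < q := lt_of_le_of_lt (le_max_left _ _) hq0
  -- `α > 1/γ` makes `∑ λ_j^α` converge. The `s` chosen next is auxiliary and unrelated to the one
  -- in the theorem: it only has to satisfy `α (1 + s) < 1`, so that the indices with `λ_j >
  -- n^(-(1+s)/(D+2))` also number `o(√n)`.
  obtain ⟨α, hα1, hα2⟩ : ∃ α, 1 / γ < α ∧ α < 1 :=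
    exists_between (by rw [div_lt_one (by linarith)]; exact hγ)
  have hα0 : 0 < α := lt_trans (by positivity) hα1
  have hγα : 1 < γ * α := by
    rw [div_lt_iff₀ (by linarith)] at hα1
    linarith
  obtain ⟨s, hs0, hs1⟩ : ∃ s, 0 < s ∧ s < 1 / α - 1 :=
    exists_between (by rw [sub_pos, lt_div_iff₀ hα0]; linarith)
  have hsα : α * (1 + s) < 1 := by
    have : 1 + s < 1 / α := by linarith
    rw [lt_div_iff₀ hα0] at this
    linarith
  obtain ⟨K₁, hK₁0, hK₁⟩ := exists_tsum_rpow_mul_exp_le (Binf := Binf) (s₀ := s₀) 2 hqpos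
    (lt_of_le_of_lt (le_max_right _ _) hq0) hκ hBspn hBsig
  set B : ℝ := max Binf 1 with hB
  have hB1 : 1 ≤ B := le_max_right _ _
  -- The first term comes from `θ*` alone. Everything involving `H` or `C₃` sits in three further
  -- terms that carry a negative power of `n`, each at most `1` for large `n`. This is why `M` can
  -- be fixed before `H`.
  refine ⟨2 * B ^ (1 - q) * K₁ + 3, by positivity, fun H hH => ?_⟩
  obtain ⟨C₃, hC₃, N₁, hN₁⟩ := noise_component D hs0 hH hCeig hγ hCt hcb hCb
  have hSum : ∀ c : ℝ, Summable fun j : ℕ+ =>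
      (Ceig * (j : ℝ) ^ (-γ)) ^ α * Real.exp (c * √(Real.log j)) := fun c => by
    refine ((summable_rpow_mul_exp_sqrt_log hγα c).mul_left (Ceig ^ α)).congr fun j => ?_
    rw [Real.mul_rpow hCeig.le (by positivity), ← Real.rpow_mul (by positivity), neg_mul]
    ring
  set K₂ : ℝ := ∑' j : ℕ+, (Ceig * (j : ℝ) ^ (-γ)) ^ α * Real.exp (2 * √(Real.log j)) with hK₂
  set K₃ : ℝ := ∑' j : ℕ+, (Ceig * (j : ℝ) ^ (-γ)) ^ α *
    Real.exp ((2 * C₃ + 1) * √(Real.log j)) with hK₃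
  set C₄ : ℝ := (√(1 + D) * Cb) ^ D with hC₄
  obtain ⟨N, hN⟩ := eventually_atTop.1 (((eventually_ge_atTop (max 3 N₁)).and
    (eventually_exp_sqrt_log_mul_rpow_le (H * K₂) 1 (p := (1 - α * (1 + s)) / 2) (ε := 1)
      (by linarith) one_pos)).and
    ((eventually_exp_sqrt_log_mul_rpow_le (H * K₁) 1 (p := (1 - q) / 2) (ε := 1)
      (by linarith) one_pos).and
    (eventually_exp_sqrt_log_mul_rpow_le (C₄ * K₃) (2 * C₃)
      (p := (1 - α) * ((1 + s) / ((D : ℝ) + 2))) (ε := 1)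
      (mul_pos (by linarith) (by positivity)) one_pos)))
  refine ⟨N, fun n hn T b₀ lam θs a b β g hT0 hT hb1 hb2 hlam hlamu hθs hflow hg => ?_⟩
  obtain ⟨⟨hn1, hE₂⟩, hE₁, hE₃⟩ := hN n hn
  have hn3 : 3 ≤ n := (le_max_left _ _).trans hn1
  have hnN : N₁ ≤ n := (le_max_right _ _).trans hn1
  have hn1' : (1 : ℝ) ≤ n := by exact_mod_cast (by omega : 1 ≤ n)
  have hn0 : (0 : ℝ) < n := by linarith
  rw [one_mul] at hE₁ hE₂
  have hTm : T ∈ Icc 0 T := ⟨hT0, le_rfl⟩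
  set L := √(Real.log n) with hL
  set ν : ℝ := (n : ℝ) ^ (-(1 / 2 : ℝ)) with hν
  have hν0 : 0 < ν := by positivity
  have hb0 : 0 < b₀ := lt_of_lt_of_le (by positivity) hb1
  obtain ⟨hS₁, hS₁K⟩ := hK₁ θs hθs
  set u : ℕ+ → ℝ := fun j => |θs j| ^ q * Real.exp (2 * √(Real.log j)) with hu
  set v₂ : ℕ+ → ℝ := fun j => (Ceig * (j : ℝ) ^ (-γ)) ^ α * Real.exp (2 * √(Real.log j)) with hv₂
  set v₃ : ℕ+ → ℝ := fun j => (Ceig * (j : ℝ) ^ (-γ)) ^ α *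
    Real.exp ((2 * C₃ + 1) * √(Real.log j)) with hv₃
  set A₂ : ℝ := H * Real.exp L * (n : ℝ) ^ (-((1 - α * (1 + s)) / 2)) with hA₂
  set A₁ : ℝ := H * Real.exp L * (n : ℝ) ^ (-((1 - q) / 2)) with hA₁
  set A₃ : ℝ := C₄ * Real.exp (2 * C₃ * L) *
    (n : ℝ) ^ (-((1 - α) * ((1 + s) / ((D : ℝ) + 2)))) with hA₃
  have hterm : ∀ j : ℕ+, |θs j - a T j * b T j ^ D * β T j| * (1 + √(Real.log j)) ≤
      2 * B ^ (1 - q) * u j + A₂ * v₂ j + A₁ * u j + A₃ * v₃ j := by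
    intro j
    have hj1 := one_le_pnat_cast j
    have hj0 : (0 : ℝ) < j := by linarith
    set x := √(Real.log j) with hx
    have hx0 : 0 ≤ x := Real.sqrt_nonneg _
    have hu0 : 0 ≤ u j := by positivity
    have hv₂0 : 0 ≤ v₂ j := by positivity
    have hv₃0 : 0 ≤ v₃ j := by positivity
    have hA₁0 : 0 ≤ A₁ := by positivity
    have hA₂0 : 0 ≤ A₂ := by positivity
    have hA₃0 : 0 ≤ A₃ := by positivity
    have hx1 : 1 + x ≤ Real.exp x := by linarith [Real.add_one_le_exp x]
    have hθu : |θs j| * (1 + x) ≤ B ^ (1 - q) * u j := by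
      have h1 : |θs j| ≤ |θs j| ^ q * B ^ (1 - q) := by
        rcases eq_or_ne (θs j) 0 with h0 | h0
        · rw [h0, abs_zero, Real.zero_rpow hqpos.ne', zero_mul]
        · have hpos : 0 < |θs j| := abs_pos.2 h0
          calc |θs j| = |θs j| ^ q * |θs j| ^ (1 - q) := by
                rw [← Real.rpow_add hpos, add_sub_cancel, Real.rpow_one]
            _ ≤ _ := by
                gcongr
                exact (hθs.bounded j).trans (le_max_left _ _)
      calc |θs j| * (1 + x) ≤ |θs j| ^ q * B ^ (1 - q) * Real.exp (2 * x) := by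
            gcongr
            exact hx1.trans (Real.exp_le_exp.2 (by linarith))
        _ = _ := by rw [hu]; ring
    have hsub : |θs j - a T j * b T j ^ D * β T j| ≤ |θs j| + |a T j * b T j ^ D * β T j| :=
      abs_sub _ _
    by_cases hcase : lam j ≤ (n : ℝ) ^ (-((1 + s) / ((D : ℝ) + 2))) ∧ |θs j| ≤ ν
    · obtain ⟨hbT, haT⟩ := hN₁ n hnN T b₀ (lam j) (θs j) j _ _ _ _ hT0 hT hb1 hb2 (hlam j)
        (hlamu j) hcase.1 hcase.2 (hflow j) (fun t ht => hg t ht j) T hTm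
      have hbp := (hflow j).b_pos hb0 T hTm
      have hap := (hflow j).a_pos (hlam j) T hTm
      have hβ := ((hflow j).abs_β_lt_a (hlam j) T hTm).le
      have hb0C : b₀ ≤ Cb := hb2.trans (mul_le_of_le_one_right hCb.le
        (Real.rpow_le_one_of_one_le_of_nonpos hn1' (by
          rw [neg_nonpos]; positivity)))
      have hlamα : lam j ≤ (Ceig * (j : ℝ) ^ (-γ)) ^ α *
          (n : ℝ) ^ (-((1 - α) * ((1 + s) / ((D : ℝ) + 2)))) := by
        calc lam j = lam j ^ α * lam j ^ (1 - α) := by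
              rw [← Real.rpow_add (hlam j), add_sub_cancel, Real.rpow_one]
          _ ≤ (Ceig * (j : ℝ) ^ (-γ)) ^ α * ((n : ℝ) ^ (-((1 + s) / ((D : ℝ) + 2)))) ^ (1 - α) := by
              have h1 := (hlam j).le
              have h2 := hlamu j
              have h3 := hcase.1
              gcongr
          _ = _ := by rw [← Real.rpow_mul hn0.le]; ring_nf
      have hθ : |a T j * b T j ^ D * β T j| ≤ C₄ * (Real.exp (2 * C₃ * L) *
          Real.exp (2 * C₃ * x)) * lam j := by
        rw [abs_mul, abs_of_pos (by positivity)]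
        calc a T j * b T j ^ D * |β T j| ≤ a T j * b T j ^ D * a T j := by gcongr
          _ ≤ (√(lam j) * Real.exp (C₃ * (L + x))) * (√(1 + D) * Cb) ^ D *
              (√(lam j) * Real.exp (C₃ * (L + x))) := by
              gcongr
              exact hbT.trans (by gcongr)
          _ = C₄ * (Real.exp (C₃ * (L + x)) * Real.exp (C₃ * (L + x))) *
              (√(lam j) * √(lam j)) := by rw [hC₄]; ring
          _ = _ := by
              rw [Real.mul_self_sqrt (hlam j).le, ← Real.exp_add, ← Real.exp_add]
              ring_nf
      have hmul : |a T j * b T j ^ D * β T j| * (1 + x) ≤ A₃ * v₃ j := by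
        calc |a T j * b T j ^ D * β T j| * (1 + x)
            ≤ C₄ * (Real.exp (2 * C₃ * L) * Real.exp (2 * C₃ * x)) * ((Ceig * (j : ℝ) ^ (-γ)) ^ α *
              (n : ℝ) ^ (-((1 - α) * ((1 + s) / ((D : ℝ) + 2))))) * Real.exp x := by
              gcongr
              exact hθ.trans (by gcongr)
          _ = A₃ * ((Ceig * (j : ℝ) ^ (-γ)) ^ α * (Real.exp (2 * C₃ * x) * Real.exp x)) := by
              rw [hA₃]; ring
          _ = A₃ * v₃ j := by
              have : (2 * C₃ + 1) * x = 2 * C₃ * x + x := by ring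
              rw [← Real.exp_add, ← this]
      calc _ ≤ (|θs j| + |a T j * b T j ^ D * β T j|) * (1 + x) := by gcongr
        _ = |θs j| * (1 + x) + |a T j * b T j ^ D * β T j| * (1 + x) := by ring
        _ ≤ B ^ (1 - q) * u j + A₃ * v₃ j := add_le_add hθu hmul
        _ ≤ _ := by
          have h1 : 0 ≤ B ^ (1 - q) * u j := by positivity
          have h2 : 0 ≤ A₂ * v₂ j := by positivity
          have h3 : 0 ≤ A₁ * u j := by positivity
          linarith
    · have hθ := (hflow j).abs_theta_le (c := θs j) (r := H * (L + x) * ν) (by positivity)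
        (fun t ht => hg t ht j) T hTm
      -- An index outside the noise set satisfies either `1 ≤ n^(α(1+s)/2) (Ceig j^(-γ))^α` (from
      -- `λ_j` large and `D + 2 ≥ 2`) or `1 ≤ n^(q/2) |θ*_j|^q`. Multiplying by this replaces
      -- counting the indices by a convergent sum.
      have hone : H * ν * (Real.exp L * Real.exp (2 * x)) ≤ A₂ * v₂ j + A₁ * u j := by
        rw [not_and_or, not_le, not_le] at hcase
        rcases hcase with hc | hc
        · have h1 : 1 ≤ (n : ℝ) ^ (α * (1 + s) / 2) * (Ceig * (j : ℝ) ^ (-γ)) ^ α := by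
            calc (1 : ℝ) ≤ (n : ℝ) ^ (α * (1 + s) / 2 + -((1 + s) / ((D : ℝ) + 2)) * α) := by
                  refine Real.one_le_rpow hn1' ?_
                  have : (1 + s) / ((D : ℝ) + 2) ≤ (1 + s) / 2 := by
                    gcongr
                    linarith [(Nat.cast_nonneg D : (0 : ℝ) ≤ D)]
                  have := mul_le_mul_of_nonneg_left this hα0.le
                  linarith
              _ = (n : ℝ) ^ (α * (1 + s) / 2) *
                  ((n : ℝ) ^ (-((1 + s) / ((D : ℝ) + 2)))) ^ α := by
                  rw [Real.rpow_add hn0, ← Real.rpow_mul hn0.le]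
              _ ≤ _ := by
                  gcongr
                  exact hc.le.trans (hlamu j)
          calc H * ν * (Real.exp L * Real.exp (2 * x))
              ≤ H * ν * (Real.exp L * Real.exp (2 * x)) *
                ((n : ℝ) ^ (α * (1 + s) / 2) * (Ceig * (j : ℝ) ^ (-γ)) ^ α) :=
                le_mul_of_one_le_right (by positivity) h1
            _ = H * Real.exp L * (ν * (n : ℝ) ^ (α * (1 + s) / 2)) * v₂ j := by rw [hv₂]; ring
            _ = A₂ * v₂ j := by rw [hν, ← Real.rpow_add hn0, hA₂]; ring_nf
            _ ≤ _ := by have : 0 ≤ A₁ * u j := by positivity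
                        linarith
        · have h1 : 1 ≤ (n : ℝ) ^ (q / 2) * |θs j| ^ q := by
            calc (1 : ℝ) = (n : ℝ) ^ (q / 2) * ν ^ q := by
                  rw [hν, ← Real.rpow_mul hn0.le, ← Real.rpow_add hn0]
                  ring_nf
                  simp
              _ ≤ _ := by gcongr
          calc H * ν * (Real.exp L * Real.exp (2 * x))
              ≤ H * ν * (Real.exp L * Real.exp (2 * x)) * ((n : ℝ) ^ (q / 2) * |θs j| ^ q) :=
                le_mul_of_one_le_right (by positivity) h1
            _ = H * Real.exp L * (ν * (n : ℝ) ^ (q / 2)) * u j := by rw [hu]; ring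
            _ = A₁ * u j := by rw [hν, ← Real.rpow_add hn0, hA₁]; ring_nf
            _ ≤ _ := by have : 0 ≤ A₂ * v₂ j := by positivity
                        linarith
      calc _ ≤ (|θs j| + (|θs j| + H * (L + x) * ν)) * (1 + x) := by gcongr; linarith
        _ = 2 * (|θs j| * (1 + x)) + H * ν * ((L + x) * (1 + x)) := by ring
        _ ≤ 2 * (B ^ (1 - q) * u j) + H * ν * (Real.exp L * Real.exp (2 * x)) := by
            have := mul_le_mul_of_nonneg_left (add_mul_le_exp (L := L) hx0)
              (by positivity : 0 ≤ H * ν)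
            linarith
        _ ≤ 2 * (B ^ (1 - q) * u j) + (A₂ * v₂ j + A₁ * u j) := by gcongr
        _ ≤ _ := by have : 0 ≤ A₃ * v₃ j := by positivity
                    linarith
  have hs1 := hS₁.mul_left (2 * B ^ (1 - q))
  have hs2 := (hSum 2).mul_left A₂
  have hs3 := hS₁.mul_left A₁
  have hs4 := (hSum (2 * C₃ + 1)).mul_left A₃
  have htot := ((hs1.add hs2).add hs3).add hs4
  have hsum := Summable.of_nonneg_of_le (fun j : ℕ+ => by positivity) hterm htot
  refine ⟨hsum, (hsum.tsum_le_tsum hterm htot).trans ?_⟩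
  rw [((hs1.add hs2).add hs3).tsum_add hs4, (hs1.add hs2).tsum_add hs3, hs1.tsum_add hs2,
    tsum_mul_left, tsum_mul_left, tsum_mul_left, tsum_mul_left]
  have e1 : 2 * B ^ (1 - q) * ∑' j, u j ≤ 2 * B ^ (1 - q) * K₁ := by gcongr
  have e2 : A₂ * ∑' j, v₂ j ≤ 1 := by
    refine le_trans (le_of_eq ?_) hE₂
    rw [hA₂, ← hK₂]; ring
  have e3 : A₁ * ∑' j, u j ≤ 1 := by
    refine le_trans ?_ hE₁
    calc A₁ * ∑' j, u j ≤ A₁ * K₁ := by gcongr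
      _ = _ := by rw [hA₁]; ring
  have e4 : A₃ * ∑' j, v₃ j ≤ 1 := by
    refine le_trans (le_of_eq ?_) hE₃
    rw [hA₃, ← hK₃]; ring
  linarith

/-- On the event where the noise and the empirical Gram matrix concentrate, the driving force of
every coordinate is close to the one of the population gradient flow. -/
theorem residual_bound (D : ℕ) {H₀ Ceig γ Binf κ Bspn s₀ Bsig Ct cb Cb : ℝ} (hH₀ : 0 < H₀)
    (hCeig : 0 < Ceig) (hγ : 1 < γ) (hκ : 1 ≤ κ) (hBspn : 0 < Bspn) (hs₀ : 0 < s₀)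
    (hBsig : 0 < Bsig) (hCt : 0 < Ct) (hcb : 0 < cb) (hCb : 0 < Cb) :
    ∃ H : ℝ, 0 < H ∧ ∃ N : ℕ, ∀ n : ℕ, N ≤ n →
      ∀ (T b₀ : ℝ) (lam θs noise : ℕ+ → ℝ) (Δ : ℕ+ → ℕ+ → ℝ) (a b β g : ℝ → ℕ+ → ℝ) (CΔ : ℝ),
      T ≤ Ct * (n : ℝ) ^ (((D : ℝ) + 1) / ((D : ℝ) + 2)) →
      cb * (n : ℝ) ^ (-(1 / (2 * ((D : ℝ) + 2)))) ≤ b₀ →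
      b₀ ≤ Cb * (n : ℝ) ^ (-(1 / (2 * ((D : ℝ) + 2)))) →
      (∀ k, 0 < lam k) → (∀ k : ℕ+, lam k ≤ Ceig * (k : ℝ) ^ (-γ)) →
      SignalSpan θs Binf κ Bspn s₀ Bsig →
      (∀ k, CoordFlow D (lam k) b₀ T (fun t => a t k) (fun t => b t k) (fun t => β t k)
        (fun t => g t k)) →
      (∀ k : ℕ+, |noise k| ≤ H₀ * (√(Real.log n) + √(Real.log k)) * (n : ℝ) ^ (-(1 / 2 : ℝ))) →
      (∀ j k : ℕ+, |Δ j k| ≤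
        H₀ * (√(Real.log n) + √(Real.log j) + √(Real.log k)) * (n : ℝ) ^ (-(1 / 2 : ℝ))) →
      (∀ j k, |Δ j k| ≤ CΔ) →
      (∀ t ∈ Icc 0 T, ∀ k, g t k = θs k - a t k * b t k ^ D * β t k +
        (noise k + ∑' j, (θs j - a t j * b t j ^ D * β t j) * Δ j k)) →
      (∀ t ∈ Icc 0 T, Summable fun j => |θs j - a t j * b t j ^ D * β t j|) →
      (∀ t ∈ Icc 0 T, ∀ ε > 0, ∃ δ > 0, ∀ s ∈ Icc 0 T, |s - t| ≤ δ →
        ∑' j, |a s j * b s j ^ D * β s j - a t j * b t j ^ D * β t j| ≤ ε) →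
      ∀ t ∈ Icc 0 T, ∀ k : ℕ+, |g t k - (θs k - a t k * b t k ^ D * β t k)| ≤
        H * (√(Real.log n) + √(Real.log k)) * (n : ℝ) ^ (-(1 / 2 : ℝ)) := by
  obtain ⟨M, hM, hbound⟩ := weighted_error_bound D (Binf := Binf) hCeig hγ hκ hBspn hs₀ hBsig
    hCt hcb hCb
  -- Twice the bound `H₀ (1 + M)` that the weighted error yields, so that the bootstrap gains the
  -- factor `1/2`.
  have hH : 0 < 2 * (H₀ * (1 + M)) := by positivity
  obtain ⟨N, hN⟩ := hbound _ hH
  refine ⟨2 * (H₀ * (1 + M)), hH, max N 3, fun n hn T b₀ lam θs noise Δ a b β g CΔ hT hb1 hb2 hlam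
    hlamu hθs hflow hnoise hΔ hΔC hres hsum hcont t ht k => ?_⟩
  have hn3 : 3 ≤ n := (le_max_right _ _).trans hn
  have hnN : N ≤ n := (le_max_left _ _).trans hn
  have hn0 : (0 : ℝ) < n := by positivity
  have hL := one_le_sqrt_log hn3
  set L := √(Real.log n) with hLdef
  set ν : ℝ := (n : ℝ) ^ (-(1 / 2 : ℝ)) with hν
  have hν0 : 0 < ν := by positivity
  have hb0 : 0 < b₀ := lt_of_lt_of_le (by positivity) hb1
  set θ : ℝ → ℕ+ → ℝ := fun t j => a t j * b t j ^ D * β t j with hθ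
  set h : ℕ+ → ℝ → ℝ := fun k t => noise k + ∑' j, (θs j - θ t j) * Δ j k with hh
  have hgh : ∀ t ∈ Icc 0 T, ∀ k, g t k - (θs k - θ t k) = h k t := fun t ht k => by
    rw [hres t ht k]; simp only [hh, hθ]; ring
  have hΔC0 : 0 ≤ CΔ := (abs_nonneg _).trans (hΔC 1 1)
  have hsumΔ : ∀ t ∈ Icc 0 T, ∀ k, Summable fun j => (θs j - θ t j) * Δ j k := fun t ht k => by
    refine Summable.of_norm_bounded (g := fun j => |θs j - θ t j| * CΔ)
      ((hsum t ht).mul_right CΔ) fun j => ?_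
    rw [Real.norm_eq_abs, abs_mul]
    exact mul_le_mul_of_nonneg_left (hΔC j k) (abs_nonneg _)
  have himprove : ∀ t ∈ Icc 0 T,
      Summable (fun j : ℕ+ => |θs j - θ t j| * (1 + √(Real.log j))) →
      ∑' j : ℕ+, |θs j - θ t j| * (1 + √(Real.log j)) ≤ M →
      ∀ k : ℕ+, |h k t| ≤ 2 * (H₀ * (1 + M)) * (L + √(Real.log k)) * ν / 2 := by
    intro t ht hS hle k
    set y := √(Real.log k) with hy
    have hy0 : 0 ≤ y := Real.sqrt_nonneg _
    have hterm : ∀ j : ℕ+, ‖(θs j - θ t j) * Δ j k‖ ≤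
        |θs j - θ t j| * (1 + √(Real.log j)) * (H₀ * (L + y) * ν) := fun j => by
      rw [Real.norm_eq_abs, abs_mul, mul_assoc]
      gcongr
      refine (hΔ j k).trans ?_
      have hx0 : 0 ≤ √(Real.log j) := Real.sqrt_nonneg _
      -- Uses `L ≥ 1`: the dependence on `j` factors out into the weight `1 + √(log j)`.
      have : L + √(Real.log j) + y ≤ (1 + √(Real.log j)) * (L + y) := by nlinarith
      calc _ ≤ H₀ * ((1 + √(Real.log j)) * (L + y)) * ν := by gcongr
        _ = _ := by ring
    have hts := tsum_of_norm_bounded (hS.mul_right (H₀ * (L + y) * ν)).hasSum hterm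
    rw [tsum_mul_right, Real.norm_eq_abs] at hts
    calc |h k t| ≤ |noise k| + |∑' j, (θs j - θ t j) * Δ j k| := abs_add_le _ _
      _ ≤ H₀ * (L + y) * ν + M * (H₀ * (L + y) * ν) := by
          gcongr
          · exact hnoise k
          · exact hts.trans (by gcongr)
      _ = _ := by ring
  have hmain : ∀ t ∈ Icc 0 T, (∀ s ∈ Icc 0 t, ∀ k : ℕ+,
      |h k s| ≤ 2 * (H₀ * (1 + M)) * (L + √(Real.log k)) * ν) →
      ∀ k : ℕ+, |h k t| ≤ 2 * (H₀ * (1 + M)) * (L + √(Real.log k)) * ν / 2 := by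
    intro t ht hs
    obtain ⟨h1, h2⟩ := hN n hnN t b₀ lam θs a b β g ht.1 (ht.2.trans hT) hb1 hb2 hlam hlamu hθs
      (fun k => (hflow k).mono ht.2) (fun s hst k => by
        rw [hgh s ⟨hst.1, hst.2.trans ht.2⟩ k]; exact hs s hst k)
    exact himprove t ht h1 h2
  have hT0 : 0 ≤ T := ht.1.trans ht.2
  rw [hgh t ht k]
  refine bootstrap (fun k => by positivity) ?_ hmain ?_ t ht k
  · intro k
    have h0m : (0 : ℝ) ∈ Icc 0 T := ⟨le_rfl, hT0⟩
    have hnT : (0 : ℝ) ≤ Ct * (n : ℝ) ^ (((D : ℝ) + 1) / ((D : ℝ) + 2)) := by positivity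
    -- The start of the bootstrap: the weighted error bound is applied to constant curves on the
    -- degenerate interval `[0, 0]` with `g = θs`, for which the force has no error. It yields the
    -- bound on `∑ |θ*_j| (1 + √(log j))`.
    obtain ⟨h1, h2⟩ := hN n hnN 0 b₀ lam θs (fun _ j => √(lam j)) (fun _ _ => b₀) (fun _ _ => 0)
      (fun _ k => θs k)
      le_rfl hnT hb1 hb2 hlam hlamu hθs
      (fun k => ⟨rfl, rfl, rfl, fun t ht => by simpa using hasDerivWithinAt_const _ _ _,
        fun t ht => by simpa using hasDerivWithinAt_const _ _ _, fun t ht => by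
          rw [Icc_self]
          exact HasFDerivWithinAt.of_subsingleton subsingleton_singleton⟩) (fun s hst k => by
        simp only [mul_zero, sub_zero, sub_self, abs_zero]
        positivity)
    have hθ0 : ∀ j, θ 0 j = 0 := fun j => by simp only [hθ, (hflow j).init_β, mul_zero]
    simp only [mul_zero] at h1 h2
    have := himprove 0 h0m (by simpa only [hθ0] using h1) (by simpa only [hθ0] using h2) k
    refine this.trans (half_le_self ?_)
    positivity
  · intro t ht ε hε
    -- `CΔ` bounds the variation of every `h k` by the `ℓ¹` variation of the coefficients, and the
    -- bounds to be proved are all at least `2 H₀ (1 + M) L ν`. One `δ` thus serves all `k`.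
    obtain ⟨δ, hδ, hc⟩ := hcont t ht (ε * (2 * (H₀ * (1 + M)) * L * ν) / (CΔ + 1)) (by positivity)
    refine ⟨δ, hδ, fun s hs hst k => ?_⟩
    have hdiff : h k s - h k t = ∑' j, (θ t j - θ s j) * Δ j k := by
      simp only [hh]
      rw [add_sub_add_left_eq_sub, ← (hsumΔ s hs k).tsum_sub (hsumΔ t ht k)]
      exact tsum_congr fun j => by ring
    have hsθ : Summable fun j => |θ s j - θ t j| := by
      refine Summable.of_nonneg_of_le (fun j => abs_nonneg _) (fun j => ?_)
        ((hsum t ht).add (hsum s hs))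
      have := abs_sub (θs j - θ t j) (θs j - θ s j)
      rwa [show θs j - θ t j - (θs j - θ s j) = θ s j - θ t j by ring] at this
    have hts := tsum_of_norm_bounded (f := fun j => (θ t j - θ s j) * Δ j k)
      (hsθ.mul_right CΔ).hasSum fun j => by
      rw [Real.norm_eq_abs, abs_mul, abs_sub_comm]
      exact mul_le_mul_of_nonneg_left (hΔC j k) (abs_nonneg _)
    rw [hdiff, ← Real.norm_eq_abs]
    refine hts.trans ?_
    rw [tsum_mul_right]
    have h1 := hc s hs hst
    have hX : 0 ≤ ε * (2 * (H₀ * (1 + M)) * L * ν) := by positivity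
    calc (∑' j, |θ s j - θ t j|) * CΔ
        ≤ ε * (2 * (H₀ * (1 + M)) * L * ν) / (CΔ + 1) * CΔ := by gcongr
      _ ≤ ε * (2 * (H₀ * (1 + M)) * L * ν) := by
          rw [div_mul_eq_mul_div, div_le_iff₀ (by positivity)]
          nlinarith
      _ ≤ ε * (2 * (H₀ * (1 + M)) * (L + √(Real.log k)) * ν) := by
          gcongr
          exact le_add_of_nonneg_right (Real.sqrt_nonneg _)

/-! ### Calculus in `ℓ²` and global integral curves -/

/-- The sequence space `ℓ²`. -/
abbrev Ell2 := lp (fun _ : ℕ+ => ℝ) 2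

theorem memℓp_of_abs_le {f : ℕ+ → ℝ} {C : ℝ} (x : Ell2) (h : ∀ j, |f j| ≤ C * |x j|) :
    Memℓp f 2 := by
  refine Memℓp.mono (g := fun j => C * ‖x j‖) ?_ h
  exact (lp.memℓp x).norm.const_mul C

theorem norm_le_of_abs_le {y x : Ell2} {C : ℝ} (hC : 0 ≤ C) (h : ∀ j, |y j| ≤ C * |x j|) :
    ‖y‖ ≤ C * ‖x‖ := by
  have : ‖y‖ ≤ ‖C • x‖ := lp.norm_mono (by norm_num) fun j => by
    rw [lp.coeFn_smul, Pi.smul_apply, norm_smul, Real.norm_of_nonneg hC]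
    exact h j
  rwa [norm_smul, Real.norm_of_nonneg hC] at this

theorem abs_apply_le_norm (x : Ell2) (j : ℕ+) : |x j| ≤ ‖x‖ :=
  lp.norm_apply_le_norm (by norm_num) x j

/-- Multiplication of a square summable sequence by a bounded sequence. -/
def multL (m : ℕ+ → ℝ) (M : ℝ) (h : ∀ j, |m j| ≤ M) : Ell2 →L[ℝ] Ell2 :=
  LinearMap.mkContinuous
    { toFun := fun x => ⟨fun j => m j * x j, memℓp_of_abs_le (C := M) x fun j => by
        rw [abs_mul]; exact mul_le_mul_of_nonneg_right (h j) (abs_nonneg _)⟩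
      map_add' := fun x y => by ext j; exact mul_add _ _ _
      map_smul' := fun c x => by ext j; exact mul_left_comm _ _ _ } M
    fun x => norm_le_of_abs_le ((abs_nonneg _).trans (h 1)) fun j => by
      simp only [LinearMap.coe_mk, AddHom.coe_mk, abs_mul]
      exact mul_le_mul_of_nonneg_right (h j) (abs_nonneg _)

@[simp] theorem multL_apply (m : ℕ+ → ℝ) (M : ℝ) (h : ∀ j, |m j| ≤ M) (x : Ell2) (j : ℕ+) :
    multL m M h x j = m j * x j := rfl

/-- The coordinatewise product of two square summable sequences. -/
def mulL : Ell2 →L[ℝ] Ell2 →L[ℝ] Ell2 :=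
  LinearMap.mkContinuous₂
    (LinearMap.mk₂ ℝ (fun x y : Ell2 => multL x ‖x‖ (abs_apply_le_norm x) y)
      (fun x x' y => by ext j; exact add_mul _ _ _) (fun c x y => by ext j; exact mul_assoc _ _ _)
      (fun x y y' => by rw [map_add]) (fun c x y => by rw [map_smul])) 1
    fun x y => by
      rw [one_mul, LinearMap.mk₂_apply]
      exact norm_le_of_abs_le (norm_nonneg _) fun j => by
        rw [multL_apply, abs_mul]
        exact mul_le_mul_of_nonneg_right (abs_apply_le_norm x j) (abs_nonneg _)

@[simp] theorem mulL_apply (x y : Ell2) (j : ℕ+) : mulL x y j = x j * y j := rfl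

theorem holderConjugate_two : (2 : ℝ≥0∞).toReal.HolderConjugate (2 : ℝ≥0∞).toReal := by
  simp only [ENNReal.toReal_ofNat]
  exact Real.HolderConjugate.two_two

theorem summable_abs_mul (x y : Ell2) : Summable fun j => |x j * y j| := by
  refine (lp.summable_mul holderConjugate_two x y).congr fun j => ?_
  rw [abs_mul]; rfl

theorem tsum_abs_mul_le (x y : Ell2) : ∑' j, |x j * y j| ≤ ‖x‖ * ‖y‖ := by
  refine le_trans (le_of_eq (tsum_congr fun j => ?_))
    (lp.tsum_mul_le_mul_norm' holderConjugate_two x y)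
  rw [abs_mul]; rfl

theorem inner_ell2 (x y : Ell2) : inner ℝ x y = ∑' j, x j * y j := by
  rw [lp.inner_eq_tsum]
  exact tsum_congr fun j => by simp [mul_comm]

/-- Lipschitz continuity on every ball around the origin. -/
def LipOnBalls {E F : Type*} [SeminormedAddCommGroup E] [SeminormedAddCommGroup F]
    (f : E → F) : Prop :=
  ∀ R : ℝ, ∃ K : ℝ≥0, LipschitzOnWith K f (Metric.closedBall 0 R)

namespace LipOnBalls

variable {E F G H : Type*} [NormedAddCommGroup E] [NormedAddCommGroup F] [NormedAddCommGroup G]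
  [NormedAddCommGroup H]

theorem of_lipschitz {f : E → F} {K : ℝ≥0} (h : LipschitzWith K f) : LipOnBalls f :=
  fun _ => ⟨K, h.lipschitzOnWith⟩

theorem const (c : F) : LipOnBalls (fun _ : E => c) := of_lipschitz (K := 0) (LipschitzWith.const c)

theorem id : LipOnBalls (fun x : E => x) := of_lipschitz LipschitzWith.id

theorem add {f g : E → F} (hf : LipOnBalls f) (hg : LipOnBalls g) :
    LipOnBalls fun x => f x + g x := fun R => by
  obtain ⟨K, hK⟩ := hf R
  obtain ⟨L, hL⟩ := hg R
  exact ⟨K + L, hK.add hL⟩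

theorem sum {ι : Type*} {s : Finset ι} {f : ι → E → F} (hf : ∀ i ∈ s, LipOnBalls (f i)) :
    LipOnBalls fun x => ∑ i ∈ s, f i x := by
  classical
  induction s using Finset.induction_on with
  | empty => simpa using const (0 : F)
  | insert i s his ih =>
    simp only [Finset.sum_insert his]
    exact (hf i (Finset.mem_insert_self i s)).add
      (ih fun j hj => hf j (Finset.mem_insert_of_mem hj))

theorem bounded {f : E → F} (hf : LipOnBalls f) (R : ℝ) :
    ∃ C : ℝ, 0 ≤ C ∧ ∀ x ∈ Metric.closedBall (0 : E) R, ‖f x‖ ≤ C := by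
  -- The radius `|R|` ensures that the ball contains the origin, the reference point.
  obtain ⟨K, hK⟩ := hf |R|
  refine ⟨K * |R| + ‖f 0‖, by positivity, fun x hx => ?_⟩
  have hx' : x ∈ Metric.closedBall (0 : E) |R| :=
    Metric.closedBall_subset_closedBall (le_abs_self R) hx
  have h0 : (0 : E) ∈ Metric.closedBall (0 : E) |R| := Metric.mem_closedBall_self (abs_nonneg R)
  have h1 := hK.norm_sub_le hx' h0
  have h2 : ‖x - 0‖ ≤ |R| := by simpa using hx'
  have h3 := norm_sub_norm_le (f x) (f 0)
  have h4 : (K : ℝ) * ‖x - 0‖ ≤ K * |R| := by gcongr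
  linarith

variable [NormedSpace ℝ F] [NormedSpace ℝ G] [NormedSpace ℝ H]

theorem bilin (L : F →L[ℝ] G →L[ℝ] H) {f : E → F} {g : E → G} (hf : LipOnBalls f)
    (hg : LipOnBalls g) : LipOnBalls fun x => L (f x) (g x) := fun R => by
  obtain ⟨K₁, hK₁⟩ := hf R
  obtain ⟨K₂, hK₂⟩ := hg R
  obtain ⟨B₁, hB₁, h₁⟩ := hf.bounded R
  obtain ⟨B₂, hB₂, h₂⟩ := hg.bounded R
  refine ⟨⟨‖L‖ * (K₁ * B₂ + B₁ * K₂), by positivity⟩, ?_⟩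
  refine LipschitzOnWith.of_dist_le_mul fun x hx y hy => ?_
  rw [dist_eq_norm, dist_eq_norm]
  have e : L (f x) (g x) - L (f y) (g y) = L (f x - f y) (g x) + L (f y) (g x - g y) := by
    simp [map_sub]
  have a1 := L.le_opNorm₂ (f x - f y) (g x)
  have a2 := L.le_opNorm₂ (f y) (g x - g y)
  have b1 := hK₁.norm_sub_le hx hy
  have b2 := hK₂.norm_sub_le hx hy
  rw [e]
  calc _ ≤ ‖L‖ * ‖f x - f y‖ * ‖g x‖ + ‖L‖ * ‖f y‖ * ‖g x - g y‖ :=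
        (norm_add_le _ _).trans (add_le_add a1 a2)
    _ ≤ ‖L‖ * (K₁ * ‖x - y‖) * B₂ + ‖L‖ * B₁ * (K₂ * ‖x - y‖) := by
        gcongr
        · exact h₂ x hx
        · exact h₁ y hy
    _ = ‖L‖ * (K₁ * B₂ + B₁ * K₂) * ‖x - y‖ := by ring

theorem clm (L : F →L[ℝ] G) {f : E → F} (hf : LipOnBalls f) : LipOnBalls fun x => L (f x) :=
  fun R => by
    obtain ⟨K, hK⟩ := hf R
    exact ⟨_, L.lipschitz.comp_lipschitzOnWith hK⟩

end LipOnBalls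

/-- A vector field on a Hilbert space which is Lipschitz on balls and whose radial part grows at
most like a constant has integral curves on every bounded interval. -/
theorem exists_flow_of_inner_le {E : Type*} [NormedAddCommGroup E] [InnerProductSpace ℝ E]
    [CompleteSpace E] {F : E → E} (hF : LipOnBalls F) {Y T : ℝ} (hY : 0 ≤ Y) (hT : 0 ≤ T)
    (hin : ∀ x, inner ℝ x (F x) ≤ Y) :
    ∃ α : ℝ → E, α 0 = 0 ∧ ∀ t ∈ Icc 0 T, HasDerivWithinAt α (F (α t)) (Icc 0 T) t := by
  set R : ℝ := √(2 * Y * T) + 1 with hR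
  have hR0 : 0 < R := by positivity
  -- A cutoff equal to `1` on the ball of radius `R` and `0` outside twice that ball. The truncated
  -- field is bounded, so Picard–Lindelöf applies on all of `[0, T]`: a curve of speed at most `C`
  -- stays within distance `C T`.
  set χ : E → ℝ := fun x => max 0 (min 1 (2 - ‖x‖ / R)) with hχ
  have hχ0 : ∀ x, 0 ≤ χ x := fun x => le_max_left _ _
  have hχ1 : ∀ x, χ x ≤ 1 := fun x => max_le zero_le_one (min_le_left _ _)
  have hχL : LipOnBalls χ := by
    refine LipOnBalls.of_lipschitz (K := ⟨1 / R, by positivity⟩)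
      (LipschitzWith.of_dist_le_mul fun x y => ?_)
    rw [Real.dist_eq, dist_eq_norm]
    have h1 : |χ x - χ y| ≤ |min 1 (2 - ‖x‖ / R) - min 1 (2 - ‖y‖ / R)| := by
      have := abs_max_sub_max_le_max 0 (min 1 (2 - ‖x‖ / R)) 0 (min 1 (2 - ‖y‖ / R))
      simpa [hχ] using this
    have h2 : |min 1 (2 - ‖x‖ / R) - min 1 (2 - ‖y‖ / R)| ≤ |(2 - ‖x‖ / R) - (2 - ‖y‖ / R)| := by
      have := abs_min_sub_min_le_max 1 (2 - ‖x‖ / R) 1 (2 - ‖y‖ / R)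
      simpa using this
    refine (h1.trans h2).trans ?_
    have h3 : (2 - ‖x‖ / R) - (2 - ‖y‖ / R) = 1 / R * (‖y‖ - ‖x‖) := by ring
    rw [h3, abs_mul, abs_of_pos (by positivity : 0 < 1 / R), abs_sub_comm]
    exact mul_le_mul_of_nonneg_left (abs_norm_sub_norm_le x y) (by positivity)
  have hFt : LipOnBalls fun x => χ x • F x := hχL.bilin (ContinuousLinearMap.lsmul ℝ ℝ) hF
  obtain ⟨C, hC0, hC⟩ := hF.bounded (2 * R)
  have hbound : ∀ x, ‖χ x • F x‖ ≤ C := by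
    intro x
    by_cases hx : ‖x‖ ≤ 2 * R
    · rw [norm_smul, Real.norm_of_nonneg (hχ0 x)]
      have := hC x (by simpa using hx)
      calc χ x * ‖F x‖ ≤ 1 * C := by gcongr; exact hχ1 x
        _ = C := one_mul C
    · have : χ x = 0 := by
        simp only [hχ]
        refine max_eq_left ((min_le_right _ _).trans ?_)
        rw [sub_nonpos, le_div_iff₀ hR0]
        linarith
      rw [this, zero_smul, norm_zero]; exact hC0
  obtain ⟨K, hK⟩ := hFt (C * T)
  have hPL : IsPicardLindelof (fun _ => fun x => χ x • F x) (⟨0, le_rfl, hT⟩ : Icc (0 : ℝ) T)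
      (0 : E) ⟨C * T, by positivity⟩ 0 ⟨C, hC0⟩ K := by
    refine IsPicardLindelof.of_time_independent (fun x _ => hbound x) hK ?_
    change C * max (T - 0) (0 - 0) ≤ C * T - 0
    simp [hT]
  obtain ⟨α, hα0, hα⟩ := hPL.exists_eq_forall_mem_Icc_hasDerivWithinAt₀
  refine ⟨α, hα0, fun t ht => ?_⟩
  -- As `0 ≤ χ ≤ 1` and `Y ≥ 0`, the radial bound survives truncation. The curve therefore never
  -- leaves the ball of radius `R`, where the cutoff is invisible.
  have hnorm : ∀ t ∈ Icc 0 T, ‖α t‖ ^ 2 - 2 * Y * t ≤ 0 := by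
    refine le_of_deriv_nonpos_above (fun t ht => ((hα t ht).norm_sq).sub
      ((hasDerivAt_id t).const_mul (2 * Y)).hasDerivWithinAt) ?_ ?_
    · have : α 0 = 0 := hα0
      simp [this]
    · intro t ht _
      have h1 : inner ℝ (α t) (χ (α t) • F (α t)) ≤ Y := by
        rw [real_inner_smul_right]
        calc _ ≤ χ (α t) * Y := mul_le_mul_of_nonneg_left (hin _) (hχ0 _)
          _ ≤ 1 * Y := by gcongr; exact hχ1 _
          _ = Y := one_mul Y
      simp only [mul_one]
      linarith
  have hle : ‖α t‖ ≤ R := by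
    have h1 := hnorm t ht
    have h2 : ‖α t‖ ≤ √(2 * Y * T) := by
      refine Real.le_sqrt_of_sq_le ?_
      have : 2 * Y * t ≤ 2 * Y * T := by gcongr; exact ht.2
      linarith
    linarith
  have hone : χ (α t) = 1 := by
    simp only [hχ]
    have h1 : ‖α t‖ / R ≤ 1 := by rw [div_le_one hR0]; exact hle
    rw [min_eq_left (by linarith), max_eq_right zero_le_one]
  have := hα t ht
  simpa [hone] using this

/-! ### The gradient flow of the empirical loss -/

section Flow

variable {X : Type*}

/-- The empirical correlation of the residuals with the `k`-th eigenfunction. -/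
def resid (e : ℕ+ → X → ℝ) (D : ℕ) (fstar : X → ℝ) {n : ℕ} (z : Fin n → X × ℝ)
    (a b β : ℕ+ → ℝ) (k : ℕ+) : ℝ :=
  1 / (n : ℝ) * ∑ i, ((fstar (z i).1 + (z i).2) - predictor e D a b β (z i).1) * e k (z i).1

/-- As a function of a single coordinate of `a`, `b` or `β`, the predictor at `x_i` has the form `c
i + φ u * E i` with `φ` linear or a multiple of `u^D`; one computation covers all three gradients.
-/
theorem deriv_sum_sq {n : ℕ} (y c E : Fin n → ℝ) {φ : ℝ → ℝ} {φ' v : ℝ} (hφ : HasDerivAt φ φ' v) :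
    deriv (fun u => 1 / (2 * (n : ℝ)) * ∑ i, (y i - (c i + φ u * E i)) ^ 2) v =
      -(φ' * (1 / (n : ℝ) * ∑ i, (y i - (c i + φ v * E i)) * E i)) := by
  have h : ∀ i ∈ Finset.univ, HasDerivAt (fun u => (y i - (c i + φ u * E i)) ^ 2)
      (2 * (y i - (c i + φ v * E i)) * -(φ' * E i)) v := fun i _ => by
    have := (((hφ.mul_const (E i)).const_add (c i)).const_sub (y i)).pow 2
    refine this.congr_deriv ?_
    push_cast; ring
  rw [((HasDerivAt.fun_sum h).const_mul (1 / (2 * (n : ℝ)))).deriv, Finset.mul_sum, Finset.mul_sum,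
    Finset.mul_sum, ← Finset.sum_neg_distrib]
  refine Finset.sum_congr rfl fun i _ => ?_
  have : 1 / (2 * (n : ℝ)) = 1 / n / 2 := by rw [div_div, mul_comm]
  rw [this]; ring

theorem tsum_eq_of_eq_off {f f' : ℕ+ → ℝ} (hf : Summable f) (k : ℕ+)
    (h : ∀ j, j ≠ k → f' j = f j) : ∑' j, f' j = ∑' j, f j - f k + f' k := by
  have : f' = Function.update f k (f' k) := by
    ext j
    rcases eq_or_ne j k with rfl | hne
    · simp
    · simp [hne, h j hne]
  have h2 := (hf.hasSum.update k (f' k)).tsum_eq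
  rw [← this] at h2
  rw [h2]; ring

section Grad

variable {e : ℕ+ → X → ℝ} {D : ℕ} {fstar : X → ℝ} {n : ℕ} {z : Fin n → X × ℝ} {a b β : ℕ+ → ℝ}

theorem grad_a (hs : ∀ i, Summable fun j => (a j * b j ^ D * e j (z i).1) * β j) (k : ℕ+) :
    -grad (fun a' => loss e D fstar z a' b β) a k =
      b k ^ D * β k * resid e D fstar z a b β k := by
  have hp : ∀ u i, predictor e D (Function.update a k u) b β (z i).1 =
      (predictor e D a b β (z i).1 - a k * b k ^ D * e k (z i).1 * β k) +
        (u * (b k ^ D * β k)) * e k (z i).1 := fun u i => by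
    simp only [predictor]
    rw [tsum_eq_of_eq_off (hs i) k fun j hj => by simp [Function.update_of_ne hj]]
    simp only [Function.update_self]; ring
  simp only [grad, loss, hp]
  rw [deriv_sum_sq _ _ _ (hasDerivAt_mul_const (b k ^ D * β k)), neg_neg, resid]
  congr 3; ext i; ring

theorem grad_b (hs : ∀ i, Summable fun j => (a j * b j ^ D * e j (z i).1) * β j) (k : ℕ+) :
    -grad (fun b' => loss e D fstar z a b' β) b k =
      D * a k * b k ^ (D - 1) * β k * resid e D fstar z a b β k := by
  have hp : ∀ u i, predictor e D a (Function.update b k u) β (z i).1 =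
      (predictor e D a b β (z i).1 - a k * b k ^ D * e k (z i).1 * β k) +
        (u ^ D * (a k * β k)) * e k (z i).1 := fun u i => by
    simp only [predictor]
    rw [tsum_eq_of_eq_off (hs i) k fun j hj => by simp [Function.update_of_ne hj]]
    simp only [Function.update_self]; ring
  simp only [grad, loss, hp]
  rw [deriv_sum_sq _ _ _ ((hasDerivAt_pow D (b k)).mul_const (a k * β k)), neg_neg, resid]
  rw [show (D : ℝ) * a k * b k ^ (D - 1) * β k = D * b k ^ (D - 1) * (a k * β k) by ring]
  congr 3; ext i; ring

theorem grad_β (hs : ∀ i, Summable fun j => (a j * b j ^ D * e j (z i).1) * β j) (k : ℕ+) :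
    -grad (fun β' => loss e D fstar z a b β') β k =
      a k * b k ^ D * resid e D fstar z a b β k := by
  have hp : ∀ u i, predictor e D a b (Function.update β k u) (z i).1 =
      (predictor e D a b β (z i).1 - a k * b k ^ D * e k (z i).1 * β k) +
        (u * (a k * b k ^ D)) * e k (z i).1 := fun u i => by
    simp only [predictor]
    rw [tsum_eq_of_eq_off (hs i) k fun j hj => by simp [Function.update_of_ne hj]]
    simp only [Function.update_self]; ring
  simp only [grad, loss, hp]
  rw [deriv_sum_sq _ _ _ (hasDerivAt_mul_const (a k * b k ^ D)), neg_neg, resid]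
  congr 3; ext i; ring

end Grad

/-- Powers of `b` need not lie in `ℓ²`, but their products with an `ℓ²` sequence do: `(b₀ + B) W =
b₀ W + B W` allows induction on the exponent. -/
theorem exists_pow_mul_continuousOn {s : Set ℝ} {B V : ℝ → Ell2} (b₀ : ℝ) (hB : ContinuousOn B s)
    (hV : ContinuousOn V s) (D : ℕ) :
    ∃ W : ℝ → Ell2, ContinuousOn W s ∧ ∀ t j, W t j = (b₀ + B t j) ^ D * V t j := by
  induction D with
  | zero => exact ⟨V, hV, fun t j => by simp⟩
  | succ D ih =>
    obtain ⟨W, hW, hWe⟩ := ih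
    refine ⟨fun t => b₀ • W t + mulL (B t) (W t), (hW.const_smul b₀).add ?_, fun t j => ?_⟩
    · exact (mulL.continuous.comp_continuousOn hB).clm_apply hW
    · simp only [lp.coeFn_add, Pi.add_apply, lp.coeFn_smul, Pi.smul_apply, mulL_apply, hWe,
        smul_eq_mul]
      ring

theorem exists_pow_mul_lipOnBalls {B V : Ell2 → Ell2} (b₀ : ℝ) (hB : LipOnBalls B)
    (hV : LipOnBalls V) (D : ℕ) :
    ∃ W : Ell2 → Ell2, LipOnBalls W ∧ ∀ x j, W x j = (b₀ + B x j) ^ D * V x j := by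
  induction D with
  | zero => exact ⟨V, hV, fun t j => by simp⟩
  | succ D ih =>
    obtain ⟨W, hW, hWe⟩ := ih
    refine ⟨fun t => b₀ • W t + mulL (B t) (W t), ?_, fun t j => ?_⟩
    · exact (hW.clm (b₀ • ContinuousLinearMap.id ℝ Ell2)).add (hB.bilin mulL hW)
    · simp only [lp.coeFn_add, Pi.add_apply, lp.coeFn_smul, Pi.smul_apply, mulL_apply, hWe,
        smul_eq_mul]
      ring

/-- `√(p + x²)` is the Euclidean norm of `(√p, x)`, hence 1-Lipschitz in `x`. -/
theorem abs_sqrt_add_sq_sub_le {p : ℝ} (hp : 0 ≤ p) (x y : ℝ) :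
    |√(p + x ^ 2) - √(p + y ^ 2)| ≤ |x - y| := by
  have key : ∀ x y : ℝ, √(p + x ^ 2) ≤ √(p + y ^ 2) + |x - y| := fun x y => by
    refine Real.sqrt_le_iff.2 ⟨by positivity, ?_⟩
    have h1 : (√(p + y ^ 2)) ^ 2 = p + y ^ 2 := Real.sq_sqrt (by positivity)
    have h2 : |y| ≤ √(p + y ^ 2) := Real.abs_le_sqrt (by linarith)
    have h3 : y * (x - y) ≤ √(p + y ^ 2) * |x - y| := by
      calc y * (x - y) ≤ |y * (x - y)| := le_abs_self _
        _ = |y| * |x - y| := abs_mul _ _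
        _ ≤ _ := by gcongr
    nlinarith [sq_abs (x - y)]
  rw [abs_le]
  have h1 := key x y
  have h2 := key y x
  rw [abs_sub_comm] at h2
  constructor <;> linarith

/-- `β ↦ (√(l_j + β_j²))_j` on `ℓ²`. -/
theorem exists_sqrt_add_sq_ell2 {l : ℕ+ → ℝ} (hl0 : ∀ j, 0 ≤ l j) (hl : Summable l) :
    ∃ A : Ell2 → Ell2, LipschitzWith 1 A ∧ ∀ x j, A x j = √(l j + x j ^ 2) := by
  have hmem : ∀ x : Ell2, Memℓp (fun j => √(l j + x j ^ 2)) 2 := fun x => by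
    refine memℓp_gen ?_
    have h2 : Summable fun j => l j + x j ^ 2 := by
      refine hl.add ((summable_abs_mul x x).congr fun j => ?_)
      rw [abs_mul_self, sq]
    refine h2.congr fun j => ?_
    have : 0 ≤ l j + x j ^ 2 := add_nonneg (hl0 j) (sq_nonneg _)
    simp [Real.sq_sqrt this]
  refine ⟨fun x => ⟨_, hmem x⟩, LipschitzWith.mk_one fun x y => ?_, fun x j => rfl⟩
  rw [dist_eq_norm, dist_eq_norm, ← one_mul ‖x - y‖]
  refine norm_le_of_abs_le zero_le_one fun j => ?_
  rw [one_mul]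
  exact abs_sqrt_add_sq_sub_le (hl0 j) _ _

/-- `β ↦ (√(b₀² + D β_j²) - b₀)_j` on `ℓ²`. -/
theorem exists_sqrt_sub_ell2 {b₀ : ℝ} (hb₀ : 0 ≤ b₀) (D : ℕ) :
    ∃ B : Ell2 → Ell2, LipschitzWith ⟨√D, Real.sqrt_nonneg _⟩ B ∧
      ∀ x j, B x j = √(b₀ ^ 2 + D * x j ^ 2) - b₀ := by
  have hD : ∀ u : ℝ, (D : ℝ) * u ^ 2 = (√D * u) ^ 2 := fun u => by
    rw [mul_pow, Real.sq_sqrt (Nat.cast_nonneg D)]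
  have hmem : ∀ x : Ell2, Memℓp (fun j => √(b₀ ^ 2 + D * x j ^ 2) - b₀) 2 := fun x => by
    refine memℓp_of_abs_le (C := √D) x fun j => ?_
    have := abs_sqrt_add_sq_sub_le (sq_nonneg b₀) (√D * x j) 0
    rw [hD]
    simpa [Real.sqrt_sq hb₀, abs_mul, abs_of_nonneg (Real.sqrt_nonneg (D : ℝ))] using this
  refine ⟨fun x => ⟨_, hmem x⟩, LipschitzWith.of_dist_le_mul fun x y => ?_, fun x j => rfl⟩
  rw [dist_eq_norm, dist_eq_norm]
  refine norm_le_of_abs_le (Real.sqrt_nonneg _) fun j => ?_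
  have := abs_sqrt_add_sq_sub_le (sq_nonneg b₀) (√D * x j) (√D * y j)
  rw [← mul_sub, abs_mul, abs_of_nonneg (Real.sqrt_nonneg _), ← hD, ← hD,
    ← sub_sub_sub_cancel_right _ _ b₀] at this
  exact this

/-- Existence of the gradient flow on every bounded interval. -/
theorem exists_isGradientFlow {e : ℕ+ → X → ℝ} {lam : ℕ+ → ℝ} (D : ℕ) {b₀ M T : ℝ}
    {fstar : X → ℝ} {n : ℕ} {z : Fin n → X × ℝ} (hlam0 : ∀ j, 0 < lam j) (hlam : Summable lam)
    (hb₀ : 0 < b₀) (hT : 0 ≤ T) (he : ∀ i j, |e j (z i).1| ≤ M) :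
    ∃ a b β : ℝ → ℕ+ → ℝ, IsGradientFlow e lam D b₀ fstar z T a b β := by
  -- The conservation laws eliminate `a` and `b`: the maps `A` and `B` recover `a` and `b - b₀` from
  -- `β`, and `F` below is the resulting field for `β` alone.
  obtain ⟨A, hA, hAe⟩ := exists_sqrt_add_sq_ell2 (fun j => (hlam0 j).le) hlam
  obtain ⟨B, hB, hBe⟩ := exists_sqrt_sub_ell2 hb₀.le D
  obtain ⟨c, hc, hce⟩ := exists_pow_mul_lipOnBalls b₀ (LipOnBalls.of_lipschitz hB)
    (LipOnBalls.of_lipschitz hA) D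
  have hbB : ∀ x j, b₀ + B x j = √(b₀ ^ 2 + D * x j ^ 2) := fun x j => by rw [hBe]; ring
  set E : Fin n → Ell2 →L[ℝ] Ell2 := fun i => multL (fun j => e j (z i).1) M (he i) with hE
  set y : Fin n → ℝ := fun i => fstar (z i).1 + (z i).2 with hy
  set F : Ell2 → Ell2 := fun x => ∑ i, (1 / (n : ℝ) * y i +
    (-(1 / (n : ℝ))) • (innerSL ℝ (E i (c x)) x)) • E i (c x) with hF
  have hFL : LipOnBalls F := by
    refine LipOnBalls.sum fun i _ => ?_
    refine LipOnBalls.bilin (ContinuousLinearMap.lsmul ℝ ℝ) ?_ (hc.clm (E i))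
    refine (LipOnBalls.const _).add ?_
    exact LipOnBalls.clm ((-(1 / (n : ℝ))) • ContinuousLinearMap.id ℝ ℝ)
      ((hc.clm (E i)).bilin (innerSL ℝ) LipOnBalls.id)
  -- The radial part is the average of `(y_i - f_i) f_i`, with `f_i` the prediction, and each term
  -- is at most `y_i² / 4`.
  have hin : ∀ x, inner ℝ x (F x) ≤ ∑ i, 1 / (n : ℝ) * (y i ^ 2 / 4) := fun x => by
    simp only [hF, inner_sum, real_inner_smul_right]
    refine Finset.sum_le_sum fun i _ => ?_
    rw [real_inner_comm (E i (c x)) x, innerSL_apply_apply, smul_eq_mul]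
    set f := inner ℝ (E i (c x)) x
    have h1 : (1 / (n : ℝ) * y i + -(1 / (n : ℝ)) * f) * f = 1 / (n : ℝ) * ((y i - f) * f) := by
      ring
    have h2 : (y i - f) * f ≤ y i ^ 2 / 4 := by nlinarith [sq_nonneg (y i - 2 * f)]
    rw [h1]
    gcongr
  obtain ⟨α, hα0, hα⟩ := exists_flow_of_inner_le hFL
    (Finset.sum_nonneg fun i _ => by positivity) hT hin
  have hαc : ContinuousOn α (Icc 0 T) := fun t ht => (hα t ht).continuousWithinAt
  set a : ℝ → ℕ+ → ℝ := fun t k => √(lam k + α t k ^ 2) with ha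
  set b : ℝ → ℕ+ → ℝ := fun t k => √(b₀ ^ 2 + D * α t k ^ 2) with hb
  have hcab : ∀ t k, c (α t) k = a t k * b t k ^ D := fun t k => by
    rw [hce, hbB, hAe, mul_comm]
  have hsummable : ∀ t i, Summable fun j => (a t j * b t j ^ D * e j (z i).1) * α t j :=
      fun t i => by
    refine (summable_abs_mul (E i (c (α t))) (α t)).of_abs.congr fun j => ?_
    simp only [hE, multL_apply, hcab]; ring
  have hpred : ∀ t i, inner ℝ (E i (c (α t))) (α t) = predictor e D (a t) (b t) (α t) (z i).1 :=
    fun t i => by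
      rw [inner_ell2, predictor]
      exact tsum_congr fun j => by simp only [hE, multL_apply, hcab]; ring
  have hFk : ∀ t k, F (α t) k = a t k * b t k ^ D * resid e D fstar z (a t) (b t) (α t) k := by
    intro t k
    simp only [hF, lp.coeFn_sum, Finset.sum_apply, lp.coeFn_smul, Pi.smul_apply, smul_eq_mul, resid,
      innerSL_apply_apply, hpred, Finset.mul_sum]
    refine Finset.sum_congr rfl fun i _ => ?_
    simp only [hE, multL_apply, hcab, hy]; ring
  have hapos : ∀ t k, 0 < a t k := fun t k => Real.sqrt_pos.2 (by have := hlam0 k; positivity)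
  have hbpos : ∀ t k, 0 < b t k := fun t k => Real.sqrt_pos.2 (by positivity)
  have hβ : ∀ t ∈ Icc 0 T, ∀ k, HasDerivWithinAt (fun τ => α τ k)
      (a t k * b t k ^ D * resid e D fstar z (a t) (b t) (α t) k) (Icc 0 T) t := by
    intro t ht k
    rw [← hFk]
    exact (lp.evalCLM ℝ (fun _ : ℕ+ => ℝ) 2 k).hasFDerivAt.comp_hasDerivWithinAt t (hα t ht)
  refine ⟨a, b, fun t k => α t k, ?_, ?_, ?_, ?_, ?_, ?_, ?_, ?_, ?_⟩
  · intro k; simp [ha, hα0]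
  · intro k; simp [hb, hα0, Real.sqrt_sq hb₀.le]
  · intro k; simp [hα0]
  · exact ⟨fun t => A (α t), hA.continuous.comp_continuousOn hαc, fun t _ k => hAe _ _⟩
  · exact ⟨fun t => B (α t), hB.continuous.comp_continuousOn hαc, fun t _ k => hBe _ _⟩
  · exact ⟨α, hαc, fun t _ k => rfl⟩
  · intro t ht k
    rw [grad_a (hsummable t)]
    have hne : lam k + α t k ^ 2 ≠ 0 := by have := hlam0 k; positivity
    refine ((((hβ t ht k).pow 2).const_add (lam k)).sqrt hne).congr_deriv ?_
    have hap := hapos t k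
    change ((2 : ℕ) : ℝ) * α t k ^ (2 - 1) * (a t k * b t k ^ D * _) / (2 * a t k) = _
    rw [div_eq_iff (by positivity)]
    push_cast; ring
  · intro t ht k
    rw [grad_b (hsummable t)]
    have hne : b₀ ^ 2 + (D : ℝ) * α t k ^ 2 ≠ 0 := by positivity
    refine (((((hβ t ht k).pow 2).const_mul (D : ℝ)).const_add (b₀ ^ 2)).sqrt hne).congr_deriv ?_
    have hbp := hbpos t k
    change (D : ℝ) * (((2 : ℕ) : ℝ) * α t k ^ (2 - 1) * (a t k * b t k ^ D * _)) / (2 * b t k) = _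
    rw [div_eq_iff (by positivity)]
    rcases D with _ | D
    · simp
    · push_cast; ring
  · intro t ht k
    rw [grad_β (hsummable t)]
    exact hβ t ht k

/-- A sample on which the noise and the empirical Gram matrix of the eigenfunctions concentrate. -/
structure GoodSample (e : ℕ+ → X → ℝ) (fstar : X → ℝ) (θs : ℕ+ → ℝ) (M H₀ : ℝ) {n : ℕ}
    (z : Fin n → X × ℝ) : Prop where
  bounded : ∀ i j, |e j (z i).1| ≤ M
  expansion : ∀ i, fstar (z i).1 = ∑' j, θs j * e j (z i).1
  noise : ∀ k : ℕ+, |1 / (n : ℝ) * ∑ i, (z i).2 * e k (z i).1| ≤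
    H₀ * (√(Real.log n) + √(Real.log k)) * (n : ℝ) ^ (-(1 / 2 : ℝ))
  gram : ∀ j k : ℕ+, |1 / (n : ℝ) * ∑ i, e j (z i).1 * e k (z i).1 - if j = k then 1 else 0| ≤
    H₀ * (√(Real.log n) + √(Real.log j) + √(Real.log k)) * (n : ℝ) ^ (-(1 / 2 : ℝ))

/-- The residual at `x_i` is `ε_i + ∑_j d_j e_j(x_i)` with `d = θ* - θ`. Correlating with `e_k` and
splitting the empirical Gram matrix into identity plus deviation gives `d_k` plus an error; absolute
summability of `d` justifies the exchange of sums. -/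
theorem resid_eq {e : ℕ+ → X → ℝ} {D : ℕ} {fstar : X → ℝ} {θs : ℕ+ → ℝ} {M H₀ : ℝ} {n : ℕ}
    {z : Fin n → X × ℝ} (hz : GoodSample e fstar θs M H₀ z) {a b β : ℕ+ → ℝ}
    (hθs : Summable fun j => |θs j|) (hθ : Summable fun j => |a j * b j ^ D * β j|) (k : ℕ+) :
    resid e D fstar z a b β k = θs k - a k * b k ^ D * β k +
      (1 / (n : ℝ) * ∑ i, (z i).2 * e k (z i).1 +
        ∑' j, (θs j - a j * b j ^ D * β j) *
          (1 / (n : ℝ) * ∑ i, e j (z i).1 * e k (z i).1 - if j = k then 1 else 0)) := by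
  set d : ℕ+ → ℝ := fun j => θs j - a j * b j ^ D * β j with hd
  have hmulE : ∀ {u : ℕ+ → ℝ}, (Summable fun j => |u j|) → ∀ i,
      Summable fun j => u j * e j (z i).1 := fun hu i => by
    refine Summable.of_norm_bounded (hu.mul_right M) fun j => ?_
    rw [Real.norm_eq_abs, abs_mul]
    exact mul_le_mul_of_nonneg_left (hz.bounded i j) (abs_nonneg _)
  have hdsum : Summable fun j => |d j| :=
    Summable.of_nonneg_of_le (fun j => abs_nonneg _) (fun j => abs_sub _ _) (hθs.add hθ)
  have hdiff : ∀ i, fstar (z i).1 - predictor e D a b β (z i).1 = ∑' j, d j * e j (z i).1 := by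
    intro i
    have h1 : predictor e D a b β (z i).1 = ∑' j, (a j * b j ^ D * β j) * e j (z i).1 :=
      tsum_congr fun j => by ring
    rw [hz.expansion, h1, ← (hmulE hθs i).tsum_sub (hmulE hθ i)]
    exact tsum_congr fun j => by simp only [hd]; ring
  have hres : resid e D fstar z a b β k = 1 / (n : ℝ) * ∑ i, (z i).2 * e k (z i).1 +
      ∑' j, d j * (1 / (n : ℝ) * ∑ i, e j (z i).1 * e k (z i).1) := by
    have h2 : ∑' j, d j * (1 / (n : ℝ) * ∑ i, e j (z i).1 * e k (z i).1) =
        1 / (n : ℝ) * ∑ i, (∑' j, d j * e j (z i).1) * e k (z i).1 := by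
      have h3 : ∀ j, d j * (1 / (n : ℝ) * ∑ i, e j (z i).1 * e k (z i).1) =
          1 / (n : ℝ) * ∑ i, (d j * e j (z i).1) * e k (z i).1 := fun j => by
        rw [Finset.mul_sum, Finset.mul_sum, Finset.mul_sum]
        exact Finset.sum_congr rfl fun i _ => by ring
      simp only [h3]
      rw [tsum_mul_left, Summable.tsum_finsetSum fun i _ => (hmulE hdsum i).mul_right _]
      simp only [tsum_mul_right]
    rw [h2, resid, ← mul_add, ← Finset.sum_add_distrib]
    congr 1
    refine Finset.sum_congr rfl fun i _ => ?_
    rw [← hdiff]; ring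
  have hite : ∑' j, d j * (if j = k then (1 : ℝ) else 0) = d k := by
    rw [tsum_eq_single k fun j hj => by simp [hj]]
    simp
  have hites : Summable fun j => d j * (if j = k then (1 : ℝ) else 0) :=
    summable_of_ne_finset_zero (s := {k}) fun j hj => by
      rw [Finset.mem_singleton] at hj; simp [hj]
  have hM : ∀ j, |1 / (n : ℝ) * ∑ i, e j (z i).1 * e k (z i).1| ≤
      1 / (n : ℝ) * ∑ _i : Fin n, M * M := fun j => by
    rw [abs_mul, abs_of_nonneg (by positivity : 0 ≤ 1 / (n : ℝ))]
    gcongr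
    refine (Finset.abs_sum_le_sum_abs _ _).trans (Finset.sum_le_sum fun i _ => ?_)
    rw [abs_mul]
    exact mul_le_mul (hz.bounded i j) (hz.bounded i k) (abs_nonneg _)
      ((abs_nonneg _).trans (hz.bounded i j))
  have hgs : Summable fun j => d j * (1 / (n : ℝ) * ∑ i, e j (z i).1 * e k (z i).1) := by
    refine Summable.of_norm_bounded (hdsum.mul_right (1 / (n : ℝ) * ∑ _i : Fin n, M * M))
      fun j => ?_
    rw [Real.norm_eq_abs, abs_mul]
    exact mul_le_mul_of_nonneg_left (hM j) (abs_nonneg _)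
  have hsub : ∑' j, d j * (1 / (n : ℝ) * ∑ i, e j (z i).1 * e k (z i).1 - if j = k then 1 else 0) =
      ∑' j, d j * (1 / (n : ℝ) * ∑ i, e j (z i).1 * e k (z i).1) - d k := by
    rw [← hite, ← hgs.tsum_sub hites]
    exact tsum_congr fun j => by ring
  rw [hres, hsub]
  simp only [hd]; ring

/-- The coefficients of the predictor form a continuous curve in `ℓ¹`. -/
theorem IsGradientFlow.theta_l1 {e : ℕ+ → X → ℝ} {lam : ℕ+ → ℝ} {D : ℕ} {b₀ T : ℝ}
    {fstar : X → ℝ} {n : ℕ} {z : Fin n → X × ℝ} {a b β : ℝ → ℕ+ → ℝ}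
    (h : IsGradientFlow e lam D b₀ fstar z T a b β) :
    (∀ t ∈ Icc 0 T, Summable fun j => |a t j * b t j ^ D * β t j|) ∧
    (∀ t ∈ Icc 0 T, ∀ ε > 0, ∃ δ > 0, ∀ s ∈ Icc 0 T, |s - t| ≤ δ →
        ∑' j, |a s j * b s j ^ D * β s j - a t j * b t j ^ D * β t j| ≤ ε) := by
  obtain ⟨A, hA, hAe⟩ := h.curve_a
  obtain ⟨B, hB, hBe⟩ := h.curve_b
  obtain ⟨V, hV, hVe⟩ := h.curve_β
  obtain ⟨W, hW, hWe⟩ := exists_pow_mul_continuousOn b₀ hB hV D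
  -- The coefficient is a product of two continuous `ℓ²` curves, so its `ℓ¹` continuity is the
  -- Cauchy–Schwarz inequality.
  have hθ : ∀ t ∈ Icc 0 T, ∀ j, a t j * b t j ^ D * β t j = A t j * W t j := fun t ht j => by
    rw [hWe, hAe t ht, hBe t ht, hVe t ht]; ring
  refine ⟨fun t ht => ?_, fun t ht ε hε => ?_⟩
  · exact (summable_abs_mul (A t) (W t)).congr fun j => by rw [hθ t ht]
  · have hc : ContinuousWithinAt (fun s => ‖A s‖ * ‖W s - W t‖ + ‖A s - A t‖ * ‖W t‖)
        (Icc 0 T) t :=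
      (((hA t ht).norm).mul ((hW t ht).sub continuousWithinAt_const).norm).add
        ((((hA t ht).sub continuousWithinAt_const).norm).mul continuousWithinAt_const)
    have h0 : ‖A t‖ * ‖W t - W t‖ + ‖A t - A t‖ * ‖W t‖ < ε := by simpa using hε
    have hev := hc.eventually (gt_mem_nhds h0)
    obtain ⟨δ, hδ, hball⟩ := Metric.mem_nhdsWithin_iff.1 hev
    refine ⟨δ / 2, by positivity, fun s hs hst => ?_⟩
    have h1 := hball (a := s) ⟨by rw [Metric.mem_ball, Real.dist_eq]; linarith, hs⟩
    refine le_trans ?_ (le_of_lt h1)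
    have s1 := summable_abs_mul (A s) (W s - W t)
    have s2 := summable_abs_mul (A s - A t) (W t)
    have hterm : ∀ j, |a s j * b s j ^ D * β s j - a t j * b t j ^ D * β t j| ≤
        |A s j * (W s - W t) j| + |(A s - A t) j * W t j| := fun j => by
      rw [hθ s hs, hθ t ht]
      refine le_trans (le_of_eq ?_) (abs_add_le _ _)
      rw [lp.coeFn_sub, lp.coeFn_sub, Pi.sub_apply, Pi.sub_apply]
      congr 1; ring
    have hsum := Summable.of_nonneg_of_le (fun j => abs_nonneg _) hterm (s1.add s2)
    refine (hsum.tsum_le_tsum hterm (s1.add s2)).trans ?_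
    rw [s1.tsum_add s2]
    exact add_le_add (tsum_abs_mul_le _ _) (tsum_abs_mul_le _ _)

/-- The coordinates interact only through the scalar `resid`, so each can be studied on its own with
`resid` as a given driving force. -/
theorem IsGradientFlow.coordFlow {e : ℕ+ → X → ℝ} {lam : ℕ+ → ℝ} {D : ℕ} {b₀ T M : ℝ}
    {fstar : X → ℝ} {n : ℕ} {z : Fin n → X × ℝ} {a b β : ℝ → ℕ+ → ℝ}
    (h : IsGradientFlow e lam D b₀ fstar z T a b β) (he : ∀ i j, |e j (z i).1| ≤ M) (k : ℕ+) :
    CoordFlow D (lam k) b₀ T (fun t => a t k) (fun t => b t k) (fun t => β t k)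
      (fun t => resid e D fstar z (a t) (b t) (β t) k) := by
  have hs : ∀ t ∈ Icc 0 T, ∀ i, Summable fun j => (a t j * b t j ^ D * e j (z i).1) * β t j := by
    intro t ht i
    refine Summable.of_norm_bounded ((h.theta_l1.1 t ht).mul_right M) fun j => ?_
    rw [mul_right_comm, Real.norm_eq_abs, abs_mul]
    exact mul_le_mul_of_nonneg_left (he i j) (abs_nonneg _)
  exact ⟨h.init_a k, h.init_b k, h.init_β k,
    fun t ht => (h.deriv_a t ht k).congr_deriv (grad_a (hs t ht) k),
    fun t ht => (h.deriv_b t ht k).congr_deriv (grad_b (hs t ht) k),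
    fun t ht => (h.deriv_β t ht k).congr_deriv (grad_β (hs t ht) k)⟩

theorem SignalSpan.summable_abs {θ : ℕ+ → ℝ} {Binf κ Bspn s₀ Bsig : ℝ} (hκ : 1 ≤ κ)
    (hBspn : 0 < Bspn) (hs₀ : 0 < s₀) (hBsig : 0 < Bsig) (h : SignalSpan θ Binf κ Bspn s₀ Bsig) :
    Summable fun j => |θ j| := by
  obtain ⟨K, -, hK⟩ := exists_tsum_rpow_mul_exp_le (Binf := Binf) (s₀ := s₀) (q := 1) 0 one_pos
    (by linarith) hκ hBspn hBsig
  simpa using (hK θ h).1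

/-- On a good sample the gradient flow exists and has the asserted properties. -/
theorem flow_of_goodSample (D : ℕ) {s : ℝ} (hs : 0 < s)
    {M H₀ ceig Ceig γ : ℝ} (hM : 0 < M) (hH₀ : 0 < H₀) (hceig : 0 < ceig) (hCeig : 0 < Ceig)
    (hγ : 1 < γ) {Binf κ Bspn s₀ Bsig : ℝ} (hκ : 1 ≤ κ) (hBspn : 0 < Bspn) (hs₀ : 0 < s₀)
    (hBsig : 0 < Bsig) {ct Ct cb Cb : ℝ} (hct : 0 < ct) (hCt : 0 < Ct) (hcb : 0 < cb)
    (hCb : 0 < Cb) :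
    ∃ c₁ C₁ C₂ C₃ : ℝ, 0 < c₁ ∧ 0 < C₁ ∧ 0 < C₂ ∧ 0 < C₃ ∧ ∃ N : ℕ,
      ∀ (X : Type*) (e : ℕ+ → X → ℝ) (lam : ℕ+ → ℝ) (fstar : X → ℝ) (θs : ℕ+ → ℝ),
        (∀ j : ℕ+, ceig * (j : ℝ) ^ (-γ) ≤ lam j) → (∀ j : ℕ+, lam j ≤ Ceig * (j : ℝ) ^ (-γ)) →
        SignalSpan θs Binf κ Bspn s₀ Bsig →
        ∀ n : ℕ, N ≤ n → ∀ t b₀ : ℝ,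
          ct * (n : ℝ) ^ (((D : ℝ) + 1) / ((D : ℝ) + 2)) ≤ t →
          t ≤ Ct * (n : ℝ) ^ (((D : ℝ) + 1) / ((D : ℝ) + 2)) →
          cb * (n : ℝ) ^ (-(1 / (2 * ((D : ℝ) + 2)))) ≤ b₀ →
          b₀ ≤ Cb * (n : ℝ) ^ (-(1 / (2 * ((D : ℝ) + 2)))) →
          ∀ z : Fin n → X × ℝ, GoodSample e fstar θs M H₀ z →
            ((∃ a b β : ℝ → ℕ+ → ℝ, IsGradientFlow e lam D b₀ fstar z t a b β) ∧
              ∀ a b β : ℝ → ℕ+ → ℝ, IsGradientFlow e lam D b₀ fstar z t a b β →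
                ∀ k : ℕ+,
                  (C₁ * (n : ℝ) ^ (-(1 / 2 : ℝ)) * Real.log n ≤ |θs k| →
                    c₁ * |θs k| ^ (((D : ℝ) + 1) / ((D : ℝ) + 2)) ≤ a t k * b t k ^ D) ∧
                  (|θs k| ≤ (n : ℝ) ^ (-(1 / 2 : ℝ)) →
                    lam k ≤ (n : ℝ) ^ (-((1 + s) / ((D : ℝ) + 2))) →
                    a t k * b t k ^ D ≤ C₂ * (a 0 k * b 0 k ^ D) *
                      Real.exp (C₃ * (√(Real.log n) + √(Real.log k))))) := by
  obtain ⟨H, hH, N₁, hN₁⟩ := residual_bound D (Binf := Binf) hH₀ hCeig hγ hκ hBspn hs₀ hBsig hCt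
    hcb hCb
  obtain ⟨C₃, hC₃, N₂, hN₂⟩ := noise_component D hs hH hCeig hγ hCt hcb hCb
  obtain ⟨C₁, hC₁, N₃, hN₃⟩ := signal_component D (Binf := Binf) hH hceig hCeig hγ hκ hBspn hct hcb
  refine ⟨(1 / 2) ^ (((D : ℝ) + 1) / ((D : ℝ) + 2)), C₁, √(1 + D) ^ D, C₃, by positivity, hC₁,
    by positivity, hC₃, max (max N₁ N₂) (max N₃ 3), ?_⟩
  intro X e lam fstar θs hlam1 hlam2 hθs n hn t b₀ ht1 ht2 hb1 hb2 z hz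
  simp only [max_le_iff] at hn
  obtain ⟨⟨hn1, hn2⟩, hn3, hn4⟩ := hn
  have hn0 : (0 : ℝ) < n := by positivity
  have hb0 : 0 < b₀ := lt_of_lt_of_le (by positivity) hb1
  have ht0 : 0 ≤ t := le_trans (by positivity) ht1
  have htm : t ∈ Icc 0 t := ⟨ht0, le_rfl⟩
  have hlam0 : ∀ j, 0 < lam j := fun j => lt_of_lt_of_le (by positivity) (hlam1 j)
  have hlams : Summable lam := by
    have h1 : Summable fun j : ℕ+ => Ceig * (j : ℝ) ^ (-γ) := by
      simpa using (summable_rpow_mul_exp_sqrt_log hγ 0).mul_left Ceig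
    exact Summable.of_nonneg_of_le (fun j => (hlam0 j).le) hlam2 h1
  refine ⟨exists_isGradientFlow D hlam0 hlams hb0 ht0 hz.bounded, ?_⟩
  intro a b β hflow k
  have hcoord := fun k => hflow.coordFlow hz.bounded k
  obtain ⟨hl1, hl1c⟩ := hflow.theta_l1
  have hθsum := hθs.summable_abs hκ hBspn hs₀ hBsig
  -- `M * M + 1` is a crude uniform bound on the Gram deviations. It serves only the continuity part
  -- of the bootstrap and enters no constant of the theorem.
  have hres := hN₁ n hn1 t b₀ lam θs (fun k => 1 / (n : ℝ) * ∑ i, (z i).2 * e k (z i).1)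
    (fun j k => 1 / (n : ℝ) * ∑ i, e j (z i).1 * e k (z i).1 - if j = k then 1 else 0) a b β
    (fun t k => resid e D fstar z (a t) (b t) (β t) k) (M * M + 1) ht2 hb1 hb2 hlam0 hlam2 hθs
    hcoord hz.noise hz.gram (fun j k => ?_) (fun t ht k => resid_eq hz hθsum (hl1 t ht) k)
    (fun t ht => ?_) hl1c
  · refine ⟨fun hsig => ?_, fun hns hlk => ?_⟩
    · have hpos : 0 < |θs k| := by
        refine lt_of_lt_of_le ?_ hsig
        have : 0 < Real.log n := Real.log_pos (by exact_mod_cast (by omega : 1 < n))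
        positivity
      have := hN₃ n hn3 t b₀ (lam k) (θs k) k _ _ _ _ ht1 hb1 (hlam1 k) (hlam2 k) hsig
        (hθs.bounded k) (hθs.span _ hpos k (le_refl |θs k|)) (hcoord k) (fun t ht => hres t ht k)
      rwa [div_eq_mul_one_div, mul_comm, Real.mul_rpow (by norm_num) hpos.le] at this
    · obtain ⟨hb, ha⟩ := hN₂ n hn2 t b₀ (lam k) (θs k) k _ _ _ _ ht0 ht2 hb1 hb2 (hlam0 k) (hlam2 k)
        hlk hns (hcoord k) (fun t ht => hres t ht k) t htm
      have hbp := (hcoord k).b_pos hb0 t htm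
      rw [hflow.init_a, hflow.init_b]
      calc a t k * b t k ^ D ≤ (√(lam k) * Real.exp (C₃ * (√(Real.log n) + √(Real.log k)))) *
            (√(1 + D) * b₀) ^ D := by
            gcongr
        _ = _ := by rw [mul_pow]; ring
  · have h1 : |1 / (n : ℝ) * ∑ i, e j (z i).1 * e k (z i).1| ≤ M * M := by
      rw [abs_mul, abs_of_nonneg (by positivity : 0 ≤ 1 / (n : ℝ))]
      have h2 : |∑ i, e j (z i).1 * e k (z i).1| ≤ ∑ _i : Fin n, M * M := by
        refine (Finset.abs_sum_le_sum_abs _ _).trans (Finset.sum_le_sum fun i _ => ?_)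
        rw [abs_mul]
        exact mul_le_mul (hz.bounded i j) (hz.bounded i k) (abs_nonneg _) hM.le
      calc _ ≤ 1 / (n : ℝ) * ∑ _i : Fin n, M * M := by gcongr
        _ = M * M := by simp; field_simp
    refine (abs_sub _ _).trans (add_le_add h1 ?_)
    split_ifs <;> simp
  · exact Summable.of_nonneg_of_le (fun j => abs_nonneg _) (fun j => abs_sub _ _)
      (hθsum.add (hl1 t ht))

end Flow

/-! ### Sub-Gaussian concentration of empirical means -/

section Concentration

variable {Ω : Type*} [MeasurableSpace Ω]

theorem subgaussian_mono {ρ : Measure Ω} {f : Ω → ℝ} {c c' : ℝ≥0} (h : HasSubgaussianMGF f c ρ)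
    (hc : c ≤ c') : HasSubgaussianMGF f c' ρ :=
  ⟨h.integrable_exp_mul, fun t => (h.mgf_le t).trans (Real.exp_le_exp.2 (by
    have : (c : ℝ) ≤ c' := by exact_mod_cast hc
    gcongr))⟩

theorem subgaussian_eval {ρ : Measure Ω} [IsProbabilityMeasure ρ] {f : Ω → ℝ} {c : ℝ≥0}
    (h : HasSubgaussianMGF f c ρ) {n : ℕ} (i : Fin n) :
    HasSubgaussianMGF (fun z : Fin n → Ω => f (z i)) c (Measure.pi fun _ => ρ) := by
  have hm := measurePreserving_eval (fun _ : Fin n => ρ) i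
  exact HasSubgaussianMGF.of_map (X := f) (Y := Function.eval i) hm.measurable.aemeasurable
    (by rw [hm.map_eq]; exact h)

theorem measure_sum_ge_le {ρ : Measure Ω} [IsProbabilityMeasure ρ] {f : Ω → ℝ} {c : ℝ≥0}
    (h : HasSubgaussianMGF f c ρ) {n : ℕ} {r : ℝ} (hr : 0 ≤ r) :
    (Measure.pi fun _ : Fin n => ρ) {z | r ≤ ∑ i, f (z i)} ≤
      ENNReal.ofReal (Real.exp (-r ^ 2 / (2 * (n * c)))) := by
  have hind : iIndepFun (fun (i : Fin n) (z : Fin n → Ω) => f (z i)) (Measure.pi fun _ => ρ) :=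
    iIndepFun_pi (X := fun _ => f) fun _ => h.aemeasurable
  have := HasSubgaussianMGF.measure_sum_ge_le_of_iIndepFun hind (s := Finset.univ)
    (fun i _ => subgaussian_eval h i) hr
  simp only [Finset.sum_const, Finset.card_univ, Fintype.card_fin, nsmul_eq_mul] at this
  rw [← ofReal_measureReal]
  exact ENNReal.ofReal_le_ofReal (by exact_mod_cast this)

/-- Hoeffding's inequality for the empirical mean of i.i.d. sub-Gaussian variables. -/
theorem measure_abs_mean_gt_le {ρ : Measure Ω} [IsProbabilityMeasure ρ] {f : Ω → ℝ} {c : ℝ≥0}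
    (h : HasSubgaussianMGF f c ρ) {n : ℕ} (hn : 0 < n) {r : ℝ} (hr : 0 ≤ r) :
    (Measure.pi fun _ : Fin n => ρ) {z | r < |1 / (n : ℝ) * ∑ i, f (z i)|} ≤
      2 * ENNReal.ofReal (Real.exp (-(n * r ^ 2) / (2 * c))) := by
  have hn0 : (0 : ℝ) < n := by exact_mod_cast hn
  have hsub : {z : Fin n → Ω | r < |1 / (n : ℝ) * ∑ i, f (z i)|} ⊆
      {z | n * r ≤ ∑ i, f (z i)} ∪ {z | n * r ≤ ∑ i, (-f) (z i)} := by
    intro z hz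
    simp only [mem_ofPred_eq, lt_abs] at hz
    simp only [mem_union, mem_ofPred_eq, Pi.neg_apply, Finset.sum_neg_distrib]
    have e : (n : ℝ) * (1 / n * ∑ i, f (z i)) = ∑ i, f (z i) := by field_simp
    rcases hz with h1 | h1
    · left; rw [← e]; gcongr
    · right; rw [← e, ← mul_neg]; gcongr
  -- For `c = 0` both quotients are `0` by the convention on division.
  have he : -(n * r) ^ 2 / (2 * ((n : ℝ) * c)) = -(n * r ^ 2) / (2 * c) := by
    rcases eq_or_ne (c : ℝ) 0 with h0 | h0
    · simp [h0]
    · field_simp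
  have h1 := measure_sum_ge_le h (n := n) (r := n * r) (by positivity)
  have h2 := measure_sum_ge_le h.neg (n := n) (r := n * r) (by positivity)
  rw [he] at h1 h2
  refine (measure_mono hsub).trans ((measure_union_le _ _).trans ?_)
  rw [two_mul]
  exact add_le_add h1 h2

/-- The normalisation `H² = 4c` makes the exponent `-2 (x + y + w)² ≤ -2 (x² + y² + w²)`, where the
squares are the logarithms of `n`, `j`, `k`. The tails are then summable over all pairs and leave
the factor `n^(-2)`. -/
theorem exp_neg_mul_sq_le {n : ℕ} (hn : 3 ≤ n) (j k : ℕ+) {c H r : ℝ} (hc : 0 < c)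
    (hH : H ^ 2 = 4 * c)
    (hr : r = H * (√(Real.log n) + √(Real.log j) + √(Real.log k)) * (n : ℝ) ^ (-(1 / 2 : ℝ))) :
    Real.exp (-(n * r ^ 2) / (2 * c)) ≤
      1 / (n : ℝ) ^ 2 * ((j : ℝ) ^ (-2 : ℝ) * (k : ℝ) ^ (-2 : ℝ)) := by
  have hn0 : (0 : ℝ) < n := by positivity
  have hn1 : (1 : ℝ) ≤ n := by exact_mod_cast (by omega : 1 ≤ n)
  have hj := one_le_pnat_cast j
  have hk := one_le_pnat_cast k
  have hj0 : (0 : ℝ) < j := by linarith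
  have hk0 : (0 : ℝ) < k := by linarith
  have e1 := Real.sq_sqrt (Real.log_nonneg hn1)
  have e2 := Real.sq_sqrt (Real.log_nonneg hj)
  have e3 := Real.sq_sqrt (Real.log_nonneg hk)
  set x := √(Real.log n)
  set y := √(Real.log j)
  set w := √(Real.log k)
  have hx : 0 ≤ x := Real.sqrt_nonneg _
  have hy : 0 ≤ y := Real.sqrt_nonneg _
  have hw : 0 ≤ w := Real.sqrt_nonneg _
  have hν : ((n : ℝ) ^ (-(1 / 2 : ℝ))) ^ 2 = 1 / n := by
    rw [← Real.rpow_natCast, ← Real.rpow_mul hn0.le]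
    norm_num
    rw [Real.rpow_neg_one]
  have hexp : -(n * r ^ 2) / (2 * c) = -(2 * (x + y + w) ^ 2) := by
    rw [hr, mul_pow, mul_pow, hH, hν]
    field_simp
    ring
  have hrhs : 1 / (n : ℝ) ^ 2 * ((j : ℝ) ^ (-2 : ℝ) * (k : ℝ) ^ (-2 : ℝ)) =
      Real.exp (-(2 * (x ^ 2 + y ^ 2 + w ^ 2))) := by
    have : 1 / (n : ℝ) ^ 2 = (n : ℝ) ^ (-2 : ℝ) := by
      rw [Real.rpow_neg hn0.le, Real.rpow_two, one_div]
    rw [this, Real.rpow_def_of_pos hn0, Real.rpow_def_of_pos hj0, Real.rpow_def_of_pos hk0,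
      ← Real.exp_add, ← Real.exp_add, e1, e2, e3]
    congr 1; ring
  rw [hexp, hrhs]
  refine Real.exp_le_exp.2 ?_
  nlinarith [mul_nonneg hx hy, mul_nonneg hx hw, mul_nonneg hy hw]

/-- Noise multiplied by a bounded function of the covariate is sub-Gaussian. -/
theorem subgaussian_mul_compProd {μ : Measure Ω} [IsProbabilityMeasure μ] {ν : Kernel Ω ℝ}
    [IsMarkovKernel ν] {σ : ℝ≥0} (hν : ∀ᵐ x ∂μ, HasSubgaussianMGF id (σ ^ 2) (ν x)) {f : Ω → ℝ}
    (hf : Measurable f) {M : ℝ≥0} (hfM : ∀ x, |f x| ≤ M) :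
    HasSubgaussianMGF (fun p : Ω × ℝ => p.2 * f p.1) (σ ^ 2 * M ^ 2) (μ ⊗ₘ ν) := by
  have hmeas : ∀ t : ℝ, Measurable fun p : Ω × ℝ => Real.exp (t * (p.2 * f p.1)) := fun t => by
    fun_prop
  have hinner : ∀ t : ℝ, ∀ᵐ x ∂μ, Integrable (fun y => Real.exp (t * (y * f x))) (ν x) ∧
      ∫ y, Real.exp (t * (y * f x)) ∂(ν x) ≤
        Real.exp (((σ ^ 2 * M ^ 2 : ℝ≥0) : ℝ) * t ^ 2 / 2) := by
    intro t
    filter_upwards [hν] with x hx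
    have e : (fun y : ℝ => Real.exp (t * (y * f x))) = fun y => Real.exp (t * f x * id y) := by
      ext y; congr 1; simp only [id]; ring
    rw [e]
    refine ⟨hx.integrable_exp_mul _, (hx.mgf_le (t * f x)).trans (Real.exp_le_exp.2 ?_)⟩
    have h1 : f x ^ 2 ≤ (M : ℝ) ^ 2 := by rw [← sq_abs]; have := hfM x; gcongr
    push_cast
    calc (σ : ℝ) ^ 2 * (t * f x) ^ 2 / 2 = (σ : ℝ) ^ 2 * f x ^ 2 * t ^ 2 / 2 := by ring
      _ ≤ _ := by gcongr
  have hint : ∀ t : ℝ, Integrable (fun p : Ω × ℝ => Real.exp (t * (p.2 * f p.1))) (μ ⊗ₘ ν) := by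
    intro t
    rw [Measure.integrable_compProd_iff (hmeas t).aestronglyMeasurable]
    refine ⟨(hinner t).mono fun x hx => hx.1, ?_⟩
    refine Integrable.of_bound (C := Real.exp (((σ ^ 2 * M ^ 2 : ℝ≥0) : ℝ) * t ^ 2 / 2)) ?_ ?_
    · exact ((hmeas t).stronglyMeasurable.norm.integral_kernel_prod_right').aestronglyMeasurable
    · filter_upwards [hinner t] with x hx
      simp only [Real.norm_eq_abs, Real.abs_exp]
      rw [abs_of_nonneg (integral_nonneg fun y => (Real.exp_pos _).le)]
      exact hx.2
  refine ⟨hint, fun t => ?_⟩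
  rw [mgf, Measure.integral_compProd (hint t)]
  calc ∫ x, ∫ y, Real.exp (t * (y * f x)) ∂(ν x) ∂μ
      ≤ ∫ _x, Real.exp (((σ ^ 2 * M ^ 2 : ℝ≥0) : ℝ) * t ^ 2 / 2) ∂μ := by
        refine integral_mono_ae (hint t).integral_compProd (integrable_const _) ?_
        filter_upwards [hinner t] with x hx using hx.2
    _ = _ := by simp

/-- A centred bounded function of the covariate is sub-Gaussian. -/
theorem subgaussian_sub_compProd {μ : Measure Ω} [IsProbabilityMeasure μ] {ν : Kernel Ω ℝ}
    [IsMarkovKernel ν] {f : Ω → ℝ} (hf : Measurable f) {M : ℝ≥0} (hfM : ∀ x, |f x| ≤ M) {m : ℝ}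
    (hm : ∫ x, f x ∂μ = m) :
    HasSubgaussianMGF (fun p : Ω × ℝ => f p.1 - m) (M ^ 2) (μ ⊗ₘ ν) := by
  have h1 : HasSubgaussianMGF (fun x => f x - m) (M ^ 2) μ := by
    have := hasSubgaussianMGF_of_mem_Icc (μ := μ) (a := -M) (b := M) hf.aemeasurable
      (ae_of_all _ fun x => abs_le.1 (hfM x))
    rw [hm] at this
    refine subgaussian_mono this (le_of_eq ?_)
    congr 1
    ext
    push_cast
    rw [sub_neg_eq_add, Real.norm_of_nonneg (by positivity)]
    ring
  refine HasSubgaussianMGF.of_map (X := fun x => f x - m) (Y := Prod.fst)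
    measurable_fst.aemeasurable ?_
  change HasSubgaussianMGF _ _ ((μ ⊗ₘ ν).fst)
  rw [Measure.fst_compProd]
  exact h1

end Concentration

/-! ### Bounded measurable versions and the pointwise expansion of the target -/

section Expansion

variable {X : Type*} [MeasurableSpace X] {μ : Measure X} {e : ℕ+ → X → ℝ}

/-- The `e j` are only almost everywhere measurable and bounded. Clipping a measurable version at
`±M` yields bounds that hold everywhere, as the concentration lemmas require. -/
theorem exists_measurable_version (he : IsL2Basis μ e) {M : ℝ} (hM : 0 < M)
    (hb : ∀ j, ∀ᵐ x ∂μ, |e j x| ≤ M) :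
    ∃ e' : ℕ+ → X → ℝ, (∀ j, Measurable (e' j)) ∧ (∀ j x, |e' j x| ≤ M) ∧ ∀ j, e j =ᵐ[μ] e' j := by
  obtain ⟨B, hB⟩ := he
  have hm : ∀ j, AEMeasurable (e j) μ := fun j =>
    ((Lp.aestronglyMeasurable (B j)).congr (hB j)).aemeasurable
  refine ⟨fun j x => max (-M) (min M ((hm j).mk _ x)), fun j => ?_, fun j x => ?_, fun j => ?_⟩
  · exact measurable_const.max (measurable_const.min (hm j).measurable_mk)
  · rw [abs_le]
    exact ⟨le_max_left _ _, max_le (by linarith) (min_le_left _ _)⟩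
  · filter_upwards [(hm j).ae_eq_mk, hb j] with x h1 h2
    rw [← h1, min_eq_right (abs_le.1 h2).2, max_eq_right (abs_le.1 h2).1]

theorem integral_mul_eq_ite (he : IsL2Basis μ e) (j k : ℕ+) :
    ∫ x, e j x * e k x ∂μ = if j = k then 1 else 0 := by
  obtain ⟨B, hB⟩ := he
  have h1 := orthonormal_iff_ite.1 B.orthonormal j k
  rw [← h1, L2.inner_def]
  refine integral_congr_ae ?_
  filter_upwards [hB j, hB k] with x hj hk
  rw [hj, hk]
  simp [mul_comm]

/-- A square integrable function with absolutely summable coefficients is the pointwise sum of its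
expansion. -/
theorem ae_eq_tsum_coeff [IsProbabilityMeasure μ] (he : IsL2Basis μ e) {M : ℝ}
    (hb : ∀ j, ∀ᵐ x ∂μ, |e j x| ≤ M)
    {f : X → ℝ} (hf : MemLp f 2 μ) (hs : Summable fun j => |coeff μ e f j|) :
    ∀ᵐ x ∂μ, f x = ∑' j, coeff μ e f j * e j x := by
  have he' := he
  obtain ⟨B, hB⟩ := he
  have hball : ∀ᵐ x ∂μ, ∀ j, |e j x| ≤ M := ae_all_iff.2 hb
  have hem : ∀ j, AEStronglyMeasurable (e j) μ := fun j =>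
    (Lp.aestronglyMeasurable (B j)).congr (hB j)
  set θ := coeff μ e f with hθ
  set S : X → ℝ := fun x => ∑' j, θ j * e j x with hS
  have hSm : AEStronglyMeasurable S μ := by
    have h1 : ∀ j, AEMeasurable (fun x => θ j * e j x) μ :=
      fun j => ((hem j).const_mul _).aemeasurable
    refine aestronglyMeasurable_of_tendsto_ae (u := (atTop : Filter (Finset ℕ+)))
      (f := fun s x => ∑ j ∈ s, θ j * e j x) (fun s => ?_) ?_
    · exact (Finset.aemeasurable_fun_sum s fun j _ => h1 j).aestronglyMeasurable
    · filter_upwards [hball] with x hx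
      have : Summable fun j => θ j * e j x := by
        refine Summable.of_norm_bounded (hs.mul_right M) fun j => ?_
        rw [Real.norm_eq_abs, abs_mul]
        exact mul_le_mul_of_nonneg_left (hx j) (abs_nonneg _)
      exact this.hasSum
  have hSb : ∀ᵐ x ∂μ, ‖S x‖ ≤ (∑' j, |θ j|) * M := by
    filter_upwards [hball] with x hx
    refine tsum_of_norm_bounded (hs.hasSum.mul_right M) fun j => ?_
    rw [Real.norm_eq_abs, abs_mul]
    exact mul_le_mul_of_nonneg_left (hx j) (abs_nonneg _)
  have hSL : MemLp S 2 μ := MemLp.of_bound hSm _ hSb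
  have hcoef : ∀ (g : X → ℝ) (hg : MemLp g 2 μ) j, B.repr (hg.toLp g) j = ∫ x, g x * e j x ∂μ := by
    intro g hg j
    rw [B.repr_apply_apply, L2.inner_def]
    refine integral_congr_ae ?_
    filter_upwards [hB j, hg.coeFn_toLp] with x h1 h2
    rw [h1, h2]
    simp
  have hSint : ∀ k, ∫ x, S x * e k x ∂μ = θ k := by
    intro k
    have hFb : ∀ j, ∀ᵐ x ∂μ, ‖θ j * e j x * e k x‖ ≤ |θ j| * (M * M) := fun j => by
      filter_upwards [hball] with x hx
      rw [Real.norm_eq_abs, abs_mul, abs_mul, mul_assoc]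
      refine mul_le_mul_of_nonneg_left ?_ (abs_nonneg _)
      exact mul_le_mul (hx j) (hx k) (abs_nonneg _) ((abs_nonneg _).trans (hx j))
    have hFi : ∀ j, Integrable (fun x => θ j * e j x * e k x) μ := fun j =>
      Integrable.of_bound (((hem j).const_mul _).mul (hem k)) _ (hFb j)
    have hsum : Summable fun j => ∫ x, ‖θ j * e j x * e k x‖ ∂μ := by
      refine Summable.of_nonneg_of_le (fun j => integral_nonneg fun x => norm_nonneg _)
        (fun j => ?_)
        (hs.mul_right (M * M))
      calc ∫ x, ‖θ j * e j x * e k x‖ ∂μ ≤ ∫ _x, |θ j| * (M * M) ∂μ :=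
            integral_mono_ae (hFi j).norm (integrable_const _) (hFb j)
        _ = |θ j| * (M * M) := by simp
    have h1 := (hasSum_integral_of_summable_integral_norm hFi hsum).tsum_eq
    have h2 : ∫ x, S x * e k x ∂μ = ∫ x, ∑' j, θ j * e j x * e k x ∂μ := by
      refine integral_congr_ae (ae_of_all _ fun x => ?_)
      simp only [hS, tsum_mul_right]
    rw [h2, ← h1]
    have h3 : ∀ j, ∫ x, θ j * e j x * e k x ∂μ = θ j * if j = k then 1 else 0 := fun j => by
      rw [← integral_mul_eq_ite he' j k, ← integral_const_mul]
      exact integral_congr_ae (ae_of_all _ fun x => mul_assoc _ _ _)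
    simp only [h3]
    rw [tsum_eq_single k fun j hj => by simp [hj]]
    simp
  -- The pointwise sum `S` has the same coefficients as `f`, and coefficients with respect to a
  -- Hilbert basis determine the class in `L²`.
  have heq : hf.toLp f = hSL.toLp S := by
    refine B.repr.injective ?_
    ext j
    rw [hcoef, hcoef, hSint]
    rfl
  exact (MemLp.toLp_eq_toLp_iff hf hSL).1 heq

end Expansion

/-! ### Probability of a good sample and conclusion -/

/-- With high probability the sample is good. -/
theorem measure_not_goodSample_le (σ : ℝ≥0) {M : ℝ} (hM : 0 < M) {Binf κ Bspn s₀ Bsig : ℝ}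
    (hκ : 1 ≤ κ) (hBspn : 0 < Bspn) (hs₀ : 0 < s₀) (hBsig : 0 < Bsig) :
    ∃ H₀ C : ℝ, 0 < H₀ ∧ 0 < C ∧ ∀ (X : Type*) [MeasurableSpace X] (μ : Measure X)
      [IsProbabilityMeasure μ] (e : ℕ+ → X → ℝ) (fstar : X → ℝ) (ν : Kernel X ℝ)
      [IsMarkovKernel ν], IsL2Basis μ e → (∀ j, ∀ᵐ x ∂μ, |e j x| ≤ M) → MemLp fstar 2 μ →
      SignalSpan (coeff μ e fstar) Binf κ Bspn s₀ Bsig →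
      (∀ᵐ x ∂μ, HasSubgaussianMGF id (σ ^ 2) (ν x)) → ∀ n : ℕ, 3 ≤ n →
        sampleLaw μ ν n {z | ¬ GoodSample e fstar (coeff μ e fstar) M H₀ z} ≤
          ENNReal.ofReal (C / (n : ℝ) ^ 2) := by
  set m : ℝ≥0 := ⟨M, hM.le⟩ with hm
  -- A common parameter for all variables: `σ² M²` for noise times `e_k`, `M⁴` for the centred
  -- products `e_j e_k`, and `1` for positivity.
  set c : ℝ≥0 := σ ^ 2 * m ^ 2 + (m ^ 2) ^ 2 + 1 with hc
  have hc0 : (0 : ℝ) < c := by rw [hc]; positivity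
  set S : ℝ := ∑' j : ℕ+, (j : ℝ) ^ (-2 : ℝ) with hS
  have hSs : Summable fun j : ℕ+ => (j : ℝ) ^ (-2 : ℝ) := by
    simpa using summable_rpow_mul_exp_sqrt_log (r := 2) (by norm_num) 0
  have hS0 : 0 < S := hSs.tsum_pos (fun j => by positivity) 1 (by simp)
  set H : ℝ := √(4 * c) with hH
  have hH0 : 0 < H := by positivity
  have hHsq : H ^ 2 = 4 * c := Real.sq_sqrt (by positivity)
  refine ⟨H, 4 * (S * S), hH0, by positivity, ?_⟩
  intro X _ μ _ e fstar ν _ he hb hf hθ hν n hn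
  have hn0 : (0 : ℝ) < n := by positivity
  obtain ⟨e', hem, heb, hee⟩ := exists_measurable_version he hM hb
  have hint : ∀ j k, ∫ x, e' j x * e' k x ∂μ = if j = k then 1 else 0 := fun j k => by
    rw [← integral_mul_eq_ite he j k]
    refine integral_congr_ae ?_
    filter_upwards [hee j, hee k] with x h1 h2
    rw [h1, h2]
  have hae : ∀ᵐ x ∂μ, (∀ j, e j x = e' j x) ∧ fstar x = ∑' j, coeff μ e fstar j * e j x :=
    (ae_all_iff.2 hee).and (ae_eq_tsum_coeff he hb hf (hθ.summable_abs hκ hBspn hs₀ hBsig))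
  have hae' : ∀ᵐ z ∂(sampleLaw μ ν n), ∀ i, (∀ j, e j (z i).1 = e' j (z i).1) ∧
      fstar (z i).1 = ∑' j, coeff μ e fstar j * e j (z i).1 := by
    refine ae_all_iff.2 fun i => ?_
    have h1 : ∀ᵐ p ∂(μ ⊗ₘ ν), (∀ j, e j p.1 = e' j p.1) ∧
        fstar p.1 = ∑' j, coeff μ e fstar j * e j p.1 := by
      refine ae_of_ae_map (f := Prod.fst) (p := fun x => (∀ j, e j x = e' j x) ∧
        fstar x = ∑' j, coeff μ e fstar j * e j x) measurable_fst.aemeasurable ?_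
      change ∀ᵐ x ∂((μ ⊗ₘ ν).fst), _
      rw [Measure.fst_compProd]
      exact hae
    exact (Measure.quasiMeasurePreserving_eval (fun _ : Fin n => μ ⊗ₘ ν) i).ae h1
  set r : ℕ+ → ℕ+ → ℝ := fun j k =>
    H * (√(Real.log n) + √(Real.log j) + √(Real.log k)) * (n : ℝ) ^ (-(1 / 2 : ℝ)) with hr
  have hr0 : ∀ j k, 0 ≤ r j k := fun j k => by positivity
  set A : ℕ+ → Set (Fin n → X × ℝ) := fun k =>
    {z | r 1 k < |1 / (n : ℝ) * ∑ i, (z i).2 * e' k (z i).1|} with hA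
  set G : ℕ+ × ℕ+ → Set (Fin n → X × ℝ) := fun q =>
    {z | r q.1 q.2 < |1 / (n : ℝ) * ∑ i, (e' q.1 (z i).1 * e' q.2 (z i).1 -
      if q.1 = q.2 then 1 else 0)|} with hG
  set p : ℕ+ × ℕ+ → ℝ≥0∞ := fun q => ENNReal.ofReal (2 * (1 / (n : ℝ) ^ 2) *
    ((q.1 : ℝ) ^ (-2 : ℝ) * (q.2 : ℝ) ^ (-2 : ℝ))) with hp
  have hbound : ∀ (g : X × ℝ → ℝ), HasSubgaussianMGF g c (μ ⊗ₘ ν) → ∀ j k,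
      sampleLaw μ ν n {z | r j k < |1 / (n : ℝ) * ∑ i, g (z i)|} ≤ p (j, k) := by
    intro g hg j k
    refine (measure_abs_mean_gt_le hg (by omega) (hr0 j k)).trans ?_
    change _ ≤ ENNReal.ofReal (2 * (1 / (n : ℝ) ^ 2) *
      ((j : ℝ) ^ (-2 : ℝ) * (k : ℝ) ^ (-2 : ℝ)))
    rw [mul_assoc, ENNReal.ofReal_mul zero_le_two, ENNReal.ofReal_ofNat]
    gcongr
    exact exp_neg_mul_sq_le hn j k hc0 hHsq rfl
  -- The noise bound is indexed by the pairs `(1, k)`, because `log 1 = 0` removes the `j` term.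
  have hAle : ∀ k, sampleLaw μ ν n (A k) ≤ p (1, k) := fun k =>
    hbound _ (subgaussian_mono (subgaussian_mul_compProd hν (hem k) (M := m) (heb k))
      (by rw [hc, add_assoc]; exact le_self_add)) 1 k
  have hGle : ∀ q, sampleLaw μ ν n (G q) ≤ p q := fun q =>
    hbound _ (subgaussian_mono (subgaussian_sub_compProd (f := fun x => e' q.1 x * e' q.2 x)
      ((hem q.1).mul (hem q.2)) (M := m ^ 2) (fun x => by
        rw [abs_mul, sq]
        exact mul_le_mul (heb q.1 x) (heb q.2 x) (abs_nonneg _) hM.le) (hint q.1 q.2))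
      (by rw [hc, add_right_comm]; exact le_add_self)) q.1 q.2
  have hsub : {z | ¬ GoodSample e fstar (coeff μ e fstar) M H z} ⊆
      {z | ¬ ∀ i, (∀ j, e j (z i).1 = e' j (z i).1) ∧
        fstar (z i).1 = ∑' j, coeff μ e fstar j * e j (z i).1} ∪ ((⋃ k, A k) ∪ ⋃ q, G q) := by
    intro z hz
    by_contra hcon
    simp only [mem_union, mem_ofPred_eq, mem_iUnion, not_or, not_not, not_exists, hA, hG,
      not_lt] at hcon
    obtain ⟨h1, h2, h3⟩ := hcon
    refine hz ⟨fun i j => ?_, fun i => (h1 i).2, fun k => ?_, fun j k => ?_⟩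
    · rw [(h1 i).1]; exact heb j _
    · have := h2 k
      simp only [hr, PNat.one_coe, Nat.cast_one, Real.log_one, Real.sqrt_zero, add_zero] at this
      have h4 : ∑ i, (z i).2 * e k (z i).1 = ∑ i, (z i).2 * e' k (z i).1 :=
        Finset.sum_congr rfl fun i _ => by rw [(h1 i).1]
      rw [h4]
      exact this
    · have := h3 (j, k)
      simp only [Finset.sum_sub_distrib, Finset.sum_const, Finset.card_univ, Fintype.card_fin,
        nsmul_eq_mul] at this
      rw [mul_sub, ← mul_assoc, one_div_mul_cancel hn0.ne', one_mul] at this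
      have h4 : ∑ i, e j (z i).1 * e k (z i).1 = ∑ i, e' j (z i).1 * e' k (z i).1 :=
        Finset.sum_congr rfl fun i _ => by rw [(h1 i).1, (h1 i).1]
      rw [h4]
      exact this
  have hps : ∑' q, p q = ENNReal.ofReal (2 * (1 / (n : ℝ) ^ 2) * (S * S)) := by
    have hprod := hSs.mul_of_nonneg hSs (fun j => by positivity) (fun j => by positivity)
    rw [hp, ← ENNReal.ofReal_tsum_of_nonneg (fun q => by positivity) (hprod.mul_left _),
      tsum_mul_left, hS, hSs.tsum_mul_tsum hSs hprod]
  have hA' : sampleLaw μ ν n (⋃ k, A k) ≤ ∑' q, p q :=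
    (measure_iUnion_le _).trans ((ENNReal.tsum_le_tsum hAle).trans
      (ENNReal.tsum_comp_le_tsum_of_injective (Prod.mk_right_injective (1 : ℕ+)) p))
  have hG' : sampleLaw μ ν n (⋃ q, G q) ≤ ∑' q, p q :=
    (measure_iUnion_le _).trans (ENNReal.tsum_le_tsum hGle)
  calc sampleLaw μ ν n {z | ¬ GoodSample e fstar (coeff μ e fstar) M H z}
      ≤ 0 + (∑' q, p q + ∑' q, p q) := by
        refine (measure_mono hsub).trans ((measure_union_le _ _).trans ?_)
        refine add_le_add (le_of_eq (ae_iff.1 hae')) ((measure_union_le _ _).trans ?_)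
        exact add_le_add hA' hG'
    _ = ENNReal.ofReal (4 * (S * S) / (n : ℝ) ^ 2) := by
        rw [zero_add, hps, ← ENNReal.ofReal_add (by positivity) (by positivity)]
        congr 1; ring

end

end DiagKernel

theorem mainTheorem3
    (D : ℕ) (s : ℝ) (hs : 0 < s) (σ : ℝ≥0)
    (Ceigf ceig Ceig γ : ℝ) (hCeigf : 0 < Ceigf) (hceig : 0 < ceig) (hCeig : 0 < Ceig)
    (hγ : 1 < γ)
    (Binf κ Bspn s₀ Bsig : ℝ) (hκ : 1 ≤ κ) (hBspn : 0 < Bspn) (hs₀ : 0 < s₀) (hBsig : 0 < Bsig)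
    -- the constants in `t ≍ n^{(D+1)/(D+2)}` and in `b₀ ≍ n^{-1/(2(D+2))}`
    (ct Ct cb Cb : ℝ) (hct : 0 < ct) (hCt : 0 < Ct) (hcb : 0 < cb) (hCb : 0 < Cb) :
    ∃ c₁ C₁ C₂ C₃ C : ℝ, 0 < c₁ ∧ 0 < C₁ ∧ 0 < C₂ ∧ 0 < C₃ ∧ 0 < C ∧ ∃ N : ℕ,
      ∀ (X : Type*) [MeasurableSpace X] (μ : Measure X) [IsProbabilityMeasure μ]
        (e : ℕ+ → X → ℝ) (lam : ℕ+ → ℝ) (fstar : X → ℝ) (ν : Kernel X ℝ) [IsMarkovKernel ν],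
        DiagKernel.IsL2Basis μ e →
        DiagKernel.EigenSystem μ e lam Ceigf ceig Ceig γ →
        MemLp fstar 2 μ →
        DiagKernel.SignalSpan (DiagKernel.coeff μ e fstar) Binf κ Bspn s₀ Bsig →
        -- given `x`, the noise is centred and `σ²`-sub-Gaussian
        (∀ᵐ x ∂μ, HasSubgaussianMGF id (σ ^ 2) (ν x)) →
        ∀ n : ℕ, N ≤ n → ∀ t b₀ : ℝ,
          ct * (n : ℝ) ^ (((D : ℝ) + 1) / ((D : ℝ) + 2)) ≤ t →
          t ≤ Ct * (n : ℝ) ^ (((D : ℝ) + 1) / ((D : ℝ) + 2)) →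
          cb * (n : ℝ) ^ (-(1 / (2 * ((D : ℝ) + 2)))) ≤ b₀ →
          b₀ ≤ Cb * (n : ℝ) ^ (-(1 / (2 * ((D : ℝ) + 2)))) →
          DiagKernel.sampleLaw μ ν n {z | ¬
            ((∃ a b β : ℝ → ℕ+ → ℝ, DiagKernel.IsGradientFlow e lam D b₀ fstar z t a b β) ∧
              ∀ a b β : ℝ → ℕ+ → ℝ, DiagKernel.IsGradientFlow e lam D b₀ fstar z t a b β →
                ∀ k : ℕ+,
                  (C₁ * (n : ℝ) ^ (-(1 / 2 : ℝ)) * Real.log n ≤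
                      |DiagKernel.coeff μ e fstar k| →
                    c₁ * |DiagKernel.coeff μ e fstar k| ^ (((D : ℝ) + 1) / ((D : ℝ) + 2)) ≤
                      a t k * b t k ^ D) ∧
                  (|DiagKernel.coeff μ e fstar k| ≤ (n : ℝ) ^ (-(1 / 2 : ℝ)) →
                    lam k ≤ (n : ℝ) ^ (-((1 + s) / ((D : ℝ) + 2))) →
                    a t k * b t k ^ D ≤
                      C₂ * (a 0 k * b 0 k ^ D) *
                        Real.exp (C₃ * (√(Real.log n) + √(Real.log k)))))}
            ≤ ENNReal.ofReal (C / (n : ℝ) ^ 2) := by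
  obtain ⟨H₀, C, hH₀, hC, hprob⟩ := DiagKernel.measure_not_goodSample_le σ hCeigf (Binf := Binf)
    hκ hBspn hs₀ hBsig
  obtain ⟨c₁, C₁, C₂, C₃, hc₁, hC₁, hC₂, hC₃, N, hN⟩ := DiagKernel.flow_of_goodSample D hs hCeigf
    hH₀ hceig hCeig hγ (Binf := Binf) hκ hBspn hs₀ hBsig hct hCt hcb hCb
  refine ⟨c₁, C₁, C₂, C₃, C, hc₁, hC₁, hC₂, hC₃, hC, max N 3, ?_⟩
  intro X _ μ _ e lam fstar ν _ he hsys hf hθ hν n hn t b₀ ht1 ht2 hb1 hb2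
  -- Every sample violating the conclusion fails to be good; monotonicity of the measure needs no
  -- measurability of either event.
  refine le_trans (MeasureTheory.measure_mono ?_)
    (hprob X μ e fstar ν he hsys.bounded hf hθ hν n ((le_max_right _ _).trans hn))
  intro z hz hgood
  exact hz (hN X e lam fstar _ hsys.lower hsys.upper hθ n ((le_max_left _ _).trans hn) t b₀ ht1 ht2
    hb1 hb2 z hgood)
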